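/- Let $P$ be a family of $n\ge 2$ points in the plane with binary measurements $y(p)\in\{0,1\}$. For $S\subseteq P$ let $|S|$ be the number of its points and $y(S)$ the number of its points with measurement $1$. Put $G=y(P)/n$, $m_S=y(S)/y(P)$, $b_S=|S|/n$, and define the Bernoulli scan statistic, for a fixed constant $c>0$, by $d_B(S)=c\,f_B(m_S,b_S)$, where $$f_B(x,y)=x\log\frac{x}{y}+(1-x)\log\frac{1-x}{1-y}+\Bigl(\frac{y}{G}-x\Bigr)\log\Bigl(1-G\frac{x}{y}\Bigr)+\Bigl(\frac{1-y}{G}-1+x\Bigr)\log\Bigl(1-G\,\frac{1-x}{1-y}\Bigr)$$ with $0\log 0=0$. For a fixed constant $C>0$, call $S$ supported if $(m_S,b_S)\in[C/n,\,1-C/n]^2$. The model of computation is the real RAM: unit-cost exact arithmetic $+,-,\times,\div$, comparisons and $\log$ on reals, addition and truncated subtraction on natural numbers, which also serve as addresses of memory cells. **Theorem.** Let $C,c>0$ be fixed constants; the programs and the constants hidden in $O(\cdot)$ may depend on $C$ and $c$ only. 1. There is a real RAM program that, given $\epsilon>0$, the constants $C,c$, and $P$ with its measurements, halts after $O\bigl(\max(1,\tfrac1\epsilon)\,n^2\log^2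 n\bigr)$ steps. Whenever some closed axis-parallel rectangle $R$ has $R\cap P$ supported, the program outputs such a rectangle $R^*$ together with $d_B(R^*\cap P)$, and $d_B(R\cap P)\le d_B(R^*\cap P)+\epsilon$ for every rectangle $R$ with $R\cap P$ supported. 2. If the points also carry real time stamps $t(p)$, there is a real RAM program that halts after $O\bigl(\max(1,\tfrac1\epsilon)\,n^3\log^2 n\bigr)$ steps and solves the same problem for the prospective regions $R\times[\tau,\infty)$, containing the points $p\in R\cap P$ with $t(p)\ge\tau$, where $R$ ranges over the closed axis-parallel rectangles and $\tau$ over the real numbers; it outputs a supported region $R^*\times[\tau^*,\infty)$ and its discrepancy, which is within $\epsilon$ of the maximum over the supported regions, whenever a supported region exists. For $\epsilon\le 1$ the bounds read $O(\tfrac1\epsilon n^2\log^2 n)$ and $O(\tfrac1\epsilon n^3\log^2 n)$. -/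

import Mathlib

/-! ## Real RAM with a step count

Programs of a real random access machine: natural-number arrays (with addition and truncated
subtraction, also used as addresses) and real arrays (with exact `+ - * /`, comparison and the
natural logarithm).  There is no conversion from reals to integers.  Every array is addressed
indirectly at unit cost, and every operation and every elementary command costs one step.
A program mentions only finitely many arrays and only natural-number constants. -/

namespace RealRAM

/-- Contents of the memory: `nat a i` and `real a i` are the entries number `i` of the
natural-number array and of the real array with name `a`. -/
structure Memory where
  nat : ℕ → ℕ → ℕ
  real : ℕ → ℕ → ℝ

/-- Natural-number expressions. -/
inductive NatExpr where
  | lit (k : ℕ)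
  | get (a : ℕ) (i : NatExpr)
  | add (e₁ e₂ : NatExpr)
  | sub (e₁ e₂ : NatExpr)

/-- Real expressions. -/
inductive RealExpr where
  | ofNat (e : NatExpr)
  | get (a : ℕ) (i : NatExpr)
  | add (e₁ e₂ : RealExpr)
  | sub (e₁ e₂ : RealExpr)
  | mul (e₁ e₂ : RealExpr)
  | div (e₁ e₂ : RealExpr)
  | log (e : RealExpr)

/-- Boolean tests. -/
inductive Cond where
  | natLt (e₁ e₂ : NatExpr)
  | realLt (e₁ e₂ : RealExpr)
  | not (b : Cond)
  | and (b₁ b₂ : Cond)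

/-- Programs. -/
inductive Prog where
  | skip
  | setNat (a : ℕ) (i e : NatExpr)
  | setReal (a : ℕ) (i : NatExpr) (e : RealExpr)
  | seq (p₁ p₂ : Prog)
  | ite (b : Cond) (p₁ p₂ : Prog)
  | loop (b : Cond) (p : Prog)

/-- Value of a natural-number expression. -/
def NatExpr.eval (s : Memory) : NatExpr → ℕ
  | .lit k => k
  | .get a i => s.nat a (i.eval s)
  | .add e₁ e₂ => e₁.eval s + e₂.eval s
  | .sub e₁ e₂ => e₁.eval s - e₂.eval s

/-- Number of operations performed when evaluating a natural-number expression. -/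
def NatExpr.cost : NatExpr → ℕ
  | .lit _ => 1
  | .get _ i => i.cost + 1
  | .add e₁ e₂ => e₁.cost + e₂.cost + 1
  | .sub e₁ e₂ => e₁.cost + e₂.cost + 1

/-- Value of a real expression. -/
noncomputable def RealExpr.eval (s : Memory) : RealExpr → ℝ
  | .ofNat e => (e.eval s : ℝ)
  | .get a i => s.real a (i.eval s)
  | .add e₁ e₂ => e₁.eval s + e₂.eval s
  | .sub e₁ e₂ => e₁.eval s - e₂.eval s
  | .mul e₁ e₂ => e₁.eval s * e₂.eval s
  | .div e₁ e₂ => e₁.eval s / e₂.eval s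
  | .log e => Real.log (e.eval s)

/-- Number of operations performed when evaluating a real expression. -/
def RealExpr.cost : RealExpr → ℕ
  | .ofNat e => e.cost + 1
  | .get _ i => i.cost + 1
  | .add e₁ e₂ => e₁.cost + e₂.cost + 1
  | .sub e₁ e₂ => e₁.cost + e₂.cost + 1
  | .mul e₁ e₂ => e₁.cost + e₂.cost + 1
  | .div e₁ e₂ => e₁.cost + e₂.cost + 1
  | .log e => e.cost + 1

/-- Truth of a test. -/
def Cond.Holds (s : Memory) : Cond → Prop
  | .natLt e₁ e₂ => e₁.eval s < e₂.eval s
  | .realLt e₁ e₂ => e₁.eval s < e₂.eval s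
  | .not b => ¬ b.Holds s
  | .and b₁ b₂ => b₁.Holds s ∧ b₂.Holds s

/-- Number of operations performed when evaluating a test. -/
def Cond.cost : Cond → ℕ
  | .natLt e₁ e₂ => e₁.cost + e₂.cost + 1
  | .realLt e₁ e₂ => e₁.cost + e₂.cost + 1
  | .not b => b.cost + 1
  | .and b₁ b₂ => b₁.cost + b₂.cost + 1

/-- Overwrite one entry of a natural-number array. -/
def Memory.writeNat (s : Memory) (a i v : ℕ) : Memory where
  nat := Function.update s.nat a (Function.update (s.nat a) i v)
  real := s.real

/-- Overwrite one entry of a real array. -/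
noncomputable def Memory.writeReal (s : Memory) (a i : ℕ) (v : ℝ) : Memory where
  nat := s.nat
  real := Function.update s.real a (Function.update (s.real a) i v)

/-- `Runs p s s' T`: started in memory `s`, the program `p` halts in memory `s'` after exactly
`T` steps. -/
inductive Runs : Prog → Memory → Memory → ℕ → Prop
  | skip (s : Memory) : Runs .skip s s 1
  | setNat (a : ℕ) (i e : NatExpr) (s : Memory) :
      Runs (.setNat a i e) s (s.writeNat a (i.eval s) (e.eval s)) (i.cost + e.cost + 1)
  | setReal (a : ℕ) (i : NatExpr) (e : RealExpr) (s : Memory) :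
      Runs (.setReal a i e) s (s.writeReal a (i.eval s) (e.eval s)) (i.cost + e.cost + 1)
  | seq {p₁ p₂ : Prog} {s s' s'' : Memory} {T₁ T₂ : ℕ}
      (h₁ : Runs p₁ s s' T₁) (h₂ : Runs p₂ s' s'' T₂) :
      Runs (.seq p₁ p₂) s s'' (T₁ + T₂)
  | ite_true {b : Cond} {p₁ p₂ : Prog} {s s' : Memory} {T : ℕ}
      (hb : b.Holds s) (h : Runs p₁ s s' T) :
      Runs (.ite b p₁ p₂) s s' (b.cost + 1 + T)
  | ite_false {b : Cond} {p₁ p₂ : Prog} {s s' : Memory} {T : ℕ}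
      (hb : ¬ b.Holds s) (h : Runs p₂ s s' T) :
      Runs (.ite b p₁ p₂) s s' (b.cost + 1 + T)
  | loop_false {b : Cond} {p : Prog} {s : Memory} (hb : ¬ b.Holds s) :
      Runs (.loop b p) s s (b.cost + 1)
  | loop_true {b : Cond} {p : Prog} {s s' s'' : Memory} {T₁ T₂ : ℕ}
      (hb : b.Holds s) (h₁ : Runs p s s' T₁) (h₂ : Runs (.loop b p) s' s'' T₂) :
      Runs (.loop b p) s s'' (b.cost + 1 + T₁ + T₂)

end RealRAM

/-! ## The Bernoulli scan statistic -/

namespace BernoulliScan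

/-- The function `f_B(x, y)` with overall success rate `G`; here `x` is the fraction `m_R` of the
measurement and `y` the fraction `b_R` of the baseline.  With `Real.log 0 = 0`, a term whose
coefficient and logarithm's argument vanish together has its limit value `0`. -/
noncomputable def fB (G x y : ℝ) : ℝ :=
  x * Real.log (x / y) + (1 - x) * Real.log ((1 - x) / (1 - y))
    + (y / G - x) * Real.log (1 - G * (x / y))
    + ((1 - y) / G - 1 + x) * Real.log (1 - G * ((1 - x) / (1 - y)))

/-- Number of `1`s among the points of `S`, for binary measurements `y`. -/
def ones {n : ℕ} (y : Fin n → Bool) (S : Finset (Fin n)) : ℕ :=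
  (S.filter (fun i => y i = true)).card

/-- Overall success rate `G`. -/
noncomputable def rate {n : ℕ} (y : Fin n → Bool) : ℝ := (ones y Finset.univ : ℝ) / n

/-- `m_R`: the fraction of the total measurement contained in `S`. -/
noncomputable def mFrac {n : ℕ} (y : Fin n → Bool) (S : Finset (Fin n)) : ℝ :=
  (ones y S : ℝ) / (ones y Finset.univ : ℝ)

/-- `b_R`: the fraction of the points contained in `S` (counting measure as baseline). -/
noncomputable def bFrac {n : ℕ} (S : Finset (Fin n)) : ℝ := (S.card : ℝ) / n

/-- The Bernoulli discrepancy `d_B` of the point set `S`, with normalizing constant `c`. -/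
noncomputable def dB {n : ℕ} (c : ℝ) (y : Fin n → Bool) (S : Finset (Fin n)) : ℝ :=
  c * fB (rate y) (mFrac y S) (bFrac S)

/-- Minimum level of support: `(m_R, b_R)` lies in the square `[C/n, 1 - C/n]²`. -/
def Supported {n : ℕ} (C : ℝ) (y : Fin n → Bool) (S : Finset (Fin n)) : Prop :=
  mFrac y S ∈ Set.Icc (C / n) (1 - C / n) ∧ bFrac S ∈ Set.Icc (C / n) (1 - C / n)

open Classical in
/-- The points in the closed axis-parallel rectangle `[p.1, q.1] × [p.2, q.2]`. -/
noncomputable def inRect {n : ℕ} (pos : Fin n → ℝ × ℝ) (p q : ℝ × ℝ) : Finset (Fin n) :=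
  Finset.univ.filter (fun i => pos i ∈ Set.Icc p q)

open Classical in
/-- The points in the rectangle `[p.1, q.1] × [p.2, q.2]` with time stamp in `[τ, ∞)`. -/
noncomputable def inWindow {n : ℕ} (pos : Fin n → ℝ × ℝ) (t : Fin n → ℝ) (p q : ℝ × ℝ)
    (τ : ℝ) : Finset (Fin n) :=
  Finset.univ.filter (fun i => pos i ∈ Set.Icc p q ∧ τ ≤ t i)

/-- The array that holds a finite sequence, with a default entry beyond its end. -/
def toArray {α : Type} {n : ℕ} (default : α) (f : Fin n → α) (i : ℕ) : α :=
  if h : i < n then f ⟨i, h⟩ else default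

/-- Initial memory.  Natural-number array `0` holds `n` in entry `0`, array `1` the binary
measurements.  Real arrays `0`, `1`, `2` hold the first coordinates, the second coordinates and
the time stamps, array `3` holds `ε, C, c`.  Everything else is `0`. -/
noncomputable def load {n : ℕ} (ε C c : ℝ) (pos : Fin n → ℝ × ℝ) (t : Fin n → ℝ)
    (y : Fin n → Bool) : RealRAM.Memory where
  nat a i :=
    match a with
    | 0 => if i = 0 then n else 0
    | 1 => toArray 0 (fun j => if y j = true then 1 else 0) i
    | _ => 0
  real a i :=
    match a with
    | 0 => toArray 0 (fun j => (pos j).1) i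
    | 1 => toArray 0 (fun j => (pos j).2) i
    | 2 => toArray 0 t i
    | 3 => if i = 0 then ε else if i = 1 then C else if i = 2 then c else 0
    | _ => 0

/-- Lower left corner of the output rectangle, read from entries `0, 1` of real array `4`. -/
def outLow (s : RealRAM.Memory) : ℝ × ℝ := (s.real 4 0, s.real 4 1)

/-- Upper right corner of the output rectangle, read from entries `2, 3` of real array `4`. -/
def outHigh (s : RealRAM.Memory) : ℝ × ℝ := (s.real 4 2, s.real 4 3)

/-- Reported discrepancy value, read from entry `4` of real array `4`. -/
def outValue (s : RealRAM.Memory) : ℝ := s.real 4 4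

/-- Start of the output time window, read from entry `5` of real array `4`. -/
def outTime (s : RealRAM.Memory) : ℝ := s.real 4 5

/-- The memory `s` holds an additive `ε`-approximation to the maximum of `d_B` over all
axis-parallel rectangles with minimum support: if there is such a rectangle at all, then a
rectangle of this kind whose discrepancy is within `ε` of the maximum, and its discrepancy. -/
def IsApprox {n : ℕ} (ε C c : ℝ) (pos : Fin n → ℝ × ℝ) (y : Fin n → Bool)
    (s : RealRAM.Memory) : Prop :=
  (∃ p q, Supported C y (inRect pos p q)) →
    Supported C y (inRect pos (outLow s) (outHigh s)) ∧
    outValue s = dB c y (inRect pos (outLow s) (outHigh s)) ∧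
    ∀ p q, Supported C y (inRect pos p q) → dB c y (inRect pos p q) ≤ outValue s + ε

/-- The same for prospective regions `[p.1, q.1] × [p.2, q.2] × [τ, ∞)`. -/
def IsProspectiveApprox {n : ℕ} (ε C c : ℝ) (pos : Fin n → ℝ × ℝ) (t : Fin n → ℝ)
    (y : Fin n → Bool) (s : RealRAM.Memory) : Prop :=
  (∃ p q τ, Supported C y (inWindow pos t p q τ)) →
    Supported C y (inWindow pos t (outLow s) (outHigh s) (outTime s)) ∧
    outValue s = dB c y (inWindow pos t (outLow s) (outHigh s) (outTime s)) ∧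
    ∀ p q τ, Supported C y (inWindow pos t p q τ) →
      dB c y (inWindow pos t p q τ) ≤ outValue s + ε

end BernoulliScan

/-! Let `A` be the number of ones and `G = A / n`. For a set of `s` points with `a` ones, `A * fB`
equals `phi s a + phi (n - s) (A - a)` up to an additive constant (`fB_eq`), where `phi s a` is the
log-likelihood of `a` successes in `s` trials at the best success rate. Being a supremum over
success rates, `phi` lies above its tangent planes. The plane for odds `r` is `a log r - s log (1 +
r)`; its gap to `phi` is a Kullback–Leibler divergence, hence at most the chi-square divergence
`loss s a r = (a - r (s - a))² / (s r)` (`phi_lower`, `phi_upper`). Fix odds `r` for a set and `t`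
for its complement. The sum of the two planes is affine in `(a, s)`, and any set with at least as
large an affine value loses at most `c * E / A` in discrepancy against a set whose two losses sum to
at most `E` (`disc_le`). Two tasks remain: find few pairs of odds that serve all counts, and
maximize a linear function over supported rectangles quickly.

Odds. The loss behaves like the squared relative change of `r`, weighted by the counts. For the side
(set or complement) with at most `n / 2` points, the odds lie in `[1/n, n]` or are infinite, and a
geometric grid of ratio `1 + 1/M` with `O(M log n)` values costs at most `A / M²`. The other side
has at least `n / 2` points, so its odds are at least `1` or at most `4 G`; a grid with equally
spaced square roots, of the odds or of their reciprocals, needs only `2 M` values and costs at most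
`16 A / M²`. Only one factor carries a logarithm, so `O(M² log n)` pairs, used in both orders, bring
the error down to `17 c / M²` (`exists_direction`), and `M²` of order `max 1 (1/ε)` suffices.

Linear maximization. Fix the left side and the time window and let the right side advance through
the points. The leaves of a segment tree are the ranks of the second coordinates, and a rectangle is
a monotone labelling of leaves as below, inside or above. For each block and each key, the tree
stores an optimal labelling. The objective is additive, so the optimum of a block is assembled from
its halves once keys contain the first and last label (`Good.combine`). Support asks whether four
counts (points and ones, inside and outside) reach thresholds not exceeding `C`; counts capped at
`⌈C⌉` decide this (`supp_of_caps_eq`), so the number of keys depends on `C` only. An insertion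
recomputes one path to the root in `O(log n)` steps. One sweep over all pairs of sides thus costs
`O(n² log n)` per time window.

At every right side that ends a group of equal coordinates, the true discrepancy of all supported
root entries is evaluated and the best region kept, so the final region dominates the linear optimum
of every direction. The scan takes `O(max(1, 1/ε) n² log² n)` steps, and `n` times as many when all
time stamps serve as window starts.

In the formal argument every loop has an invariant together with a step bound (`wp`). The arrays are
numbered along the nesting of the main loops, so that the body of a loop writes only to arrays with
larger numbers than its counter; frames are then mostly sets `Set.Ici i`. -/

namespace RealRAM

/-! ### Reasoning about programs -/

/-- Started in `s`, the program halts within `B` steps in a memory satisfying `Q`. -/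
def wp (p : Prog) (Q : Memory → Prop) (s : Memory) (B : ℕ) : Prop :=
  ∃ s' T, Runs p s s' T ∧ T ≤ B ∧ Q s'

theorem wp.mono {p : Prog} {Q Q' : Memory → Prop} {s : Memory} {B B' : ℕ} (h : wp p Q s B)
    (hQ : ∀ s', Q s' → Q' s') (hB : B ≤ B') : wp p Q' s B' := by
  obtain ⟨s', T, h1, h2, h3⟩ := h
  exact ⟨s', T, h1, h2.trans hB, hQ _ h3⟩

theorem wp_seq {p q : Prog} {Q R : Memory → Prop} {s : Memory} {B₁ B₂ : ℕ}
    (h₁ : wp p R s B₁) (h₂ : ∀ s', R s' → wp q Q s' B₂) : wp (.seq p q) Q s (B₁ + B₂) := by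
  obtain ⟨s', T, h1, h2, h3⟩ := h₁
  obtain ⟨s'', T', h1', h2', h3'⟩ := h₂ s' h3
  exact ⟨s'', T + T', .seq h1 h1', by omega, h3'⟩

theorem wp_skip {Q : Memory → Prop} {s : Memory} (h : Q s) : wp .skip Q s 1 :=
  ⟨s, 1, .skip s, le_rfl, h⟩

theorem wp_ite {b : Cond} {p q : Prog} {Q : Memory → Prop} {s : Memory} {B : ℕ}
    (h₁ : b.Holds s → wp p Q s B) (h₂ : ¬ b.Holds s → wp q Q s B) :
    wp (.ite b p q) Q s (b.cost + 1 + B) := by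
  by_cases hb : b.Holds s
  · obtain ⟨s', T, h1, h2, h3⟩ := h₁ hb
    exact ⟨s', _, .ite_true hb h1, by omega, h3⟩
  · obtain ⟨s', T, h1, h2, h3⟩ := h₂ hb
    exact ⟨s', _, .ite_false hb h1, by omega, h3⟩

/-- The potential `f` drops in every round and so bounds the number of rounds. The summand `b.cost +
1` at the end pays for the failing test. -/
theorem wp_loop {b : Cond} {p : Prog} {B : ℕ} (Inv : Memory → Prop) (f : Memory → ℕ)
    (hb : ∀ s, Inv s → b.Holds s → wp p (fun s' => Inv s' ∧ f s' < f s) s B) :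
    ∀ s, Inv s → wp (.loop b p) (fun s' => Inv s' ∧ ¬ b.Holds s') s
      (f s * (b.cost + 1 + B) + (b.cost + 1)) := by
  intro s
  induction hn : f s using Nat.strong_induction_on generalizing s with
  | _ N ih =>
    intro hs
    by_cases h : b.Holds s
    · obtain ⟨s', T, h1, h2, h3, h4⟩ := hb s hs h
      obtain ⟨s'', T', h1', h2', h3'⟩ := ih (f s') (hn ▸ h4) s' rfl h3
      refine ⟨s'', _, .loop_true h h1 h1', ?_, h3'⟩
      have : (f s' + 1) * (b.cost + 1 + B) ≤ N * (b.cost + 1 + B) :=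
        Nat.mul_le_mul_right _ (by omega)
      rw [Nat.add_mul] at this
      omega
    · exact ⟨s, _, .loop_false h, by omega, hs, h⟩

/-! ### Frames -/

/-- Every array to which the program writes belongs to `S`. -/
def Prog.WritesIn (S : Set ℕ) : Prog → Prop
  | .skip => True
  | .setNat a _ _ => a ∈ S
  | .setReal a _ _ => a ∈ S
  | .seq p q => p.WritesIn S ∧ q.WritesIn S
  | .ite _ p q => p.WritesIn S ∧ q.WritesIn S
  | .loop _ p => p.WritesIn S

theorem Prog.WritesIn.mono {S S' : Set ℕ} (h : S ⊆ S') :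
    ∀ {p : Prog}, p.WritesIn S → p.WritesIn S'
  | .skip, _ => trivial
  | .setNat _ _ _, hp => h hp
  | .setReal _ _ _, hp => h hp
  | .seq _ _, hp => ⟨hp.1.mono h, hp.2.mono h⟩
  | .ite _ _ _, hp => ⟨hp.1.mono h, hp.2.mono h⟩
  | .loop _ p, hp => Prog.WritesIn.mono (p := p) h hp

/-- The two memories agree on all arrays outside `S`. -/
def AgreeOff (S : Set ℕ) (s s' : Memory) : Prop :=
  ∀ a, a ∉ S → s'.nat a = s.nat a ∧ s'.real a = s.real a

theorem AgreeOff.refl (S : Set ℕ) (s : Memory) : AgreeOff S s s := fun _ _ => ⟨rfl, rfl⟩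

theorem AgreeOff.trans {S : Set ℕ} {s s' s'' : Memory} (h : AgreeOff S s s')
    (h' : AgreeOff S s' s'') : AgreeOff S s s'' := fun a ha =>
  ⟨(h' a ha).1.trans (h a ha).1, (h' a ha).2.trans (h a ha).2⟩

theorem AgreeOff.mono {S S' : Set ℕ} {s s' : Memory} (h : AgreeOff S s s') (hS : S ⊆ S') :
    AgreeOff S' s s' := fun a ha => h a fun h' => ha (hS h')

theorem Memory.writeNat_nat (s : Memory) (a i v b j : ℕ) :
    (s.writeNat a i v).nat b j = if b = a ∧ j = i then v else s.nat b j := by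
  by_cases h : b = a
  · subst h
    by_cases h' : j = i
    · subst h'; simp [Memory.writeNat]
    · simp [Memory.writeNat, h']
  · simp [Memory.writeNat, h]

theorem Memory.writeReal_real (s : Memory) (a i : ℕ) (v : ℝ) (b j : ℕ) :
    (s.writeReal a i v).real b j = if b = a ∧ j = i then v else s.real b j := by
  by_cases h : b = a
  · subst h
    by_cases h' : j = i
    · subst h'; simp [Memory.writeReal]
    · simp [Memory.writeReal, h']
  · simp [Memory.writeReal, h]

theorem Memory.writeNat_nat_of_ne (s : Memory) {a i v b : ℕ} (h : b ≠ a) :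
    (s.writeNat a i v).nat b = s.nat b := by
  simp [Memory.writeNat, h]

theorem Memory.writeReal_real_of_ne (s : Memory) {a i : ℕ} {v : ℝ} {b : ℕ} (h : b ≠ a) :
    (s.writeReal a i v).real b = s.real b := by
  simp [Memory.writeReal, h]

@[simp] theorem Memory.writeNat_real (s : Memory) (a i v : ℕ) :
    (s.writeNat a i v).real = s.real := rfl

@[simp] theorem Memory.writeReal_nat (s : Memory) (a i : ℕ) (v : ℝ) :
    (s.writeReal a i v).nat = s.nat := rfl

theorem AgreeOff.writeNat {S : Set ℕ} {s s' : Memory} {a i v : ℕ} (h : AgreeOff S s s')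
    (ha : a ∈ S) : AgreeOff S s (s'.writeNat a i v) := fun b hb => by
  have hne : b ≠ a := fun h' => hb (h' ▸ ha)
  exact ⟨(s'.writeNat_nat_of_ne hne).trans (h b hb).1, (h b hb).2⟩

theorem AgreeOff.writeReal {S : Set ℕ} {s s' : Memory} {a i : ℕ} {v : ℝ} (h : AgreeOff S s s')
    (ha : a ∈ S) : AgreeOff S s (s'.writeReal a i v) := fun b hb => by
  have hne : b ≠ a := fun h' => hb (h' ▸ ha)
  exact ⟨(h b hb).1, (s'.writeReal_real_of_ne hne).trans (h b hb).2⟩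

theorem Runs.agreeOff {S : Set ℕ} {p : Prog} {s s' : Memory} {T : ℕ} (h : Runs p s s' T)
    (hp : p.WritesIn S) : AgreeOff S s s' := by
  induction h with
  | skip s => exact .refl _ _
  | setNat a i e s => exact (AgreeOff.refl _ _).writeNat hp
  | setReal a i e s => exact (AgreeOff.refl _ _).writeReal hp
  | seq _ _ ih₁ ih₂ => exact (ih₁ hp.1).trans (ih₂ hp.2)
  | ite_true _ _ ih => exact ih hp.1
  | ite_false _ _ ih => exact ih hp.2
  | loop_false _ => exact .refl _ _
  | loop_true _ _ _ ih₁ ih₂ => exact (ih₁ hp).trans (ih₂ hp)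

/-- Invariants need to speak only about the arrays that a program may change; this recovers
everything else from the program text. -/
theorem wp.frame {S : Set ℕ} {p : Prog} {Q : Memory → Prop} {s : Memory} {B : ℕ}
    (h : wp p Q s B) (hp : p.WritesIn S) : wp p (fun s' => Q s' ∧ AgreeOff S s s') s B := by
  obtain ⟨s', T, h1, h2, h3⟩ := h
  exact ⟨s', T, h1, h2, h3, h1.agreeOff hp⟩

/-! ### Loop-free programs -/

/-- The program contains no loop. -/
def Prog.LoopFree : Prog → Prop
  | .skip => True
  | .setNat _ _ _ => True
  | .setReal _ _ _ => True
  | .seq p q => p.LoopFree ∧ q.LoopFree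
  | .ite _ p q => p.LoopFree ∧ q.LoopFree
  | .loop _ _ => False

open Classical in
/-- The effect of a loop-free program. -/
noncomputable def Prog.exec : Prog → Memory → Memory
  | .skip, s => s
  | .setNat a i e, s => s.writeNat a (i.eval s) (e.eval s)
  | .setReal a i e, s => s.writeReal a (i.eval s) (e.eval s)
  | .seq p q, s => q.exec (p.exec s)
  | .ite b p q, s => if b.Holds s then p.exec s else q.exec s
  | .loop _ _, s => s

/-- A bound for the number of steps of a loop-free program. -/
def Prog.bound : Prog → ℕ
  | .skip => 1
  | .setNat _ i e => i.cost + e.cost + 1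
  | .setReal _ i e => i.cost + e.cost + 1
  | .seq p q => p.bound + q.bound
  | .ite b p q => b.cost + 1 + (p.bound + q.bound)
  | .loop _ _ => 0

theorem Prog.LoopFree.runs : ∀ {p : Prog}, p.LoopFree → ∀ s, ∃ T ≤ p.bound,
    Runs p s (p.exec s) T
  | .skip, _, s => ⟨_, le_rfl, .skip s⟩
  | .setNat a i e, _, s => ⟨_, le_rfl, .setNat a i e s⟩
  | .setReal a i e, _, s => ⟨_, le_rfl, .setReal a i e s⟩
  | .seq p q, h, s => by
    obtain ⟨T, hT, hr⟩ := h.1.runs s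
    obtain ⟨T', hT', hr'⟩ := h.2.runs (p.exec s)
    exact ⟨_, by simp only [Prog.bound]; omega, .seq hr hr'⟩
  | .ite b p q, h, s => by
    by_cases hb : b.Holds s
    · obtain ⟨T, hT, hr⟩ := h.1.runs s
      refine ⟨b.cost + 1 + T, by simp only [Prog.bound]; omega, ?_⟩
      simp only [Prog.exec, hb, if_true]
      exact .ite_true hb hr
    · obtain ⟨T, hT, hr⟩ := h.2.runs s
      refine ⟨b.cost + 1 + T, by simp only [Prog.bound]; omega, ?_⟩
      simp only [Prog.exec, hb, if_false]
      exact .ite_false hb hr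
  | .loop _ _, h, _ => h.elim

theorem Prog.LoopFree.wp {p : Prog} (hp : p.LoopFree) {Q : Memory → Prop} {s : Memory}
    (h : Q (p.exec s)) : wp p Q s p.bound := by
  obtain ⟨T, hT, hr⟩ := hp.runs s
  exact ⟨_, T, hr, hT, h⟩

theorem Prog.LoopFree.agreeOff {S : Set ℕ} {p : Prog} (hp : p.LoopFree) (hS : p.WritesIn S)
    (s : Memory) : AgreeOff S s (p.exec s) := by
  obtain ⟨T, _, hr⟩ := hp.runs s
  exact hr.agreeOff hS

/-- Sequential composition of a list of programs. -/
def block (l : List Prog) : Prog := l.foldr .seq .skip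

@[simp] theorem block_nil : block [] = .skip := rfl

@[simp] theorem block_cons (p : Prog) (l : List Prog) : block (p :: l) = .seq p (block l) := rfl

theorem exec_block (l : List Prog) (s : Memory) :
    (block l).exec s = l.foldl (fun s p => p.exec s) s := by
  induction l generalizing s with
  | nil => rfl
  | cons p l ih => exact ih _

theorem loopFree_block {l : List Prog} (h : ∀ p ∈ l, p.LoopFree) : (block l).LoopFree := by
  induction l with
  | nil => trivial
  | cons p l ih => exact ⟨h p (by simp), ih fun q hq => h q (by simp [hq])⟩

theorem writesIn_block {S : Set ℕ} {l : List Prog} (h : ∀ p ∈ l, p.WritesIn S) :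
    (block l).WritesIn S := by
  induction l with
  | nil => trivial
  | cons p l ih => exact ⟨h p (by simp), ih fun q hq => h q (by simp [hq])⟩

/-- Serves straight-line code generated from a list: the invariant is indexed by the prefix that has
already been executed. -/
theorem foldl_invariant {α : Type*} {σ : Type*} (f : σ → α → σ) (I : List α → σ → Prop) {s : σ}
    (h0 : I [] s) : ∀ l : List α,
    (∀ l' x s', x ∈ l → I l' s' → I (l' ++ [x]) (f s' x)) → I l (l.foldl f s) := by
  intro l
  induction l using List.reverseRecOn with
  | nil => intro _; exact h0
  | append_singleton l x ih =>
    intro h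
    rw [List.foldl_append]
    exact h _ _ _ (by simp) (ih fun l' y s' hy => h l' y s' (by simp [hy]))

/-! ### Counting loops -/

/-- The scalar stored in entry `0` of the natural-number array `a`. -/
abbrev nvar (a : ℕ) : NatExpr := .get a (.lit 0)

/-- Increment of a scalar. -/
abbrev incr (a : ℕ) : Prog := .setNat a (.lit 0) (.add (nvar a) (.lit 1))

/-- `for i < N do p`, the counter being the scalar `i`. -/
def forLoop (i : ℕ) (N : NatExpr) (p : Prog) : Prog :=
  .seq (.setNat i (.lit 0) (.lit 0)) (.loop (.natLt (nvar i) N) (.seq p (incr i)))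

theorem forLoop_writesIn {S : Set ℕ} {i : ℕ} {N : NatExpr} {p : Prog} (hi : i ∈ S)
    (hp : p.WritesIn S) : (forLoop i N p).WritesIn S := ⟨hi, hp, hi⟩

/-- The bound `N` is re-evaluated in each round, hence the requirement that it be constant under
changes of the counter and of `S`. The invariant for `k + 1` is demanded after the increment.
Besides `B`, a round pays `N.cost + 4` for the test and `6` for the increment. -/
theorem wp_forLoop {i : ℕ} {N : NatExpr} {p : Prog} {B : ℕ} {s : Memory} {S : Set ℕ} (K : ℕ)
    (Inv : ℕ → Memory → Prop) (hiS : i ∉ S)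
    (hN : ∀ s', AgreeOff (insert i S) s s' → N.eval s' = K)
    (hp : p.WritesIn S)
    (h0 : Inv 0 (s.writeNat i 0 0))
    (hb : ∀ k < K, ∀ s', AgreeOff (insert i S) s s' → s'.nat i 0 = k → Inv k s' →
      wp p (fun s'' => Inv (k + 1) (s''.writeNat i 0 (k + 1))) s' B) :
    wp (forLoop i N p) (fun s' => Inv K s' ∧ AgreeOff (insert i S) s s') s
      (K * (B + N.cost + 10) + N.cost + 8) := by
  have hi : i ∈ insert i S := Set.mem_insert _ _
  let J : Memory → Prop := fun s' =>
    AgreeOff (insert i S) s s' ∧ s'.nat i 0 ≤ K ∧ Inv (s'.nat i 0) s'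
  have hloop := wp_loop (b := .natLt (nvar i) N) (p := .seq p (incr i)) (B := B + 6) J
    (fun s' => K - s'.nat i 0) (by
      rintro s' ⟨h1, h2, h3⟩ hlt
      have hlt' : s'.nat i 0 < K := by
        have := hlt
        simp only [Cond.Holds, NatExpr.eval, hN s' h1] at this
        exact this
      have hw := (hb _ hlt' s' h1 rfl h3).frame hp
      refine wp_seq hw ?_
      rintro s'' ⟨h4, h5⟩
      have h6 : s''.nat i 0 = s'.nat i 0 := by rw [(h5 i hiS).1]
      have h7 : AgreeOff (insert i S) s s'' :=
        h1.trans (h5.mono (Set.subset_insert _ _))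
      refine ⟨_, _, .setNat _ _ _ _, by simp [NatExpr.cost], ?_⟩
      simp only [NatExpr.eval, h6]
      refine ⟨⟨h7.writeNat hi, ?_, ?_⟩, ?_⟩
      · simp [Memory.writeNat_nat]; omega
      · simpa [Memory.writeNat_nat] using h4
      · simp [Memory.writeNat_nat]; omega)
  have h1 : J (s.writeNat i 0 0) :=
    ⟨(AgreeOff.refl _ _).writeNat hi, by simp [Memory.writeNat_nat],
      by simpa [Memory.writeNat_nat] using h0⟩
  have h2 := hloop _ h1
  refine wp.mono (wp_seq (R := fun s' => s' = s.writeNat i 0 0) (B₁ := 3) ?_ ?_)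
    (Q := fun s' => J s' ∧ ¬ Cond.Holds s' (.natLt (nvar i) N))
    (B := 3 + (K * (B + N.cost + 10) + N.cost + 5)) ?_ (by omega)
  · exact ⟨_, _, .setNat _ _ _ _, by simp [NatExpr.cost], rfl⟩
  · rintro _ rfl
    refine h2.mono (fun _ h => h) ?_
    simp only [Memory.writeNat_nat, Cond.cost, NatExpr.cost, and_self, if_true, Nat.sub_zero]
    have h' : 1 + 1 + N.cost + 1 + 1 + (B + 6) = B + N.cost + 10 := by ring
    rw [h']
    omega
  · rintro s' ⟨⟨h3, h4, h5⟩, h6⟩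
    simp only [Cond.Holds, NatExpr.eval, hN s' h3, not_lt] at h6
    have : s'.nat i 0 = K := le_antisymm h4 h6
    exact ⟨this ▸ h5, h3⟩

end RealRAM

namespace RectScan
open RealRAM

/-! ### Tables of best configurations -/

/-- A vector of counts attached to a labelling of leaves: points inside, ones inside, points
outside, ones outside, points below, points in the inner leaves. -/
abbrev Entry := Fin 6 → ℕ

/-- First label, last label, and the first four counts capped at `k`. -/
abbrev Key (k : ℕ) := (Fin 3 × Fin 3) × (Fin 4 → Fin (k + 1))

/-- The first four counts, capped at `k`. -/
def caps (k : ℕ) (e : Entry) : Fin 4 → Fin (k + 1) := fun i =>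
  ⟨min (e (i.castLE (by omega))) k, by omega⟩

/-- Key of the union of two adjacent blocks. -/
def Key.mul {k : ℕ} (κ₁ κ₂ : Key k) : Key k :=
  ((κ₁.1.1, κ₂.1.2), fun i => ⟨min ((κ₁.2 i : ℕ) + κ₂.2 i) k, by omega⟩)

/-- Number of a key. -/
noncomputable def idx {k : ℕ} (κ : Key k) : ℕ := Fintype.equivFin (Key k) κ

theorem idx_injective {k : ℕ} : Function.Injective (idx : Key k → ℕ) := fun _ _ h =>
  (Fintype.equivFin (Key k)).injective (Fin.ext h)

/-- Name of the array that holds component `i` of the entries with key `κ`; component `6` tells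
whether the entry is present. -/
noncomputable def nm {k : ℕ} (κ : Key k) (i : ℕ) : ℕ := 100 + 7 * idx κ + i

theorem nm_ge {k : ℕ} (κ : Key k) (i : ℕ) : 100 ≤ nm κ i := by unfold nm; omega

theorem ne_nm {k : ℕ} (κ : Key k) (i : ℕ) {a : ℕ} (h : a < 100) : a ≠ nm κ i := by
  have := nm_ge κ i; omega

/-- Each key owns seven consecutive array names, so quotient and remainder by `7` recover key and
component. -/
theorem nm_inj {k : ℕ} {κ κ' : Key k} {i j : ℕ} (hi : i ≤ 6) (hj : j ≤ 6) :
    nm κ i = nm κ' j ↔ κ = κ' ∧ i = j := by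
  constructor
  · intro h
    unfold nm at h
    have h1 : idx κ = idx κ' := by omega
    exact ⟨idx_injective h1, by omega⟩
  · rintro ⟨rfl, rfl⟩; rfl

/-- The table of node `ν`. -/
noncomputable def tab (k : ℕ) (s : Memory) (ν : ℕ) (κ : Key k) : Option Entry :=
  if s.nat (nm κ 6) ν = 0 then none else some fun i => s.nat (nm κ i) ν

/-- The linear functional to be maximized. -/
def val (w : ℝ × ℝ) (e : Entry) : ℝ := w.1 * e 1 + w.2 * e 0

/-- The weights in memory. -/
def weights (s : Memory) : ℝ × ℝ := (s.real 18 0, s.real 18 1)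

/-- The two memories agree except for the temporary entry and the table of node `ν`. -/
structure SameOff (ν : ℕ) (s s' : Memory) : Prop where
  low : ∀ a < 100, a ≠ 60 → s'.nat a = s.nat a
  real : s'.real = s.real
  off : ∀ a j, a ≠ 60 → j ≠ ν → s'.nat a j = s.nat a j

theorem SameOff.refl (ν : ℕ) (s : Memory) : SameOff ν s s :=
  ⟨fun _ _ _ => rfl, rfl, fun _ _ _ _ => rfl⟩

theorem SameOff.trans {ν : ℕ} {s s' s'' : Memory} (h : SameOff ν s s') (h' : SameOff ν s' s'') :
    SameOff ν s s'' :=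
  ⟨fun a h1 h2 => (h'.low a h1 h2).trans (h.low a h1 h2), h'.real.trans h.real,
    fun a j h1 h2 => (h'.off a j h1 h2).trans (h.off a j h1 h2)⟩

theorem SameOff.tab {k ν : ℕ} {s s' : Memory} (h : SameOff ν s s') {j : ℕ} (hj : j ≠ ν) :
    tab k s' j = tab k s j := by
  funext κ
  have h1 : ∀ i, s'.nat (nm κ i) j = s.nat (nm κ i) j := fun i =>
    h.off _ _ (ne_nm κ i (by norm_num)).symm hj
  simp only [RectScan.tab, h1]

theorem SameOff.weights {ν : ℕ} {s s' : Memory} (h : SameOff ν s s') :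
    weights s' = weights s := by simp [RectScan.weights, h.real]

theorem SameOff.writeTab {k : ℕ} {ν : ℕ} {s s' : Memory} (h : SameOff ν s s') (κ : Key k)
    (i v : ℕ) : SameOff ν s (s'.writeNat (nm κ i) ν v) := by
  refine h.trans ⟨fun a ha _ => ?_, rfl, fun a j _ hj => ?_⟩
  · rw [Memory.writeNat_nat_of_ne _ (ne_nm κ i ha)]
  · simp [Memory.writeNat_nat, hj]

/-- Copy the temporary entry to the current node. -/
noncomputable def store {k : ℕ} (κ : Key k) : Prog :=
  .seq (.setNat (nm κ 6) (nvar 50) (.lit 1))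
    (block ((List.finRange 6).map fun i : Fin 6 => .setNat (nm κ i) (nvar 50) (.get 60 (.lit i))))

theorem store_spec {k : ℕ} (κ : Key k) (s : Memory) :
    SameOff (s.nat 50 0) s ((store κ).exec s) ∧
    tab k ((store κ).exec s) (s.nat 50 0) κ = some (fun i : Fin 6 => s.nat 60 i) ∧
    ((store κ).exec s).nat 60 = s.nat 60 ∧
    ∀ κ', κ' ≠ κ → tab k ((store κ).exec s) (s.nat 50 0) κ' = tab k s (s.nat 50 0) κ' := by
  set ν := s.nat 50 0 with hν
  have h50 : ∀ i, (50 : ℕ) ≠ nm κ i := fun i => ne_nm κ i (by norm_num)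
  have h60 : ∀ i, (60 : ℕ) ≠ nm κ i := fun i => ne_nm κ i (by norm_num)
  let I : List (Fin 6) → Memory → Prop := fun l s' =>
    SameOff ν s s' ∧ s'.nat 60 = s.nat 60 ∧ s'.nat (nm κ 6) ν = 1 ∧
    (∀ i ∈ l, s'.nat (nm κ i) ν = s.nat 60 i) ∧
    ∀ κ', κ' ≠ κ → ∀ i ≤ 6, s'.nat (nm κ' i) = s.nat (nm κ' i)
  have key : I (List.finRange 6) ((store κ).exec s) := by
    simp only [store, Prog.exec, exec_block, List.foldl_map]
    apply foldl_invariant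
    · refine ⟨?_, ?_, ?_, by simp, ?_⟩
      · exact (SameOff.refl _ _).writeTab κ 6 _
      · exact Memory.writeNat_nat_of_ne _ (h60 6)
      · simp [Memory.writeNat_nat, NatExpr.eval, hν]
      · intro κ' hκ' i hi
        rw [Memory.writeNat_nat_of_ne]
        rw [Ne, nm_inj hi le_rfl]
        tauto
    · rintro l x s' - ⟨h1, h2, h3, h4, h5⟩
      have e1 : s'.nat 50 0 = ν := by rw [h1.low 50 (by norm_num) (by norm_num)]
      simp only [NatExpr.eval, e1]
      refine ⟨h1.writeTab κ _ _, ?_, ?_, ?_, ?_⟩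
      · rw [Memory.writeNat_nat_of_ne _ (h60 _), h2]
      · rw [Memory.writeNat_nat_of_ne, h3]
        rw [Ne, nm_inj le_rfl (by omega)]
        omega
      · intro i hi
        rw [Memory.writeNat_nat]
        split_ifs with h
        · rw [nm_inj (by omega) (by omega)] at h
          rw [h2, h.1.2]
        · rw [h2] at *
          simp only [List.mem_append, List.mem_singleton] at hi
          rcases hi with hi | rfl
          · exact h4 i hi
          · simp at h
      · intro κ' hκ' i hi
        rw [Memory.writeNat_nat_of_ne _ (by rw [Ne, nm_inj hi (by omega)]; tauto)]
        exact h5 κ' hκ' i hi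
  obtain ⟨h1, h2, h3, h4, h5⟩ := key
  refine ⟨h1, ?_, h2, fun κ' hκ' => ?_⟩
  · simp only [tab, h3]
    simp [h4 _ (List.mem_finRange _)]
  · simp only [tab, h5 κ' hκ' 6 le_rfl]
    congr 2
    funext i
    rw [h5 κ' hκ' i (by omega)]

/-- Value of the temporary entry. -/
def tempVal : RealExpr :=
  .add (.mul (.get 18 (.lit 0)) (.ofNat (.get 60 (.lit 1))))
    (.mul (.get 18 (.lit 1)) (.ofNat (.get 60 (.lit 0))))

/-- Value of the entry with key `κ` of the current node. -/
noncomputable def entryVal {k : ℕ} (κ : Key k) : RealExpr :=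
  .add (.mul (.get 18 (.lit 0)) (.ofNat (.get (nm κ 1) (nvar 50))))
    (.mul (.get 18 (.lit 1)) (.ofNat (.get (nm κ 0) (nvar 50))))

/-- Replace the entry with key `κ` of the current node by the temporary one if that is better. -/
noncomputable def offer {k : ℕ} (κ : Key k) : Prog :=
  .ite (.and (.natLt (.lit 0) (.get (nm κ 6) (nvar 50))) (.not (.realLt (entryVal κ) tempVal)))
    .skip (store κ)

/-- Whether the old entry is kept or replaced, the resulting one is at least as good as both the
candidate and the old entry, which makes a sequence of offers compute a maximum. -/
theorem offer_spec {k : ℕ} (κ : Key k) (s : Memory) :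
    SameOff (s.nat 50 0) s ((offer κ).exec s) ∧
    (∃ e, tab k ((offer κ).exec s) (s.nat 50 0) κ = some e ∧
      val (weights s) (fun i : Fin 6 => s.nat 60 i) ≤ val (weights s) e ∧
      (e = (fun i : Fin 6 => s.nat 60 i) ∨ tab k s (s.nat 50 0) κ = some e) ∧
      ∀ e', tab k s (s.nat 50 0) κ = some e' → val (weights s) e' ≤ val (weights s) e) ∧
    ∀ κ', κ' ≠ κ → tab k ((offer κ).exec s) (s.nat 50 0) κ' = tab k s (s.nat 50 0) κ' := by
  obtain ⟨h1, h2, -, h4⟩ := store_spec κ s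
  simp only [offer, Prog.exec]
  split_ifs with h
  · refine ⟨.refl _ _, ?_, fun _ _ => rfl⟩
    simp only [Cond.Holds, NatExpr.eval, entryVal, tempVal, RealExpr.eval, not_lt] at h
    have hne : s.nat (nm κ 6) (s.nat 50 0) ≠ 0 := by omega
    refine ⟨fun i => s.nat (nm κ i) (s.nat 50 0), by simp [tab, hne], h.2,
      Or.inr (by simp [tab, hne]), ?_⟩
    intro e' he'
    simp only [tab, hne, if_false, Option.some.injEq] at he'
    rw [he']
  · refine ⟨h1, ⟨_, h2, le_rfl, Or.inl rfl, fun e' he' => ?_⟩, h4⟩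
    simp only [tab] at he'
    split_ifs at he' with h0
    simp only [Option.some.injEq] at he'
    simp only [Cond.Holds, NatExpr.eval, entryVal, tempVal, RealExpr.eval, not_and, not_not] at h
    have h' := h (by omega)
    rw [← he']
    exact h'.le

/-- A candidate for the table of the current node, offered if `guard` holds. -/
structure Item (k : ℕ) where
  guard : Cond
  vec : Fin 6 → NatExpr
  key : Key k

/-- The candidate does not depend on the table that is being built. -/
def Item.Stable {k : ℕ} (ν : ℕ) (it : Item k) : Prop :=
  ∀ s s', s.nat 50 0 = ν → SameOff ν s s' →
    (it.guard.Holds s' ↔ it.guard.Holds s) ∧ ∀ i, (it.vec i).eval s' = (it.vec i).eval s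

/-- Offer a candidate. -/
noncomputable def Item.prog {k : ℕ} (it : Item k) : Prog :=
  .ite it.guard
    (.seq (block ((List.finRange 6).map fun i : Fin 6 => .setNat 60 (.lit i) (it.vec i))) (offer it.key))
    .skip

/-- The components are evaluated one after another while array `60` is being overwritten; stability
guarantees that this does not affect the later ones. -/
theorem temp_spec {k : ℕ} (it : Item k) (s : Memory) (hst : it.Stable (s.nat 50 0)) :
    let s' := (block ((List.finRange 6).map fun i : Fin 6 => .setNat 60 (.lit i) (it.vec i))).exec s
    SameOff (s.nat 50 0) s s' ∧ (∀ a ≠ 60, s'.nat a = s.nat a) ∧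
      ∀ i : Fin 6, s'.nat 60 i = (it.vec i).eval s := by
  simp only [exec_block, List.foldl_map]
  have := foldl_invariant (s := s)
    (fun s (i : Fin 6) => (Prog.setNat 60 (.lit i) (it.vec i)).exec s)
    (fun l s' => SameOff (s.nat 50 0) s s' ∧ (∀ a ≠ 60, s'.nat a = s.nat a) ∧
      ∀ i ∈ l, s'.nat 60 i = (it.vec i).eval s)
    ⟨.refl _ _, fun _ _ => rfl, by simp⟩ (List.finRange 6) (by
      rintro l x s' - ⟨h1, h2, h3⟩
      simp only [Prog.exec, NatExpr.eval]
      refine ⟨h1.trans ⟨fun a _ ha => ?_, rfl, fun a j ha _ => ?_⟩, fun a ha => ?_, ?_⟩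
      · rw [Memory.writeNat_nat_of_ne _ ha]
      · rw [Memory.writeNat_nat_of_ne _ ha]
      · rw [Memory.writeNat_nat_of_ne _ ha, h2 a ha]
      · intro i hi
        rw [Memory.writeNat_nat, (hst s s' rfl h1).2 x]
        split_ifs with h
        · rw [Fin.ext h.2]
        · simp only [List.mem_append, List.mem_singleton] at hi
          rcases hi with hi | rfl
          · exact h3 i hi
          · simp at h)
  exact ⟨this.1, this.2.1, fun i => this.2.2 i (List.mem_finRange i)⟩

/-- The table `T` of node `ν` in `s'` consists of best candidates among `l`. -/
def Filled {k : ℕ} (s : Memory) (l : List (Item k)) (T : Key k → Option Entry) : Prop :=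
  (∀ κ e, T κ = some e →
    ∃ it ∈ l, it.guard.Holds s ∧ it.key = κ ∧ e = fun i => (it.vec i).eval s) ∧
  ∀ it ∈ l, it.guard.Holds s →
    ∃ e, T it.key = some e ∧
      val (weights s) (fun i => (it.vec i).eval s) ≤ val (weights s) e

theorem Item.prog_spec {k : ℕ} (it : Item k) (l : List (Item k)) (s s' : Memory)
    (hst : it.Stable (s.nat 50 0)) (hs : SameOff (s.nat 50 0) s s')
    (hf : Filled s l (tab k s' (s.nat 50 0))) :
    SameOff (s.nat 50 0) s (it.prog.exec s') ∧
      Filled s (l ++ [it]) (tab k (it.prog.exec s') (s.nat 50 0)) := by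
  have e50 : s'.nat 50 0 = s.nat 50 0 := by rw [hs.low 50 (by norm_num) (by norm_num)]
  have hst' := hst s s' rfl hs
  simp only [Item.prog, Prog.exec]
  split_ifs with hg
  · have ht := temp_spec it s' (e50 ▸ hst)
    set s₁ := (block ((List.finRange 6).map fun i : Fin 6 => .setNat 60 (.lit i) (it.vec i))).exec s'
    simp only [e50] at ht
    obtain ⟨h1, h2, h3⟩ := ht
    have e50' : s₁.nat 50 0 = s.nat 50 0 := by rw [h2 50 (by norm_num), e50]
    obtain ⟨o1, ⟨e, o2, o3, o4, o5⟩, o6⟩ := offer_spec it.key s₁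
    rw [e50'] at o1 o2 o4 o5 o6
    have hw : weights s₁ = weights s := (hs.trans h1).weights
    rw [hw] at o3 o5
    have htab : tab k s₁ = tab k s' := by
      funext ν κ
      have : ∀ i, s₁.nat (nm κ i) = s'.nat (nm κ i) := fun i =>
        h2 _ (ne_nm κ i (by norm_num)).symm
      simp only [tab, this]
    have htemp : (fun i : Fin 6 => s₁.nat 60 i) = fun i => (it.vec i).eval s := by
      funext i; rw [h3 i, hst'.2 i]
    rw [htemp] at o3 o4
    rw [htab] at o4 o5 o6
    refine ⟨(hs.trans h1).trans o1, ?_, ?_⟩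
    · intro κ e' he'
      by_cases hκ : κ = it.key
      · subst hκ
        rw [o2, Option.some.injEq] at he'
        subst he'
        rcases o4 with rfl | o4
        · exact ⟨it, by simp, hst'.1.1 hg, rfl, rfl⟩
        · obtain ⟨it', h1, h2⟩ := hf.1 _ _ o4
          exact ⟨it', by simp [h1], h2⟩
      · rw [o6 κ hκ] at he'
        obtain ⟨it', h1, h2⟩ := hf.1 _ _ he'
        exact ⟨it', by simp [h1], h2⟩
    · intro it' hit' hg'
      simp only [List.mem_append, List.mem_singleton] at hit'
      rcases hit' with hit' | rfl
      · obtain ⟨e', h1, h2⟩ := hf.2 it' hit' hg'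
        by_cases hκ : it'.key = it.key
        · rw [hκ] at h1 ⊢
          exact ⟨e, o2, h2.trans (o5 _ h1)⟩
        · exact ⟨e', by rw [o6 _ hκ, h1], h2⟩
      · exact ⟨e, o2, o3⟩
  · refine ⟨hs, ?_, ?_⟩
    · intro κ e he
      obtain ⟨it', h1, h2⟩ := hf.1 _ _ he
      exact ⟨it', by simp [h1], h2⟩
    · intro it' hit' hg'
      simp only [List.mem_append, List.mem_singleton] at hit'
      rcases hit' with hit' | rfl
      · exact hf.2 it' hit' hg'
      · exact absurd (hst'.1.2 hg') hg

/-- Empty the table of the current node. -/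
noncomputable def clear (k : ℕ) : Prog :=
  block ((Finset.univ : Finset (Key k)).toList.map fun κ => .setNat (nm κ 6) (nvar 50) (.lit 0))

theorem clear_spec (k : ℕ) (s : Memory) :
    SameOff (s.nat 50 0) s ((clear k).exec s) ∧
      ∀ κ, tab k ((clear k).exec s) (s.nat 50 0) κ = none := by
  simp only [clear, exec_block, List.foldl_map]
  have := foldl_invariant (s := s)
    (fun s (κ : Key k) => (Prog.setNat (nm κ 6) (nvar 50) (.lit 0)).exec s)
    (fun l s' => SameOff (s.nat 50 0) s s' ∧ ∀ κ ∈ l, s'.nat (nm κ 6) (s.nat 50 0) = 0)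
    ⟨.refl _ _, by simp⟩ (Finset.univ : Finset (Key k)).toList (by
      rintro l x s' - ⟨h1, h2⟩
      have e1 : s'.nat 50 0 = s.nat 50 0 := by rw [h1.low 50 (by norm_num) (by norm_num)]
      simp only [Prog.exec, NatExpr.eval, e1]
      refine ⟨h1.writeTab x 6 0, ?_⟩
      intro κ hκ
      rw [Memory.writeNat_nat]
      split_ifs with h
      · rfl
      · simp only [List.mem_append, List.mem_singleton] at hκ
        rcases hκ with hκ | rfl
        · exact h2 κ hκ
        · simp at h)
  refine ⟨this.1, fun κ => ?_⟩
  have := this.2 κ (by simp)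
  simp only [tab, this, if_true]

/-- Build the table of the current node from a list of candidates. -/
noncomputable def fill {k : ℕ} (l : List (Item k)) : Prog :=
  .seq (clear k) (block (l.map Item.prog))

/-- A running maximum per key over all candidates. Guards and vectors are evaluated in intermediate
memories, but by stability they have their initial values. -/
theorem fill_spec {k : ℕ} (l : List (Item k)) (s : Memory)
    (hst : ∀ it ∈ l, it.Stable (s.nat 50 0)) :
    SameOff (s.nat 50 0) s ((fill l).exec s) ∧
      Filled s l (tab k ((fill l).exec s) (s.nat 50 0)) := by
  simp only [fill, Prog.exec, exec_block, List.foldl_map]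
  apply foldl_invariant (fun s (it : Item k) => it.prog.exec s)
    (fun l s' => SameOff (s.nat 50 0) s s' ∧ Filled s l (tab k s' (s.nat 50 0)))
  · refine ⟨(clear_spec k s).1, fun κ e he => ?_, by simp⟩
    rw [(clear_spec k s).2] at he
    simp at he
  · rintro l' it s' hit ⟨h1, h2⟩
    exact it.prog_spec l' s s' (hst it hit) h1 h2

theorem loopFree_block_map {α : Type*} {l : List α} {f : α → Prog} (h : ∀ x ∈ l, (f x).LoopFree) :
    (block (l.map f)).LoopFree := loopFree_block (by
  simp only [List.mem_map, forall_exists_index, and_imp, forall_apply_eq_imp_iff₂]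
  exact h)

theorem store_loopFree {k : ℕ} (κ : Key k) : (store κ).LoopFree :=
  ⟨trivial, loopFree_block_map fun _ _ => trivial⟩

theorem fill_loopFree {k : ℕ} (l : List (Item k)) : (fill l).LoopFree :=
  ⟨loopFree_block_map fun _ _ => trivial, loopFree_block_map fun _ _ =>
    ⟨⟨loopFree_block_map fun _ _ => trivial, trivial, store_loopFree _⟩, trivial⟩⟩

theorem fill_writesIn {k : ℕ} (l : List (Item k)) : (fill l).WritesIn (Set.Ici 60) := by
  have h : ∀ (κ : Key k) i, nm κ i ∈ Set.Ici 60 := fun κ i => by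
    have := nm_ge κ i
    simp only [Set.mem_Ici]; omega
  refine ⟨writesIn_block ?_, writesIn_block ?_⟩
  · simp only [List.mem_map, forall_exists_index, and_imp, forall_apply_eq_imp_iff₂]
    exact fun κ _ => h κ 6
  · simp only [List.mem_map, forall_exists_index, and_imp, forall_apply_eq_imp_iff₂]
    intro it _
    refine ⟨⟨writesIn_block ?_, trivial, h _ 6, writesIn_block ?_⟩, trivial⟩
    · simp only [List.mem_map, forall_exists_index, and_imp, forall_apply_eq_imp_iff₂]
      exact fun _ _ => Set.mem_Ici.2 le_rfl
    · simp only [List.mem_map, forall_exists_index, and_imp, forall_apply_eq_imp_iff₂]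
      exact fun i _ => h _ i

end RectScan

namespace RectScan
open RealRAM

/-! ### The segment tree -/

/-- Sum of the vectors of a labelled block of leaves. -/
def total (v : ℕ → Fin 3 → Entry) (lab : ℕ → Fin 3) (L R : ℕ) : Entry :=
  ∑ l ∈ Finset.Ico L R, v l (lab l)

/-- Key of a labelled block of leaves. -/
def keyOf (k : ℕ) (v : ℕ → Fin 3 → Entry) (lab : ℕ → Fin 3) (L R : ℕ) : Key k :=
  ((lab L, lab (R - 1)), caps k (total v lab L R))

/-- The table `T` holds an optimal monotone labelling of `[L, R)` for each key. -/
def Good (k : ℕ) (w : ℝ × ℝ) (v : ℕ → Fin 3 → Entry) (T : Key k → Option Entry) (L R : ℕ) :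
    Prop :=
  (∀ κ e, T κ = some e → ∃ lab : ℕ → Fin 3, MonotoneOn lab (Set.Ico L R) ∧
    keyOf k v lab L R = κ ∧ e = total v lab L R) ∧
  ∀ lab : ℕ → Fin 3, MonotoneOn lab (Set.Ico L R) →
    ∃ e, T (keyOf k v lab L R) = some e ∧ val w (total v lab L R) ≤ val w e

theorem total_congr {v v' : ℕ → Fin 3 → Entry} {lab lab' : ℕ → Fin 3} {L R : ℕ}
    (h : ∀ l, L ≤ l → l < R → v l (lab l) = v' l (lab' l)) : total v lab L R = total v' lab' L R :=
  Finset.sum_congr rfl fun l hl => h l (Finset.mem_Ico.1 hl).1 (Finset.mem_Ico.1 hl).2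

theorem total_append (v : ℕ → Fin 3 → Entry) (lab : ℕ → Fin 3) {L M R : ℕ} (h₁ : L ≤ M)
    (h₂ : M ≤ R) : total v lab L R = total v lab L M + total v lab M R :=
  (Finset.sum_Ico_consecutive _ h₁ h₂).symm

theorem Good.congr {k : ℕ} {w : ℝ × ℝ} {v v' : ℕ → Fin 3 → Entry} {T : Key k → Option Entry}
    {L R : ℕ} (h : Good k w v T L R) (hv : ∀ l, L ≤ l → l < R → v l = v' l) :
    Good k w v' T L R := by
  have ht : ∀ lab, total v' lab L R = total v lab L R := fun lab =>
    total_congr fun l h1 h2 => by rw [hv l h1 h2]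
  simpa only [Good, keyOf, ht] using h

theorem val_add (w : ℝ × ℝ) (e₁ e₂ : Entry) : val w (e₁ + e₂) = val w e₁ + val w e₂ := by
  simp only [val, Pi.add_apply]; push_cast; ring

/-- Capped counts can be added: `min (min x k + min y k) k = min (x + y) k`. -/
theorem mul_keyOf {k : ℕ} (v : ℕ → Fin 3 → Entry) (lab : ℕ → Fin 3) {L M R : ℕ} (h₁ : L ≤ M)
    (h₂ : M ≤ R) : (keyOf k v lab L M).mul (keyOf k v lab M R) = keyOf k v lab L R := by
  simp only [keyOf, Key.mul, Prod.mk.injEq, true_and]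
  funext i
  simp only [caps, total_append v lab h₁ h₂, Pi.add_apply, Fin.mk.injEq]
  omega

/-- For soundness, glue the labellings of the halves; comparing the last label of the left half with
the first of the right half ensures monotonicity. For optimality, cut a labelling at `M` and replace
each half by the stored optimum with the same key. Equal keys preserve the condition at the cut and
the capped counts, and the objective is additive. -/
theorem Good.combine {k : ℕ} {w : ℝ × ℝ} {v : ℕ → Fin 3 → Entry}
    {T₁ T₂ T : Key k → Option Entry} {L M R : ℕ} (h₁ : Good k w v T₁ L M) (h₂ : Good k w v T₂ M R)
    (hLM : L < M) (hMR : M < R)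
    (hs : ∀ κ e, T κ = some e → ∃ κ₁ κ₂ e₁ e₂, κ₁.1.2 ≤ κ₂.1.1 ∧ κ₁.mul κ₂ = κ ∧
      T₁ κ₁ = some e₁ ∧ T₂ κ₂ = some e₂ ∧ e = e₁ + e₂)
    (hc : ∀ κ₁ κ₂ e₁ e₂, κ₁.1.2 ≤ κ₂.1.1 → T₁ κ₁ = some e₁ → T₂ κ₂ = some e₂ →
      ∃ e, T (κ₁.mul κ₂) = some e ∧ val w (e₁ + e₂) ≤ val w e) : Good k w v T L R := by
  constructor
  · intro κ e he
    obtain ⟨κ₁, κ₂, e₁, e₂, hle, rfl, he₁, he₂, rfl⟩ := hs κ e he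
    obtain ⟨lab₁, m₁, rfl, rfl⟩ := h₁.1 _ _ he₁
    obtain ⟨lab₂, m₂, rfl, rfl⟩ := h₂.1 _ _ he₂
    let lab : ℕ → Fin 3 := fun l => if l < M then lab₁ l else lab₂ l
    have t₁ : ∀ l < M, lab l = lab₁ l := fun l hl => by simp [lab, hl]
    have t₂ : ∀ l, M ≤ l → lab l = lab₂ l := fun l hl => by simp [lab, not_lt.2 hl]
    have e₁ : total v lab L M = total v lab₁ L M := total_congr fun l _ h => by rw [t₁ l h]
    have e₂ : total v lab M R = total v lab₂ M R := total_congr fun l h _ => by rw [t₂ l h]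
    have k₁ : keyOf k v lab L M = keyOf k v lab₁ L M := by
      simp only [keyOf, e₁, t₁ L hLM, t₁ (M - 1) (by omega)]
    have k₂ : keyOf k v lab M R = keyOf k v lab₂ M R := by
      simp only [keyOf, e₂, t₂ M le_rfl, t₂ (R - 1) (by omega)]
    refine ⟨lab, ?_, ?_, ?_⟩
    · intro a ha b hb hab
      simp only [Set.mem_Ico] at ha hb
      by_cases ha' : a < M
      · by_cases hb' : b < M
        · rw [t₁ a ha', t₁ b hb']
          exact m₁ ⟨ha.1, ha'⟩ ⟨hb.1, hb'⟩ hab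
        · push Not at hb'
          rw [t₁ a ha', t₂ b hb']
          refine (m₁ ⟨ha.1, ha'⟩ ⟨?_, ?_⟩ ?_ : lab₁ a ≤ lab₁ (M - 1)).trans (hle.trans
            (m₂ ⟨le_rfl, hMR⟩ ⟨hb', hb.2⟩ hb')) <;> omega
      · push Not at ha'
        rw [t₂ a ha', t₂ b (by omega)]
        exact m₂ ⟨ha', ha.2⟩ ⟨by omega, hb.2⟩ hab
    · rw [← mul_keyOf v lab hLM.le hMR.le, k₁, k₂]
    · rw [total_append v lab hLM.le hMR.le, e₁, e₂]
  · intro lab hm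
    obtain ⟨e₁, a₁, b₁⟩ := h₁.2 lab (hm.mono (Set.Ico_subset_Ico_right hMR.le))
    obtain ⟨e₂, a₂, b₂⟩ := h₂.2 lab (hm.mono (Set.Ico_subset_Ico_left hLM.le))
    obtain ⟨e, he, hv⟩ := hc _ _ _ _ (hm ⟨by omega, by omega⟩ ⟨by omega, by omega⟩ (by omega) :
      lab (M - 1) ≤ lab M) a₁ a₂
    rw [mul_keyOf v lab hLM.le hMR.le] at he
    refine ⟨e, he, ?_⟩
    rw [total_append v lab hLM.le hMR.le, val_add]
    rw [val_add] at hv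
    linarith

theorem Good.leaf {k : ℕ} {w : ℝ × ℝ} {v : ℕ → Fin 3 → Entry} {T : Key k → Option Entry} {L : ℕ}
    (hs : ∀ κ e, T κ = some e → ∃ f, κ = ((f, f), caps k (v L f)) ∧ e = v L f)
    (hc : ∀ f, ∃ e, T ((f, f), caps k (v L f)) = some e ∧ val w (v L f) ≤ val w e) :
    Good k w v T L (L + 1) := by
  have ht : ∀ lab, total v lab L (L + 1) = v L (lab L) := fun lab => by simp [total]
  simp only [Good, keyOf, ht, Nat.add_sub_cancel]
  refine ⟨fun κ e he => ?_, fun lab _ => hc (lab L)⟩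
  obtain ⟨f, rfl, rfl⟩ := hs κ e he
  exact ⟨fun _ => f, fun _ _ _ _ _ => le_rfl, rfl, rfl⟩

/-- Vector of leaf `l` with label `f`, given the total and the active counts in memory. -/
def leafVec (s : Memory) (l : ℕ) (f : Fin 3) : Entry :=
  ![if f = 1 then s.nat 40 l else 0, if f = 1 then s.nat 41 l else 0,
    s.nat 8 l - if f = 1 then s.nat 40 l else 0, s.nat 9 l - if f = 1 then s.nat 41 l else 0,
    if f = 0 then s.nat 8 l else 0, if f = 1 then s.nat 8 l else 0]

/-- Expressions for the vector of the current leaf with label `f`. -/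
def leafExpr (f : Fin 3) : Fin 6 → NatExpr :=
  ![if f = 1 then .get 40 (nvar 50) else .lit 0, if f = 1 then .get 41 (nvar 50) else .lit 0,
    .sub (.get 8 (nvar 50)) (if f = 1 then .get 40 (nvar 50) else .lit 0),
    .sub (.get 9 (nvar 50)) (if f = 1 then .get 41 (nvar 50) else .lit 0),
    if f = 0 then .get 8 (nvar 50) else .lit 0, if f = 1 then .get 8 (nvar 50) else .lit 0]

theorem leafExpr_eval (f : Fin 3) (i : Fin 6) (s : Memory) :
    (leafExpr f i).eval s = leafVec s (s.nat 50 0) f i := by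
  fin_cases f <;> fin_cases i <;> simp [leafExpr, leafVec, NatExpr.eval]

/-- The capped value of `e` is `c`. -/
def capEq (k : ℕ) (e : NatExpr) (c : ℕ) : Cond :=
  .and (.not (.natLt (.sub e (.sub e (.lit k))) (.lit c)))
    (.not (.natLt (.lit c) (.sub e (.sub e (.lit k)))))

/-- Truncated subtraction yields minima: `e - (e - k) = min e k`. -/
theorem capEq_holds (k : ℕ) (e : NatExpr) (c : ℕ) (s : Memory) :
    (capEq k e c).Holds s ↔ min (e.eval s) k = c := by
  simp only [capEq, Cond.Holds, NatExpr.eval]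
  omega

/-- Candidates for the table of a leaf. -/
noncomputable def leafItems (k : ℕ) : List (Item k) :=
  (Finset.univ : Finset (Fin 3 × (Fin 4 → Fin (k + 1)))).toList.map fun x =>
    { guard := .and (.and (capEq k (leafExpr x.1 0) (x.2 0)) (capEq k (leafExpr x.1 1) (x.2 1)))
        (.and (capEq k (leafExpr x.1 2) (x.2 2)) (capEq k (leafExpr x.1 3) (x.2 3)))
      vec := leafExpr x.1
      key := ((x.1, x.1), x.2) }

theorem leafVec_congr {s s' : Memory} (h : ∀ a < 50, s'.nat a = s.nat a) :
    leafVec s' = leafVec s := by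
  funext l f
  simp [leafVec, h]

/-- Array names are fixed in the program text, whereas the capped counts of a leaf are known only at
run time. Hence there is a candidate for every conceivable value `c`, and for each label exactly the
correct one passes its guard. -/
theorem leafItems_guard {k : ℕ} (f : Fin 3) (c : Fin 4 → Fin (k + 1)) (s : Memory) :
    (Cond.and (.and (capEq k (leafExpr f 0) (c 0)) (capEq k (leafExpr f 1) (c 1)))
        (.and (capEq k (leafExpr f 2) (c 2)) (capEq k (leafExpr f 3) (c 3)))).Holds s ↔
      caps k (leafVec s (s.nat 50 0) f) = c := by
  simp only [Cond.Holds, capEq_holds, leafExpr_eval, funext_iff, Fin.forall_fin_succ, caps,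
    Fin.ext_iff]
  simp
  tauto

theorem leafItems_stable {k ν : ℕ} : ∀ it ∈ leafItems k, it.Stable ν := by
  simp only [leafItems, List.mem_map, forall_exists_index, and_imp, forall_apply_eq_imp_iff₂]
  rintro ⟨f, c⟩ - s s' hs h
  have h50 : s'.nat 50 0 = s.nat 50 0 := by rw [h.low 50 (by norm_num) (by norm_num)]
  have hv : leafVec s' = leafVec s := leafVec_congr fun a ha => h.low a (by omega) (by omega)
  simp only [leafItems_guard, leafExpr_eval, h50, hv, implies_true, and_self]

theorem fill_leafItems {k : ℕ} (w : ℝ × ℝ) (s : Memory) (hw : weights s = w) :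
    let s' := (fill (leafItems k)).exec s
    SameOff (s.nat 50 0) s s' ∧
      Good k w (leafVec s) (tab k s' (s.nat 50 0)) (s.nat 50 0) (s.nat 50 0 + 1) := by
  obtain ⟨h1, h2, h3⟩ := fill_spec (leafItems k) s leafItems_stable
  refine ⟨h1, Good.leaf ?_ ?_⟩
  · intro κ e he
    obtain ⟨it, hit, hg, rfl, rfl⟩ := h2 κ e he
    simp only [leafItems, List.mem_map] at hit
    obtain ⟨⟨f, c⟩, -, rfl⟩ := hit
    rw [leafItems_guard] at hg
    refine ⟨f, by simp [hg], ?_⟩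
    funext i
    exact leafExpr_eval f i s
  · intro f
    obtain ⟨e, he, hv⟩ := h3 _ (List.mem_map.2
      ⟨(f, caps k (leafVec s (s.nat 50 0) f)), by simp, rfl⟩)
      ((leafItems_guard _ _ _).2 rfl)
    refine ⟨e, he, ?_⟩
    simp only [leafExpr_eval, hw] at hv
    exact hv

/-- Candidates for the table of an inner node. -/
noncomputable def combItems (k : ℕ) : List (Item k) :=
  ((Finset.univ : Finset (Key k × Key k)).filter fun x => x.1.1.2 ≤ x.2.1.1).toList.map fun x =>
    { guard := .and (.natLt (.lit 0) (.get (nm x.1 6) (.add (nvar 50) (nvar 50))))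
        (.natLt (.lit 0) (.get (nm x.2 6) (.add (.add (nvar 50) (nvar 50)) (.lit 1))))
      vec := fun i => .add (.get (nm x.1 i) (.add (nvar 50) (nvar 50)))
        (.get (nm x.2 i) (.add (.add (nvar 50) (nvar 50)) (.lit 1)))
      key := x.1.mul x.2 }

theorem tab_eq_some {k : ℕ} {s : Memory} {ν : ℕ} {κ : Key k} {e : Entry} :
    tab k s ν κ = some e ↔ 0 < s.nat (nm κ 6) ν ∧ e = fun i : Fin 6 => s.nat (nm κ i) ν := by
  unfold tab
  split_ifs with h
  · simp [h]
  · simp only [Option.some.injEq]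
    constructor
    · rintro rfl; exact ⟨by omega, rfl⟩
    · rintro ⟨-, rfl⟩; rfl

/-- Only the tables of the children `2 ν` and `2 ν + 1` are read, and these differ from `ν` because
`ν` is positive. -/
theorem combItems_stable {k ν : ℕ} (hν : 1 ≤ ν) : ∀ it ∈ combItems k, it.Stable ν := by
  simp only [combItems, List.mem_map, forall_exists_index, and_imp, forall_apply_eq_imp_iff₂]
  rintro ⟨κ₁, κ₂⟩ - s s' hs h
  have h50 : s'.nat 50 0 = s.nat 50 0 := by rw [h.low 50 (by norm_num) (by norm_num)]
  have h1 : ∀ (κ : Key k) i, s'.nat (nm κ i) (ν + ν) = s.nat (nm κ i) (ν + ν) := fun κ i =>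
    h.off _ _ (ne_nm κ i (by norm_num)).symm (by omega)
  have h2 : ∀ (κ : Key k) i, s'.nat (nm κ i) (ν + ν + 1) = s.nat (nm κ i) (ν + ν + 1) :=
    fun κ i => h.off _ _ (ne_nm κ i (by norm_num)).symm (by omega)
  simp only [Cond.Holds, NatExpr.eval, h50, hs, h1, h2, implies_true, and_self]

theorem fill_combItems {k : ℕ} (w : ℝ × ℝ) (s : Memory) (hw : weights s = w) {ν : ℕ}
    (hν : s.nat 50 0 = ν) (h1 : 1 ≤ ν) {v : ℕ → Fin 3 → Entry} {L M R : ℕ} (hLM : L < M)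
    (hMR : M < R) (g₁ : Good k w v (tab k s (ν + ν)) L M)
    (g₂ : Good k w v (tab k s (ν + ν + 1)) M R) :
    Good k w v (tab k ((fill (combItems k)).exec s) ν) L R := by
  obtain ⟨-, h2, h3⟩ := fill_spec (combItems k) s (by rw [hν]; exact combItems_stable h1)
  rw [hν] at h2 h3
  refine g₁.combine g₂ hLM hMR ?_ ?_
  · intro κ e he
    obtain ⟨it, hit, hg, rfl, rfl⟩ := h2 κ e he
    simp only [combItems, List.mem_map, Finset.mem_toList, Finset.mem_filter, Finset.mem_univ,
      true_and] at hit
    obtain ⟨⟨κ₁, κ₂⟩, hle, rfl⟩ := hit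
    simp only [Cond.Holds, NatExpr.eval, hν] at hg
    exact ⟨κ₁, κ₂, _, _, hle, rfl, tab_eq_some.2 ⟨hg.1, rfl⟩, tab_eq_some.2 ⟨hg.2, rfl⟩, by
      funext i; simp [NatExpr.eval, hν]⟩
  · intro κ₁ κ₂ e₁ e₂ hle he₁ he₂
    obtain ⟨a₁, rfl⟩ := tab_eq_some.1 he₁
    obtain ⟨a₂, rfl⟩ := tab_eq_some.1 he₂
    obtain ⟨e, he, hv⟩ := h3 _ (List.mem_map.2 ⟨(κ₁, κ₂), by simpa using hle, rfl⟩)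
      (by simpa only [Cond.Holds, NatExpr.eval, hν] using ⟨a₁, a₂⟩)
    refine ⟨e, he, ?_⟩
    simp only [NatExpr.eval, hν, hw] at hv
    exact hv

/-- The table `T` of node `ν` is correct; `m` is the number of leaves. -/
def NodeOK (k : ℕ) (w : ℝ × ℝ) (v : ℕ → Fin 3 → Entry) (m : ℕ) (T : Key k → Option Entry)
    (ν : ℕ) : Prop :=
  ∀ j, m ≤ ν * 2 ^ j → (ν + 1) * 2 ^ j ≤ 2 * m → Good k w v T (ν * 2 ^ j) ((ν + 1) * 2 ^ j)

/-- All tables are correct. -/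
def TreeOK (k : ℕ) (s : Memory) (m : ℕ) : Prop :=
  ∀ ν, 1 ≤ ν → NodeOK k (weights s) (leafVec s) m (tab k s ν) ν

/-- The exponent `j` is the height of the node. For `m ≤ ν`, any height `j ≥ 1` contradicts `(ν + 1)
2 ^ j ≤ 2 m`, so only the one-leaf block matters. -/
theorem nodeOK_leaf {k : ℕ} {w : ℝ × ℝ} {v : ℕ → Fin 3 → Entry} {m : ℕ}
    {T : Key k → Option Entry} {ν : ℕ} (hν : m ≤ ν) (h : Good k w v T ν (ν + 1)) :
    NodeOK k w v m T ν := by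
  intro j h1 h2
  rcases j with _ | j
  · simpa using h
  · exfalso
    have : 1 ≤ 2 ^ j := Nat.one_le_two_pow
    rw [pow_succ] at h2
    nlinarith

/-- Height `0` is impossible since `ν < m`; at height `j + 1` the block of `ν` is the union of the
blocks of `2 ν` and `2 ν + 1` at height `j`. -/
theorem nodeOK_fill {k : ℕ} {s : Memory} {m ν : ℕ} {v : ℕ → Fin 3 → Entry}
    (hν : s.nat 50 0 = ν) (h1 : 1 ≤ ν) (h2 : ν < m)
    (g₁ : NodeOK k (weights s) v m (tab k s (ν + ν)) (ν + ν))
    (g₂ : NodeOK k (weights s) v m (tab k s (ν + ν + 1)) (ν + ν + 1)) :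
    NodeOK k (weights s) v m (tab k ((fill (combItems k)).exec s) ν) ν := by
  intro j h3 h4
  rcases j with _ | j
  · simp at h3; omega
  · have e1 : ν * 2 ^ (j + 1) = (ν + ν) * 2 ^ j := by ring
    have e2 : (ν + 1) * 2 ^ (j + 1) = (ν + ν + 1 + 1) * 2 ^ j := by ring
    have hp : 1 ≤ 2 ^ j := Nat.one_le_two_pow
    rw [e1] at h3 ⊢
    rw [e2] at h4 ⊢
    have e3 : (ν + ν + 1) * 2 ^ j = (ν + ν) * 2 ^ j + 2 ^ j := by ring
    have e4 : (ν + ν + 1 + 1) * 2 ^ j = (ν + ν + 1) * 2 ^ j + 2 ^ j := by ring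
    exact fill_combItems (weights s) s rfl hν h1 (by omega) (by omega)
      (g₁ j h3 (by omega)) (g₂ j (by omega) h4)

theorem fill_sameOff {k : ℕ} {s : Memory} {ν : ℕ} (hν : s.nat 50 0 = ν) (h1 : 1 ≤ ν) (b : Bool) :
    SameOff ν s ((fill (if b then leafItems k else combItems k)).exec s) := by
  have := (fill_spec (if b then leafItems k else combItems k) s (by
    rw [hν]
    cases b
    · exact combItems_stable h1
    · exact leafItems_stable)).1
  rwa [hν] at this

/-- Recompute all tables. -/
noncomputable def build (k : ℕ) : Prog :=
  .seq (.setNat 50 (.lit 0) (.add (nvar 3) (nvar 3)))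
    (.loop (.natLt (.lit 1) (nvar 50))
      (.seq (.setNat 50 (.lit 0) (.sub (nvar 50) (.lit 1)))
        (.ite (.natLt (nvar 50) (nvar 3)) (fill (combItems k)) (fill (leafItems k)))))

/-- Recompute the tables of the current leaf and of its ancestors. -/
noncomputable def updatePath (k : ℕ) : Prog :=
  .seq (fill (leafItems k))
    (.loop (.natLt (.lit 1) (nvar 50))
      (.seq (.setNat 50 (.lit 0) (.get 4 (nvar 50))) (fill (combItems k))))

theorem build_writesIn (k : ℕ) : (build k).WritesIn (Set.Ici 50) := by
  have h : Set.Ici 60 ⊆ Set.Ici 50 := Set.Ici_subset_Ici.2 (by norm_num)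
  exact ⟨Set.mem_Ici.2 le_rfl, Set.mem_Ici.2 le_rfl, (fill_writesIn _).mono h,
    (fill_writesIn _).mono h⟩

theorem updatePath_writesIn (k : ℕ) : (updatePath k).WritesIn (Set.Ici 50) := by
  have h : Set.Ici 60 ⊆ Set.Ici 50 := Set.Ici_subset_Ici.2 (by norm_num)
  exact ⟨(fill_writesIn _).mono h, Set.mem_Ici.2 le_rfl, (fill_writesIn _).mono h⟩

theorem tab_writeNat {k : ℕ} (s : Memory) {a i v : ℕ} (ha : a < 100) :
    tab k (s.writeNat a i v) = tab k s := by
  funext ν κ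
  have : ∀ i', (s.writeNat a i v).nat (nm κ i') = s.nat (nm κ i') := fun i' =>
    Memory.writeNat_nat_of_ne _ (ne_nm κ i' ha).symm
  simp only [tab, this]

/-- Bound for the steps spent on one node. -/
noncomputable def nodeCost (k : ℕ) : ℕ :=
  (fill (combItems k)).bound + (fill (leafItems k)).bound + 20

/-- Nodes are treated by decreasing number, so both children of a node are correct before the node
itself is filled. -/
theorem build_wp (k : ℕ) {s : Memory} {m : ℕ} (hm : s.nat 3 0 = m) :
    wp (build k) (fun s' => TreeOK k s' m) s ((2 * m + 1) * nodeCost k) := by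
  let J : Memory → Prop := fun s' => (∀ a < 50, s'.nat a = s.nat a) ∧ s'.real = s.real ∧
    ∀ ν, 1 ≤ ν → s'.nat 50 0 ≤ ν → NodeOK k (weights s) (leafVec s) m (tab k s' ν) ν
  have hloop := wp_loop (b := .natLt (.lit 1) (nvar 50))
    (p := .seq (.setNat 50 (.lit 0) (.sub (nvar 50) (.lit 1)))
        (.ite (.natLt (nvar 50) (nvar 3)) (fill (combItems k)) (fill (leafItems k))))
    (B := nodeCost k - 6) J (fun s' => s'.nat 50 0) (by
      rintro s₁ ⟨h1, h2, h3⟩ hb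
      simp only [Cond.Holds, NatExpr.eval] at hb
      set s₂ := s₁.writeNat 50 0 (s₁.nat 50 0 - 1) with hs₂
      have hν : s₂.nat 50 0 = s₁.nat 50 0 - 1 := by simp [hs₂, Memory.writeNat_nat]
      set ν := s₁.nat 50 0 - 1
      have a1 : ∀ a < 50, s₂.nat a = s.nat a := fun a ha => by
        rw [hs₂, Memory.writeNat_nat_of_ne _ (by omega), h1 a ha]
      have a3 : tab k s₂ = tab k s₁ := tab_writeNat _ (by norm_num)
      have aw : weights s₂ = weights s := by simp [weights, hs₂, h2]
      have av : leafVec s₂ = leafVec s := leafVec_congr a1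
      have a4 : ∀ s₃, SameOff ν s₂ s₃ → NodeOK k (weights s) (leafVec s) m (tab k s₃ ν) ν →
          J s₃ ∧ s₃.nat 50 0 < s₁.nat 50 0 := by
        intro s₃ hs hn
        have e : s₃.nat 50 0 = ν := by rw [hs.low 50 (by norm_num) (by norm_num), hν]
        refine ⟨⟨fun a ha => ?_, ?_, ?_⟩, by omega⟩
        · rw [hs.low a (by omega) (by omega), a1 a ha]
        · rw [hs.real, ← h2]; rfl
        · intro ν' hν' hle
          rcases Nat.eq_or_lt_of_le (e ▸ hle) with rfl | hlt
          · exact hn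
          · rw [hs.tab (by omega), a3]
            exact h3 ν' hν' (by omega)
      refine wp.mono (wp_seq (R := fun s' => s' = s₂) (B₁ := 6) ?_ (B₂ := nodeCost k - 12) ?_)
        (fun _ h => h) ?_
      · exact ⟨_, _, .setNat _ _ _ _, by simp [NatExpr.cost], rfl⟩
      · rintro _ rfl
        refine wp.mono (wp_ite
          (B := (fill (combItems k)).bound + (fill (leafItems k)).bound) ?_ ?_)
          (fun _ h => h) (by simp only [nodeCost, Cond.cost, NatExpr.cost]; omega)
        · intro hlt
          simp only [Cond.Holds, NatExpr.eval, hν, a1 3 (by norm_num), hm] at hlt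
          refine wp.mono ((fill_loopFree _).wp ?_) (fun _ h => h) (Nat.le_add_right _ _)
          refine a4 _ (fill_sameOff hν (by omega) false) ?_
          have := nodeOK_fill (v := leafVec s) hν (by omega) hlt
            (by rw [aw, a3]; exact h3 _ (by omega) (by omega))
            (by rw [aw, a3]; exact h3 _ (by omega) (by omega))
          rwa [aw] at this
        · intro hlt
          simp only [Cond.Holds, NatExpr.eval, hν, a1 3 (by norm_num), hm, not_lt] at hlt
          refine wp.mono ((fill_loopFree _).wp ?_) (fun _ h => h) (Nat.le_add_left _ _)
          refine a4 _ (fill_sameOff hν (by omega) true) ?_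
          have := (fill_leafItems (k := k) _ s₂ aw).2
          rw [hν, av] at this
          exact nodeOK_leaf hlt this
      · simp only [nodeCost]; omega)
  set s₀ := s.writeNat 50 0 (m + m) with hs₀
  have e0 : s₀.nat 50 0 = m + m := by simp [hs₀, Memory.writeNat_nat]
  have J0 : J s₀ := by
    -- Nodes numbered `2 m` or more have no block inside `[m, 2 m)`, so the invariant holds
    -- vacuously at the start.
    refine ⟨fun a ha => Memory.writeNat_nat_of_ne _ (by omega), rfl, fun ν h1 h2 j h3 h4 => ?_⟩
    exfalso
    have : 1 ≤ 2 ^ j := Nat.one_le_two_pow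
    nlinarith
  refine wp.mono (wp_seq (R := fun s' => s' = s₀) (B₁ := 7) ?_ ?_)
    (Q := fun s' => J s' ∧ ¬ Cond.Holds s' (.natLt (.lit 1) (nvar 50)))
    (B := 7 + ((m + m) * nodeCost k + 6)) ?_ ?_
  · exact ⟨_, _, .setNat _ _ _ _, by simp [NatExpr.cost], by simp [NatExpr.eval, hs₀, hm]⟩
  · rintro _ rfl
    refine (hloop _ J0).mono (fun _ h => h) ?_
    rw [e0]
    have : Cond.cost (.natLt (.lit 1) (nvar 50)) + 1 + (nodeCost k - 6) ≤ nodeCost k := by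
      simp only [Cond.cost, NatExpr.cost, nodeCost]; omega
    have := Nat.mul_le_mul_left (m + m) this
    simp only [Cond.cost, NatExpr.cost] at this ⊢
    omega
  · rintro s' ⟨⟨h1, h2, h3⟩, h4⟩
    simp only [Cond.Holds, NatExpr.eval] at h4
    intro ν hν
    have e1 : weights s' = weights s := by simp [weights, h2]
    rw [e1, leafVec_congr h1]
    exact h3 ν hν (by omega)
  · have : 20 ≤ nodeCost k := by simp only [nodeCost]; omega
    have h' : (2 * m + 1) * nodeCost k = (m + m) * nodeCost k + nodeCost k := by ring
    omega

/-- Only tables off the path from the current leaf to the root have to be correct beforehand. During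
the climb, the tables still in doubt are those of the proper ancestors of the current node; at the
root there are none. The binary logarithm of the node number drops in each round and gives the step
bound. -/
theorem updatePath_wp (k : ℕ) {s : Memory} {m : ℕ} (hl : m ≤ s.nat 50 0)
    (hl' : s.nat 50 0 < 2 * m) (hhalf : ∀ ν < 2 * m, s.nat 4 ν = ν / 2)
    (h : ∀ ν, 1 ≤ ν → (∀ i, s.nat 50 0 / 2 ^ i ≠ ν) →
      NodeOK k (weights s) (leafVec s) m (tab k s ν) ν) :
    wp (updatePath k) (fun s' => TreeOK k s' m) s ((Nat.log 2 (s.nat 50 0) + 1) * nodeCost k) := by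
  set l := s.nat 50 0 with hl0
  let J : Memory → Prop := fun s' => (∀ a < 50, s'.nat a = s.nat a) ∧ s'.real = s.real ∧
    1 ≤ s'.nat 50 0 ∧ s'.nat 50 0 < 2 * m ∧
    ∀ ν, 1 ≤ ν → (∀ i, s'.nat 50 0 / 2 ^ (i + 1) ≠ ν) →
      NodeOK k (weights s) (leafVec s) m (tab k s' ν) ν
  have hloop := wp_loop (b := .natLt (.lit 1) (nvar 50))
    (p := .seq (.setNat 50 (.lit 0) (.get 4 (nvar 50))) (fill (combItems k)))
    (B := nodeCost k - 6) J (fun s' => Nat.log 2 (s'.nat 50 0)) (by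
      rintro s₁ ⟨h1, h2, h3, h4, h5⟩ hb
      simp only [Cond.Holds, NatExpr.eval] at hb
      set s₂ := s₁.writeNat 50 0 (s₁.nat 50 0 / 2) with hs₂
      have hν : s₂.nat 50 0 = s₁.nat 50 0 / 2 := by simp [hs₂, Memory.writeNat_nat]
      set ν := s₁.nat 50 0 / 2 with hν0
      have a1 : ∀ a < 50, s₂.nat a = s.nat a := fun a ha => by
        rw [hs₂, Memory.writeNat_nat_of_ne _ (by omega), h1 a ha]
      have a3 : tab k s₂ = tab k s₁ := tab_writeNat _ (by norm_num)
      have aw : weights s₂ = weights s := by simp [weights, hs₂, h2]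
      -- The tables in doubt belong to nodes numbered at most `ν`, so those of both children of `ν`
      -- can be relied on.
      have hdiv : ∀ i, s₁.nat 50 0 / 2 ^ (i + 1) ≤ ν := fun i => by
        rw [pow_succ', ← Nat.div_div_eq_div_mul]
        exact Nat.div_le_self _ _
      refine wp.mono (wp_seq (R := fun s' => s' = s₂) (B₁ := 5) ?_
        (B₂ := (fill (combItems k)).bound) ?_) (fun _ h => h) (by simp only [nodeCost]; omega)
      · refine ⟨_, _, .setNat _ _ _ _, by simp [NatExpr.cost], ?_⟩
        simp only [NatExpr.eval, hs₂, hν0]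
        rw [h1 4 (by norm_num), hhalf _ h4]
      · rintro _ rfl
        refine (fill_loopFree _).wp ?_
        have hs := fill_sameOff (k := k) hν (by omega) false
        simp only [Bool.false_eq_true, if_false] at hs
        have hn := nodeOK_fill (k := k) (m := m) (v := leafVec s) hν (by omega) (by omega)
            (by rw [aw, a3]; exact h5 _ (by omega) fun i => by have := hdiv i; omega)
            (by rw [aw, a3]; exact h5 _ (by omega) fun i => by have := hdiv i; omega)
        rw [aw] at hn
        set s₃ := (fill (combItems k)).exec s₂
        have e : s₃.nat 50 0 = ν := by rw [hs.low 50 (by norm_num) (by norm_num), hν]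
        refine ⟨⟨fun a ha => ?_, ?_, by omega, by omega, ?_⟩, ?_⟩
        · rw [hs.low a (by omega) (by omega), a1 a ha]
        · rw [hs.real, ← h2]; rfl
        · intro ν' hν' hanc
          by_cases hne : ν' = ν
          · rw [hne]; exact hn
          · rw [hs.tab hne, a3]
            refine h5 ν' hν' fun i => ?_
            rcases i with _ | i
            · simpa using Ne.symm hne
            · have := hanc i
              rwa [e, hν0, Nat.div_div_eq_div_mul, ← pow_succ'] at this
        · rw [e, hν0, Nat.log_div_base]
          have : 0 < Nat.log 2 (s₁.nat 50 0) := Nat.log_pos (by norm_num) hb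
          omega)
  obtain ⟨hs, hg⟩ := fill_leafItems (k := k) _ s rfl
  set s₀ := (fill (leafItems k)).exec s with hs₀
  rw [← hl0] at hs hg
  have e0 : s₀.nat 50 0 = l := by rw [hs.low 50 (by norm_num) (by norm_num)]
  have J0 : J s₀ := by
    refine ⟨fun a ha => hs.low a (by omega) (by omega), hs.real, by omega, by omega,
      fun ν h1 h2 => ?_⟩
    by_cases hne : ν = l
    · rw [hne]; exact nodeOK_leaf hl hg
    · rw [hs.tab hne]
      refine h ν h1 fun i => ?_
      rcases i with _ | i
      · simpa using Ne.symm hne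
      · rw [← e0]; exact h2 i
  refine wp.mono (wp_seq (R := fun s' => s' = s₀) (B₁ := (fill (leafItems k)).bound)
    ((fill_loopFree _).wp hs₀.symm) (fun s' hs' => by rw [hs']; exact hloop _ J0)) ?_ ?_
  · rintro s' ⟨⟨h1, h2, h3, -, h4⟩, h5⟩
    simp only [Cond.Holds, NatExpr.eval] at h5
    have e2 : s'.nat 50 0 = 1 := by omega
    intro ν hν
    have e1 : weights s' = weights s := by simp [weights, h2]
    rw [e1, leafVec_congr h1]
    refine h4 ν hν fun i => ?_
    rw [e2, Nat.div_eq_of_lt (Nat.one_lt_two_pow (by omega))]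
    omega
  · rw [e0]
    have h1 : Cond.cost (.natLt (.lit 1) (nvar 50)) + 1 + (nodeCost k - 6) ≤ nodeCost k := by
      simp only [Cond.cost, NatExpr.cost, nodeCost]; omega
    have h2 := Nat.mul_le_mul_left (Nat.log 2 l) h1
    have h3 : (fill (leafItems k)).bound + 20 ≤ nodeCost k := by simp only [nodeCost]; omega
    have h4 : (Nat.log 2 l + 1) * nodeCost k = Nat.log 2 l * nodeCost k + nodeCost k := by ring
    simp only [Cond.cost, NatExpr.cost] at h2 ⊢
    omega

end RectScan

namespace RectScan

/-! ### Tangent planes of the scan statistic -/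

/-- Log-likelihood of `a` successes in `s` trials at the optimal success rate. -/
noncomputable def phi (s a : ℝ) : ℝ :=
  a * Real.log (a / s) + (s - a) * Real.log ((s - a) / s)

/-- This is `log z ≥ 1 - 1 / z`; at `a = 0` the right side vanishes. -/
theorem mul_log_le {a x : ℝ} (ha : 0 ≤ a) (hx : 0 < x) : a - x ≤ a * Real.log (a / x) := by
  rcases ha.eq_or_lt with rfl | ha
  · simp [hx.le]
  · have h := Real.one_sub_inv_le_log_of_pos (div_pos ha hx)
    have := mul_le_mul_of_nonneg_left h ha.le
    calc a - x = a * (1 - (a / x)⁻¹) := by field_simp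
      _ ≤ _ := this

theorem mul_log_ge {a x : ℝ} (ha : 0 ≤ a) (hx : 0 < x) :
    a * Real.log (a / x) ≤ a * (a / x - 1) := by
  rcases ha.eq_or_lt with rfl | ha
  · simp
  · exact mul_le_mul_of_nonneg_left (Real.log_le_sub_one_of_pos (div_pos ha hx)) ha.le

theorem mul_log_div_mul {a s z : ℝ} (hs : 0 < s) (hz : 0 < z) :
    a * Real.log (a / (s * z)) = a * Real.log (a / s) - a * Real.log z := by
  by_cases ha : a = 0
  · simp [ha]
  · rw [← div_div, Real.log_div (div_ne_zero ha hs.ne') hz.ne', mul_sub]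

/-- The gap between `phi` and its tangent plane is `s` times the Kullback–Leibler divergence of the
rate `a / s` from the rate `r / (1 + r)` that belongs to the odds `r`. -/
theorem phi_sub {s a r : ℝ} (hs : 0 < s) (hr : 0 < r) :
    phi s a - (a * Real.log r - s * Real.log (1 + r)) =
      a * Real.log (a / (s * (r / (1 + r)))) + (s - a) * Real.log ((s - a) / (s * (1 / (1 + r)))) := by
  have h1 : 0 < 1 + r := by linarith
  rw [mul_log_div_mul hs (by positivity), mul_log_div_mul hs (by positivity),
    Real.log_div hr.ne' h1.ne', Real.log_div one_ne_zero h1.ne', Real.log_one, phi]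
  ring

/-- Gibbs' inequality: observed and expected counts both sum to `s`, so the linear lower bounds of
the two terms cancel. -/
theorem phi_lower {s a r : ℝ} (hs : 0 < s) (ha : 0 ≤ a) (has : a ≤ s) (hr : 0 < r) :
    a * Real.log r - s * Real.log (1 + r) ≤ phi s a := by
  have h1 : 0 < 1 + r := by linarith
  have h := phi_sub (a := a) hs hr
  have e1 := mul_log_le ha (x := s * (r / (1 + r))) (by positivity)
  have e2 := mul_log_le (sub_nonneg.2 has) (x := s * (1 / (1 + r))) (by positivity)
  have : s * (r / (1 + r)) + s * (1 / (1 + r)) = s := by field_simp; ring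
  linarith

/-- With `log z ≤ z - 1`, the Kullback–Leibler divergence is bounded by the chi-square divergence.
-/
theorem phi_upper {s a r : ℝ} (hs : 0 < s) (ha : 0 ≤ a) (has : a ≤ s) (hr : 0 < r) :
    phi s a ≤ a * Real.log r - s * Real.log (1 + r) + (a - r * (s - a)) ^ 2 / (s * r) := by
  have h1 : 0 < 1 + r := by linarith
  have h := phi_sub (a := a) hs hr
  have e1 := mul_log_ge ha (x := s * (r / (1 + r))) (by positivity)
  have e2 := mul_log_ge (sub_nonneg.2 has) (x := s * (1 / (1 + r))) (by positivity)
  have : a * (a / (s * (r / (1 + r))) - 1) + (s - a) * ((s - a) / (s * (1 / (1 + r))) - 1) =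
      (a - r * (s - a)) ^ 2 / (s * r) := by field_simp; ring
  linarith

/-- Splitting off the factor `n / A` from the first two logarithms produces the constant. The
logarithms of `(s - a) / s` and its counterpart for the complement are never split, so sets
consisting of ones only, or complements of this kind, need no special treatment. -/
theorem fB_eq {n A s a : ℝ} (hA : 0 < A) (hs : 0 < s) (hsn : s < n) (ha : 0 < a) (haA : a < A) :
    A * BernoulliScan.fB (A / n) (a / A) (s / n) =
      phi s a + phi (n - s) (A - a) + A * Real.log (n / A) := by
  have hn : 0 < n := hs.trans hsn
  have h1 : 0 < n - s := sub_pos.2 hsn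
  have h2 : 0 < A - a := sub_pos.2 haA
  have e1 : (a / A) / (s / n) = (a / s) * (n / A) := by field_simp
  have e2 : (1 - a / A) / (1 - s / n) = ((A - a) / (n - s)) * (n / A) := by field_simp
  have e3 : 1 - A / n * ((a / A) / (s / n)) = (s - a) / s := by field_simp
  have e4 : 1 - A / n * ((1 - a / A) / (1 - s / n)) = (n - s - (A - a)) / (n - s) := by
    rw [e2]; field_simp
  rw [BernoulliScan.fB, e3, e4, e1, e2, Real.log_mul (by positivity) (by positivity),
    Real.log_mul (by positivity) (by positivity), phi, phi]
  field_simp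
  ring

/-- Discrepancy of a set of `s` points with `a` ones. -/
noncomputable def disc (c n A s a : ℝ) : ℝ := c * BernoulliScan.fB (A / n) (a / A) (s / n)

/-- Possible counts of a supported set. -/
structure Feasible (n A s a : ℝ) : Prop where
  s_pos : 0 < s
  s_lt : s < n
  a_pos : 0 < a
  a_lt : a < A
  a_le : a ≤ s
  compl : A - a ≤ n - s

/-- The squared deviation that bounds the loss when odds `r` replace the odds `a : s - a`. -/
noncomputable def loss (s a r : ℝ) : ℝ := (a - r * (s - a)) ^ 2 / (s * r)

/-- Use the upper bound by the planes at `(s, a)` and the lower bound at `(s', a')`. The two planes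
add up to the linear form in `hv` plus terms in `A` and `n` that are the same for both pairs of
counts. -/
theorem disc_le {c n A s a s' a' r t E : ℝ} (hc : 0 < c) (h : Feasible n A s a)
    (h' : Feasible n A s' a') (hr : 0 < r) (ht : 0 < t)
    (hE : loss s a r + loss (n - s) (A - a) t ≤ E)
    (hv : (Real.log r - Real.log t) * a + (Real.log (1 + t) - Real.log (1 + r)) * s ≤
      (Real.log r - Real.log t) * a' + (Real.log (1 + t) - Real.log (1 + r)) * s') :
    disc c n A s a ≤ disc c n A s' a' + c * E / A := by
  have hA : 0 < A := h.a_pos.trans h.a_lt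
  have u1 := phi_upper h.s_pos h.a_pos.le h.a_le hr
  have u2 := phi_upper (sub_pos.2 h.s_lt) (sub_pos.2 h.a_lt).le h.compl ht
  have l1 := phi_lower h'.s_pos h'.a_pos.le h'.a_le hr
  have l2 := phi_lower (sub_pos.2 h'.s_lt) (sub_pos.2 h'.a_lt).le h'.compl ht
  have f1 := fB_eq hA h.s_pos h.s_lt h.a_pos h.a_lt
  have f2 := fB_eq hA h'.s_pos h'.s_lt h'.a_pos h'.a_lt
  unfold loss at hE
  have key : A * BernoulliScan.fB (A / n) (a / A) (s / n) ≤
      A * BernoulliScan.fB (A / n) (a' / A) (s' / n) + E := by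
    rw [f1, f2]
    linarith
  have := div_le_div_of_nonneg_right key hA.le
  rw [add_div, mul_div_cancel_left₀ _ hA.ne', mul_div_cancel_left₀ _ hA.ne'] at this
  have := mul_le_mul_of_nonneg_left this hc.le
  rw [disc, disc, mul_div_assoc]
  linarith

/-! ### Grids of odds -/

/-- The geometric grid. -/
noncomputable def geo (n M : ℝ) (i : ℕ) : ℝ := (1 + 1 / M) ^ i / n

/-- Let `r` be the predecessor of the first grid value above `a / b`. Then `0 ≤ a - r b ≤ r b / M`,
and the loss is at most `(r b) b / ((a + b) M²) ≤ a / M²`. -/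
theorem exists_geo {n M a b : ℝ} {N : ℕ} (hM : 1 ≤ M) (hn : 1 ≤ n) (ha : 1 ≤ a) (hb : 1 ≤ b)
    (han : a ≤ n) (hbn : b ≤ n) (hN : n < geo n M N) :
    ∃ i < N, loss (a + b) a (geo n M i) ≤ a / M ^ 2 := by
  have hM0 : 0 < M := by linarith
  have hn0 : 0 < n := by linarith
  have ha0 : 0 < a := by linarith
  have hb0 : 0 < b := by linarith
  have hex : ∃ i, a / b < geo n M i := ⟨N, lt_of_le_of_lt (by
    rw [div_le_iff₀ hb0]; nlinarith) hN⟩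
  classical
  set i := Nat.find hex with hi
  have hi1 : a / b < geo n M i := Nat.find_spec hex
  have hiN : i ≤ N := Nat.find_min' hex (lt_of_le_of_lt (by rw [div_le_iff₀ hb0]; nlinarith) hN)
  -- The grid starts at `1 / n`, which does not exceed `a / b` because `a ≥ 1` and `b ≤ n`; so a
  -- predecessor exists.
  have hi0 : i ≠ 0 := by
    intro h
    rw [h] at hi1
    simp only [geo, pow_zero] at hi1
    rw [div_lt_div_iff₀ hb0 hn0] at hi1
    nlinarith
  obtain ⟨j, hj⟩ := Nat.exists_eq_succ_of_ne_zero hi0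
  have hj1 : geo n M j ≤ a / b := not_lt.1 (Nat.find_min hex (by omega))
  refine ⟨j, by omega, ?_⟩
  have hr : 0 < geo n M j := by unfold geo; positivity
  have hs : geo n M i = geo n M j + geo n M j / M := by
    rw [hj, geo, geo, pow_succ]; field_simp
  rw [hs] at hi1
  set r := geo n M j
  rw [lt_iff_le_and_ne] at hi1
  have h1 : a ≤ r * b + r / M * b := by
    have := hi1.1
    rw [div_le_iff₀ hb0] at this; linarith
  have h2 : r * b ≤ a := by rwa [le_div_iff₀ hb0] at hj1
  rw [loss, div_le_div_iff₀ (by positivity) (by positivity), add_sub_cancel_left]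
  have h3 : (a - r * b) * M ≤ r * b := by
    have : (r * b + r / M * b - r * b) * M = r * b := by field_simp; ring
    nlinarith
  have h4 : ((a - r * b) * M) ^ 2 ≤ (r * b) ^ 2 :=
    pow_le_pow_left₀ (mul_nonneg (by linarith) hM0.le) h3 2
  calc (a - r * b) ^ 2 * M ^ 2 = ((a - r * b) * M) ^ 2 := by ring
    _ ≤ (r * b) ^ 2 := h4
    _ = (r * b) * (b * r) := by ring
    _ ≤ a * ((a + b) * r) := mul_le_mul h2 (by nlinarith) (by positivity) ha0.le

/-- Without failures the true odds are infinite; the finite value `M²` is already as good as the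
rest of the grid. -/
theorem loss_top {M a : ℝ} (hM : 0 < M) (ha : 0 < a) : loss a a (M ^ 2) = a / M ^ 2 := by
  rw [loss, sub_self, mul_zero, sub_zero]
  field_simp

/-- Round `√x` up to `y = j / M`. Then `y² - x = (y - √x) (y + √x)`, with factors at most `1 / M`
and `2 y`. The factor `y` in the error later cancels against the odds in the denominator of the
loss. -/
theorem exists_grid {M : ℕ} (hM : 1 ≤ M) {x : ℝ} (hx : 0 ≤ x) (hx1 : x ≤ 1) :
    ∃ j, 1 ≤ j ∧ j ≤ M ∧ |x - ((j : ℝ) / M) ^ 2| ≤ 2 / M * (j / M) := by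
  have hM0 : (0 : ℝ) < M := by exact_mod_cast hM
  set τ := Real.sqrt x with hτ
  have hτ0 : 0 ≤ τ := Real.sqrt_nonneg _
  have hτ1 : τ ≤ 1 := by rw [hτ]; exact Real.sqrt_le_one.2 hx1
  have hx2 : x = τ ^ 2 := (Real.sq_sqrt hx).symm
  -- The maximum with `1` keeps the grid value positive when `x = 0`; rounding up is still by at
  -- most one unit.
  refine ⟨max 1 ⌈τ * M⌉₊, le_max_left _ _, ?_, ?_⟩
  · refine max_le hM (Nat.ceil_le.2 ?_)
    nlinarith
  · set j := max 1 ⌈τ * M⌉₊ with hj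
    have h1 : τ * M ≤ j := (Nat.le_ceil _).trans (by exact_mod_cast le_max_right _ _)
    have h2 : (j : ℝ) ≤ τ * M + 1 := by
      rw [hj]
      push_cast
      refine max_le (by nlinarith) (Nat.ceil_lt_add_one (by positivity)).le
    have h1' : τ ≤ j / M := by rwa [le_div_iff₀ hM0]
    have h2' : (j : ℝ) / M ≤ τ + 1 / M := by
      rw [div_le_iff₀ hM0, add_mul, one_div_mul_cancel hM0.ne']; exact h2
    rw [hx2, abs_sub_comm, abs_of_nonneg (by nlinarith)]
    have : ((j : ℝ) / M) ^ 2 - τ ^ 2 = (j / M - τ) * (j / M + τ) := by ring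
    rw [this]
    calc ((j : ℝ) / M - τ) * (j / M + τ) ≤ (1 / M) * (2 * (j / M)) := by
          apply mul_le_mul <;> linarith [div_nonneg zero_le_one hM0.le]
      _ = _ := by ring

/-- The true odds are `4 G x` and the grid odds `4 G y²`, so the deviation is `4 G b (x - y²)`; the
factor `y²` of its squared bound cancels. -/
theorem loss_low {G M a b x y : ℝ} (hG : 0 < G) (hM : 0 < M) (hb : 0 < b) (ha : 0 < a)
    (hx : a = 4 * G * x * b) (hy : 0 < y) (h : |x - y ^ 2| ≤ 2 / M * y) :
    loss (a + b) a (4 * G * y ^ 2) ≤ 16 * G * b / M ^ 2 := by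
  have h2 : (x - y ^ 2) ^ 2 ≤ (2 / M * y) ^ 2 := by
    rw [← sq_abs (x - y ^ 2)]; exact pow_le_pow_left₀ (abs_nonneg _) h 2
  rw [loss, add_sub_cancel_left]
  have e : (a - 4 * G * y ^ 2 * b) ^ 2 = (4 * G * b) ^ 2 * (x - y ^ 2) ^ 2 := by rw [hx]; ring
  rw [e]
  calc (4 * G * b) ^ 2 * (x - y ^ 2) ^ 2 / ((a + b) * (4 * G * y ^ 2))
      ≤ (4 * G * b) ^ 2 * (2 / M * y) ^ 2 / (b * (4 * G * y ^ 2)) := by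
        gcongr
        linarith
    _ = 16 * G * b / M ^ 2 := by field_simp; ring

/-- The counterpart for large odds, with the reciprocal odds `x` approximated by `y²`; this includes
infinite odds, `b = 0`. -/
theorem loss_high {M a b x y : ℝ} (hM : 0 < M) (hb : 0 ≤ b) (ha : 0 < a)
    (hx : b = x * a) (hy : 0 < y) (h : |x - y ^ 2| ≤ 2 / M * y) :
    loss (a + b) a ((1 / y) ^ 2) ≤ 4 * a / M ^ 2 := by
  have h2 : (x - y ^ 2) ^ 2 ≤ (2 / M * y) ^ 2 := by
    rw [← sq_abs (x - y ^ 2)]; exact pow_le_pow_left₀ (abs_nonneg _) h 2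
  rw [loss, add_sub_cancel_left]
  have e : (a - (1 / y) ^ 2 * b) ^ 2 = (a / y ^ 2) ^ 2 * (x - y ^ 2) ^ 2 := by
    rw [hx]; field_simp; ring
  rw [e]
  calc (a / y ^ 2) ^ 2 * (x - y ^ 2) ^ 2 / ((a + b) * (1 / y) ^ 2)
      ≤ (a / y ^ 2) ^ 2 * (2 / M * y) ^ 2 / (a * (1 / y) ^ 2) := by
        gcongr
        linarith
    _ = 4 * a / M ^ 2 := by field_simp; ring

/-- The quadratic grids, the first `M` odds near `0` and the others near `∞`. -/
noncomputable def quad (G : ℝ) (M : ℕ) (j : ℕ) : ℝ :=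
  if j < M then 4 * G * (((j + 1 : ℕ) : ℝ) / M) ^ 2 else ((M : ℝ) / ((j - M + 1 : ℕ) : ℝ)) ^ 2

theorem exists_quad {n A a b : ℝ} {M : ℕ} (hM : 1 ≤ M) (hA : 0 < A) (ha : 0 < a) (hb : 0 ≤ b)
    (haA : a ≤ A) (hs : n / 2 ≤ a + b) (hbn : b ≤ n) (hn : 0 < n) :
    ∃ j < 2 * M, loss (a + b) a (quad (A / n) M j) ≤ 16 * A / M ^ 2 := by
  have hM0 : (0 : ℝ) < M := by exact_mod_cast hM
  by_cases hab : b ≤ a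
  · obtain ⟨j, h1, h2, h3⟩ := exists_grid hM (x := b / a) (by positivity)
      (by rw [div_le_one ha]; exact hab)
    have hj0 : (0 : ℝ) < j := by exact_mod_cast h1
    refine ⟨M + (j - 1), by omega, ?_⟩
    have e : quad (A / n) M (M + (j - 1)) = (1 / ((j : ℝ) / M)) ^ 2 := by
      have : M + (j - 1) - M + 1 = j := by omega
      rw [quad, if_neg (by omega), this, one_div_div]
    rw [e]
    refine (loss_high hM0 hb ha (by field_simp) (by positivity) h3).trans ?_
    gcongr
    · linarith
  · push Not at hab
    have hb0 : 0 < b := ha.trans hab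
    have hG : 0 < A / n := by positivity
    have hx1 : a / (4 * (A / n) * b) ≤ 1 := by
      rw [div_le_one (by positivity)]
      -- Fewer successes than failures among at least `n / 2` trials give `n ≤ 4 b`, hence odds at
      -- most `4 A / n`. This is the origin of the factor `4` in `quad`.
      have h5 : a * n ≤ 4 * A * b := by nlinarith
      have : 4 * (A / n) * b = 4 * A * b / n := by ring
      rw [this, le_div_iff₀ hn]; exact h5
    obtain ⟨j, h1, h2, h3⟩ := exists_grid hM (x := a / (4 * (A / n) * b)) (by positivity) hx1
    have hj0 : (0 : ℝ) < j := by exact_mod_cast h1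
    refine ⟨j - 1, by omega, ?_⟩
    have e : quad (A / n) M (j - 1) = 4 * (A / n) * ((j : ℝ) / M) ^ 2 := by
      have : j - 1 + 1 = j := by omega
      rw [quad, if_pos (by omega), this]
    rw [e]
    refine (loss_low hG hM0 hb0 ha (by field_simp) (by positivity) h3).trans ?_
    have : 16 * (A / n) * b ≤ 16 * A := by
      have : 16 * (A / n) * b = 16 * A * (b / n) := by ring
      rw [this]
      have : b / n ≤ 1 := by rwa [div_le_one hn]
      nlinarith
    gcongr

/-- The grid for the smaller of the set and its complement. -/
noncomputable def fine (n : ℝ) (M N i : ℕ) : ℝ := if i < N then geo n M i else (M : ℝ) ^ 2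

/-- Integrality matters here: a positive number of failures is at least `1`, so finite odds lie
within the range of the geometric grid. Infinite odds take the additional last value. -/
theorem exists_fine {n A a b : ℕ} {M N : ℕ} (hM : 1 ≤ M) (ha : 1 ≤ a) (haA : a ≤ A)
    (hn : a + b ≤ n) (hN : (n : ℝ) < geo n M N) :
    ∃ i < N + 1, loss ((a : ℝ) + b) a (fine n M N i) ≤ A / M ^ 2 := by
  have hM1 : (1 : ℝ) ≤ M := by exact_mod_cast hM
  have ha1 : (1 : ℝ) ≤ a := by exact_mod_cast ha
  have haA' : (a : ℝ) ≤ A := by exact_mod_cast haA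
  rcases Nat.eq_zero_or_pos b with rfl | hb
  · refine ⟨N, by omega, ?_⟩
    rw [fine, if_neg (lt_irrefl _), Nat.cast_zero, add_zero, loss_top (by linarith) (by linarith)]
    gcongr
  · obtain ⟨i, h1, h2⟩ := exists_geo (b := (b : ℝ)) hM1 (by exact_mod_cast (by omega : 1 ≤ n)) ha1
      (by exact_mod_cast hb) (by exact_mod_cast (by omega : a ≤ n))
      (by exact_mod_cast (by omega : b ≤ n)) hN
    refine ⟨i, by omega, ?_⟩
    rw [fine, if_pos h1]
    refine h2.trans ?_
    gcongr

theorem fine_pos {n : ℝ} {M N : ℕ} (hn : 0 < n) (hM : 1 ≤ M) (i : ℕ) : 0 < fine n M N i := by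
  have hM0 : (0 : ℝ) < M := by exact_mod_cast hM
  unfold fine geo
  split_ifs <;> positivity

theorem quad_pos {G : ℝ} {M : ℕ} (hG : 0 < G) (hM : 1 ≤ M) (j : ℕ) : 0 < quad G M j := by
  have hM0 : (0 : ℝ) < M := by exact_mod_cast hM
  unfold quad
  split_ifs <;> positivity

/-- Every pair of counts has nearly optimal odds in the grids, possibly with the roles of the set
and its complement exchanged. -/
theorem exists_direction {n A s a : ℕ} {M N : ℕ} (hM : 1 ≤ M) (h : Feasible n A s a)
    (hN : (n : ℝ) < geo n M N) :
    ∃ i < N + 1, ∃ j < 2 * M,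
      loss s a (fine n M N i) + loss (n - s) (A - a) (quad (A / n) M j) ≤ 17 * A / M ^ 2 ∨
      loss s a (quad (A / n) M j) + loss (n - s) (A - a) (fine n M N i) ≤ 17 * A / M ^ 2 := by
  obtain ⟨h1, h2, h3, h4, h5, h6⟩ := h
  have hn : (0 : ℝ) < n := h1.trans h2
  have hA : (0 : ℝ) < A := h3.trans h4
  have e : (17 * A / M ^ 2 : ℝ) = A / M ^ 2 + 16 * A / M ^ 2 := by ring
  have g1 : 1 ≤ a := by exact_mod_cast h3
  have g2 : a < A := by exact_mod_cast h4
  have g3 : a ≤ s := by exact_mod_cast h5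
  have g4 : s < n := by exact_mod_cast h2
  have g5 : A + s ≤ n + a := by
    have : (A : ℝ) + s ≤ n + a := by linarith
    exact_mod_cast this
  -- The geometric grid serves the smaller of the set and its complement; the other one has at least
  -- `n / 2` points, as the quadratic grid requires.
  by_cases hs : (s : ℝ) ≤ n / 2
  · obtain ⟨i, hi, hi'⟩ := exists_fine (n := n) (A := A) (b := s - a) hM g1 g2.le (by omega) hN
    obtain ⟨j, hj, hj'⟩ := exists_quad (n := n) (A := A) (a := A - a) (b := n - s - (A - a)) hM hA
      (by linarith) (by linarith) (by linarith) (by linarith) (by linarith) hn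
    refine ⟨i, hi, j, hj, Or.inl ?_⟩
    rw [Nat.cast_sub g3, add_sub_cancel] at hi'
    rw [add_sub_cancel] at hj'
    rw [e]
    exact add_le_add hi' hj'
  · push Not at hs
    obtain ⟨i, hi, hi'⟩ := exists_fine (n := n) (A := A) (a := A - a) (b := n - s - (A - a)) hM
      (by omega) (by omega) (by omega) hN
    obtain ⟨j, hj, hj'⟩ := exists_quad (n := n) (A := A) (a := a) (b := s - a) hM hA
      (by linarith) (by linarith) (by linarith) (by linarith) (by linarith) hn
    refine ⟨i, hi, j, hj, Or.inr ?_⟩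
    rw [← Nat.cast_add, show A - a + (n - s - (A - a)) = n - s by omega,
      Nat.cast_sub g4.le, Nat.cast_sub g2.le] at hi'
    rw [add_sub_cancel] at hj'
    rw [e, add_comm]
    exact add_le_add hi' hj'

end RectScan

namespace RectScan
open RealRAM

/-! ### Rules for single assignments -/

theorem wp_setNat_seq {a : ℕ} {i e : NatExpr} {q : Prog} {Q : Memory → Prop} {s : Memory} {B : ℕ}
    (h : wp q Q (s.writeNat a (i.eval s) (e.eval s)) B) :
    wp (.seq (.setNat a i e) q) Q s (i.cost + e.cost + 1 + B) :=
  wp_seq (R := fun s' => s' = s.writeNat a (i.eval s) (e.eval s))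
    ⟨_, _, .setNat _ _ _ _, le_rfl, rfl⟩ fun _ h' => h' ▸ h

theorem wp_setNat {a : ℕ} {i e : NatExpr} {Q : Memory → Prop} {s : Memory}
    (h : Q (s.writeNat a (i.eval s) (e.eval s))) : wp (.setNat a i e) Q s (i.cost + e.cost + 1) :=
  ⟨_, _, .setNat _ _ _ _, le_rfl, h⟩

/-! ### Inserting a point -/

/-- The point that is being swept over. -/
abbrev curPoint : NatExpr := .get 6 (nvar 22)

/-- Make the current point active. -/
noncomputable def insertPoint (k : ℕ) : Prog :=
  .seq (.setNat 50 (.lit 0) (.get 5 curPoint))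
    (.seq (.setNat 40 (nvar 50) (.add (.get 40 (nvar 50)) (.lit 1)))
      (.seq (.setNat 41 (nvar 50) (.add (.get 41 (nvar 50)) (.get 1 curPoint)))
        (updatePath k)))

theorem insertPoint_writesIn (k : ℕ) : (insertPoint k).WritesIn (Set.Ici 40) :=
  ⟨Set.mem_Ici.2 (by norm_num), Set.mem_Ici.2 le_rfl, Set.mem_Ici.2 (by norm_num), (updatePath_writesIn k).mono (Set.Ici_subset_Ici.2 (by norm_num))⟩

theorem insertPoint_wp (k : ℕ) {s : Memory} {m l p : ℕ} (hp : s.nat 6 (s.nat 22 0) = p)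
    (hl : s.nat 5 p = l) (hl₁ : m ≤ l) (hl₂ : l < 2 * m) (hhalf : ∀ ν < 2 * m, s.nat 4 ν = ν / 2)
    (h : TreeOK k s m) :
    wp (insertPoint k) (fun s' => TreeOK k s' m ∧
        (∀ j, s'.nat 40 j = s.nat 40 j + if j = l then 1 else 0) ∧
        (∀ j, s'.nat 41 j = s.nat 41 j + if j = l then s.nat 1 p else 0) ∧
        s'.nat 30 = s.nat 30 ∧ s'.real 30 = s.real 30) s
      ((Nat.log 2 l + 1) * nodeCost k + 30) := by
  set s₁ := s.writeNat 50 0 l with hs₁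
  set s₂ := s₁.writeNat 40 l (s.nat 40 l + 1) with hs₂
  set s₃ := s₂.writeNat 41 l (s.nat 41 l + s.nat 1 p) with hs₃
  have e50 : s₃.nat 50 0 = l := by simp [hs₃, hs₂, hs₁, Memory.writeNat_nat]
  have elow : ∀ a < 40, s₃.nat a = s.nat a := fun a ha => by
    rw [hs₃, hs₂, hs₁, Memory.writeNat_nat_of_ne _ (by omega),
      Memory.writeNat_nat_of_ne _ (by omega), Memory.writeNat_nat_of_ne _ (by omega)]
  have e40 : ∀ j, s₃.nat 40 j = s.nat 40 j + if j = l then 1 else 0 := fun j => by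
    by_cases hj : j = l <;> simp [hs₃, hs₂, hs₁, Memory.writeNat_nat, hj]
  have e41 : ∀ j, s₃.nat 41 j = s.nat 41 j + if j = l then s.nat 1 p else 0 := fun j => by
    by_cases hj : j = l <;> simp [hs₃, hs₂, hs₁, Memory.writeNat_nat, hj]
  have et : tab k s₃ = tab k s := by
    rw [hs₃, tab_writeNat _ (by norm_num), hs₂, tab_writeNat _ (by norm_num), hs₁,
      tab_writeNat _ (by norm_num)]
  have ew : weights s₃ = weights s := rfl
  have hup := (updatePath_wp k (s := s₃) (m := m) (by omega) (by omega)
    (by rw [elow 4 (by norm_num)]; exact hhalf) (by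
      intro ν hν hanc j h1 h2
      rw [et, ew]
      refine (h ν hν j h1 h2).congr fun i hi1 hi2 => ?_
      -- If the block of `ν` contained the changed leaf `l`, then `ν = l / 2 ^ j` would be an
      -- ancestor of `l`. So tables off the path see unchanged leaves.
      have hil : i ≠ l := by
        rintro rfl
        refine hanc j ?_
        rw [e50]
        exact Nat.div_eq_of_lt_le hi1 hi2
      funext f
      simp [leafVec, e40, e41, hil, elow])).frame (updatePath_writesIn k)
  refine wp.mono (wp_setNat_seq (wp_setNat_seq (wp_setNat_seq (B := (Nat.log 2 l + 1) * nodeCost k)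
    (Q := fun s' => TreeOK k s' m ∧ AgreeOff (Set.Ici 50) s₃ s') ?_))) ?_ ?_
  · have h1 : NatExpr.eval s (.get 5 curPoint) = l := by simp only [NatExpr.eval, hp, hl]
    have h2 : NatExpr.eval s₁ (nvar 50) = l := by simp [NatExpr.eval, hs₁, Memory.writeNat_nat]
    have h3 : NatExpr.eval s₁ (.add (.get 40 (nvar 50)) (.lit 1)) = s.nat 40 l + 1 := by
      simp [NatExpr.eval, hs₁, Memory.writeNat_nat]
    have h4 : NatExpr.eval s₂ (nvar 50) = l := by
      simp [NatExpr.eval, hs₂, hs₁, Memory.writeNat_nat]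
    have h5 : NatExpr.eval s₂ (.add (.get 41 (nvar 50)) (.get 1 curPoint)) =
        s.nat 41 l + s.nat 1 p := by
      simp [NatExpr.eval, hs₂, hs₁, Memory.writeNat_nat, hp]
    have h6 : NatExpr.eval s (.lit 0) = 0 := rfl
    rw [h6, h1, ← hs₁, h2, h3, ← hs₂, h4, h5, ← hs₃]
    rwa [e50] at hup
  · rintro s' ⟨h1, h2⟩
    refine ⟨h1, fun j => ?_, fun j => ?_, ?_, ?_⟩
    · rw [(h2 40 (by simp)).1, e40]
    · rw [(h2 41 (by simp)).1, e41]
    · rw [(h2 30 (by simp)).1, elow 30 (by norm_num)]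
    · rw [(h2 30 (by simp)).2]; rfl
  · simp only [NatExpr.cost]; omega


/-! ### Reading off the best region -/

/-- The counts satisfy the support condition. -/
def Supp (C n A s a : ℝ) : Prop :=
  (C / n ≤ a / A ∧ a / A ≤ 1 - C / n) ∧ C / n ≤ s / n ∧ s / n ≤ 1 - C / n

/-- Number of points. -/
abbrev nE : RealExpr := .ofNat (nvar 0)

/-- Number of ones. -/
abbrev onesE : RealExpr := .ofNat (nvar 2)

/-- The constant `1`. -/
abbrev oneE : RealExpr := .ofNat (.lit 1)

/-- Component of the root entry with key `κ`. -/
noncomputable abbrev rootE {k : ℕ} (κ : Key k) (i : ℕ) : NatExpr := .get (nm κ i) (.lit 1)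

/-- Fraction of the measurement. -/
noncomputable abbrev mE {k : ℕ} (κ : Key k) : RealExpr := .div (.ofNat (rootE κ 1)) onesE

/-- Fraction of the points. -/
noncomputable abbrev bE {k : ℕ} (κ : Key k) : RealExpr := .div (.ofNat (rootE κ 0)) nE

/-- Overall success rate. -/
abbrev rateE : RealExpr := .div onesE nE

/-- The level of support. -/
abbrev levelE : RealExpr := .div (.get 3 (.lit 1)) nE

/-- Discrepancy of the root entry with key `κ`. -/
noncomputable def discE {k : ℕ} (κ : Key k) : RealExpr :=
  .mul (.get 3 (.lit 2))
    (.add (.add (.add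
      (.mul (mE κ) (.log (.div (mE κ) (bE κ))))
      (.mul (.sub oneE (mE κ)) (.log (.div (.sub oneE (mE κ)) (.sub oneE (bE κ))))))
      (.mul (.sub (.div (bE κ) rateE) (mE κ))
        (.log (.sub oneE (.mul rateE (.div (mE κ) (bE κ)))))))
      (.mul (.add (.sub (.div (.sub oneE (bE κ)) rateE) oneE) (mE κ))
        (.log (.sub oneE (.mul rateE (.div (.sub oneE (mE κ)) (.sub oneE (bE κ))))))))

theorem discE_eval {k : ℕ} (κ : Key k) (s : Memory) :
    (discE κ).eval s =
      disc (s.real 3 2) (s.nat 0 0) (s.nat 2 0) (s.nat (nm κ 0) 1) (s.nat (nm κ 1) 1) := by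
  simp [discE, RealExpr.eval, NatExpr.eval, disc, BernoulliScan.fB]

/-- The root entry with key `κ` is supported. -/
noncomputable def suppE {k : ℕ} (κ : Key k) : Cond :=
  .and (.and (.not (.realLt (mE κ) levelE)) (.not (.realLt (.sub oneE levelE) (mE κ))))
    (.and (.not (.realLt (bE κ) levelE)) (.not (.realLt (.sub oneE levelE) (bE κ))))

theorem suppE_holds {k : ℕ} (κ : Key k) (s : Memory) :
    (suppE κ).Holds s ↔
      Supp (s.real 3 1) (s.nat 0 0) (s.nat 2 0) (s.nat (nm κ 0) 1) (s.nat (nm κ 1) 1) := by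
  simp [suppE, Cond.Holds, RealExpr.eval, NatExpr.eval, Supp]

/-- Record the region of the root entry with key `κ`. -/
noncomputable def record {k : ℕ} (κ : Key k) : Prog :=
  block [.setReal 30 (.lit 0) (.get 0 (nvar 21)),
    .setReal 30 (.lit 1) (.get 1 (.get 7 (rootE κ 4))),
    .setReal 30 (.lit 2) (.get 0 curPoint),
    .setReal 30 (.lit 3) (.get 1 (.get 7 (.sub (.add (rootE κ 4) (rootE κ 5)) (.lit 1)))),
    .setReal 30 (.lit 4) (discE κ),
    .setReal 30 (.lit 5) (.get 2 (nvar 20)),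
    .setNat 30 (.lit 0) (.lit 1)]

/-- Compare the root entry with key `κ` with the best region so far. -/
noncomputable def inspect {k : ℕ} (κ : Key k) : Prog :=
  .ite (.and (.and (.natLt (.lit 0) (rootE κ 6)) (suppE κ))
      (.not (.and (.natLt (.lit 0) (nvar 30)) (.not (.realLt (.get 30 (.lit 4)) (discE κ))))))
    (record κ) .skip

/-- Compare all root entries with the best region so far. -/
noncomputable def query (k : ℕ) : Prog :=
  block ((Finset.univ : Finset (Key k)).toList.map inspect)

/-- The recorded region, if there is one, has the property `V`. -/
def BestOK (V : ℝ → ℝ → ℝ → ℝ → ℝ → ℝ → Prop) (s : Memory) : Prop :=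
  s.nat 30 0 ≠ 0 →
    V (s.real 30 0) (s.real 30 1) (s.real 30 2) (s.real 30 3) (s.real 30 4) (s.real 30 5)

/-- A region with discrepancy at least `d` has been recorded. -/
def Beats (d : ℝ) (s : Memory) : Prop := s.nat 30 0 ≠ 0 ∧ d ≤ s.real 30 4

theorem exec_record {k : ℕ} (κ : Key k) (s : Memory) :
    ((record κ).exec s).nat 30 0 = 1 ∧
    ((record κ).exec s).real 30 0 = s.real 0 (s.nat 21 0) ∧
    ((record κ).exec s).real 30 1 = s.real 1 (s.nat 7 (s.nat (nm κ 4) 1)) ∧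
    ((record κ).exec s).real 30 2 = s.real 0 (s.nat 6 (s.nat 22 0)) ∧
    ((record κ).exec s).real 30 3 =
      s.real 1 (s.nat 7 (s.nat (nm κ 4) 1 + s.nat (nm κ 5) 1 - 1)) ∧
    ((record κ).exec s).real 30 4 =
      disc (s.real 3 2) (s.nat 0 0) (s.nat 2 0) (s.nat (nm κ 0) 1) (s.nat (nm κ 1) 1) ∧
    ((record κ).exec s).real 30 5 = s.real 2 (s.nat 20 0) := by
  simp only [record, block_cons, block_nil, Prog.exec, discE_eval]
  simp [RealExpr.eval, NatExpr.eval, Memory.writeNat_nat, Memory.writeReal_real]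

theorem record_writesIn {k : ℕ} (κ : Key k) : (record κ).WritesIn {30} := by
  simp [record, Prog.WritesIn]

theorem record_loopFree {k : ℕ} (κ : Key k) : (record κ).LoopFree := by
  simp [record, Prog.LoopFree]

theorem query_writesIn (k : ℕ) : (query k).WritesIn {30} := writesIn_block (by
  simp only [List.mem_map, forall_exists_index, and_imp, forall_apply_eq_imp_iff₂]
  exact fun κ _ => ⟨record_writesIn κ, trivial⟩)

theorem query_loopFree (k : ℕ) : (query k).LoopFree :=
  loopFree_block_map fun κ _ => ⟨record_loopFree κ, trivial⟩

/-- The tables maximize a linear surrogate, but the record is compared by the true discrepancy.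
Hence it never decreases and dominates every supported root entry, across all directions. -/
theorem query_spec {k : ℕ} {V : ℝ → ℝ → ℝ → ℝ → ℝ → ℝ → Prop} {C c : ℝ} {n A : ℕ} (s : Memory)
    (hC : s.real 3 1 = C) (hc : s.real 3 2 = c) (hn : s.nat 0 0 = n) (hA : s.nat 2 0 = A)
    (hV : ∀ κ e, tab k s 1 κ = some e → Supp C n A (e 0) (e 1) →
      V (s.real 0 (s.nat 21 0)) (s.real 1 (s.nat 7 (e 4))) (s.real 0 (s.nat 6 (s.nat 22 0)))
        (s.real 1 (s.nat 7 (e 4 + e 5 - 1))) (disc c n A (e 0) (e 1)) (s.real 2 (s.nat 20 0)))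
    (hb : BestOK V s) :
    let s' := (query k).exec s
    BestOK V s' ∧ (∀ d, Beats d s → Beats d s') ∧
      ∀ κ e, tab k s 1 κ = some e → Supp C n A (e 0) (e 1) → Beats (disc c n A (e 0) (e 1)) s' := by
  simp only [query, exec_block, List.foldl_map]
  have := foldl_invariant (s := s) (fun s (κ : Key k) => (inspect κ).exec s)
    (fun l s' => AgreeOff {30} s s' ∧ BestOK V s' ∧ (∀ d, Beats d s → Beats d s') ∧
      ∀ κ ∈ l, ∀ e, tab k s 1 κ = some e → Supp C n A (e 0) (e 1) →
        Beats (disc c n A (e 0) (e 1)) s')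
    ⟨.refl _ _, hb, fun _ h => h, by simp⟩ (Finset.univ : Finset (Key k)).toList (by
      rintro l κ s' - ⟨h1, h2, h3, h4⟩
      have a : ∀ a, a ≠ 30 → s'.nat a = s.nat a := fun a ha => (h1 a (by simpa using ha)).1
      have ar : ∀ a, a ≠ 30 → s'.real a = s.real a := fun a ha => (h1 a (by simpa using ha)).2
      have anm : ∀ i, s'.nat (nm κ i) = s.nat (nm κ i) := fun i =>
        a _ (ne_nm κ i (by norm_num)).symm
      obtain ⟨r0, r1, r2, r3, r4, r5, r6⟩ := exec_record κ s'
      simp only [ar 3 (by norm_num), a 0 (by norm_num), a 2 (by norm_num), anm, hc, hn, hA,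
        ar 0 (by norm_num), ar 1 (by norm_num), ar 2 (by norm_num), a 21 (by norm_num),
        a 7 (by norm_num), a 6 (by norm_num), a 22 (by norm_num), a 20 (by norm_num)]
        at r1 r2 r3 r4 r5 r6
      simp only [inspect, Prog.exec]
      split_ifs with hg
      · simp only [Cond.Holds, suppE_holds, NatExpr.eval, RealExpr.eval, discE_eval, anm,
          ar 3 (by norm_num), a 0 (by norm_num), a 2 (by norm_num), hC, hc, hn, hA] at hg
        obtain ⟨⟨g1, g2⟩, g3⟩ := hg
        have ht : tab k s 1 κ = _ := tab_eq_some.2 ⟨g1, rfl⟩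
        refine ⟨h1.trans ((record_loopFree κ).agreeOff (record_writesIn κ) s'), ?_, ?_, ?_⟩
        · intro _
          rw [r1, r2, r3, r4, r5, r6]
          exact hV κ _ ht g2
        · intro d hd
          have hd' := h3 d hd
          refine ⟨by rw [r0]; norm_num, ?_⟩
          rw [r5]
          have h5 := hd'.1
          have h6 := hd'.2
          rw [not_and, not_not] at g3
          exact h6.trans (g3 (by omega)).le
        · intro κ' hκ' e he hs
          refine ⟨by rw [r0]; norm_num, ?_⟩
          rw [r5]
          simp only [List.mem_append, List.mem_singleton] at hκ'
          rcases hκ' with hκ' | rfl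
          · have h5 := (h4 κ' hκ' e he hs).1
            have h6 := (h4 κ' hκ' e he hs).2
            rw [not_and, not_not] at g3
            exact h6.trans (g3 (by omega)).le
          · rw [ht, Option.some.injEq] at he
            rw [← he]; rfl
      · simp only [Cond.Holds, suppE_holds, NatExpr.eval, RealExpr.eval, discE_eval, anm,
          ar 3 (by norm_num), a 0 (by norm_num), a 2 (by norm_num), hC, hc, hn, hA] at hg
        refine ⟨h1, h2, h3, fun κ' hκ' e he hs => ?_⟩
        simp only [List.mem_append, List.mem_singleton] at hκ'
        rcases hκ' with hκ' | rfl
        · exact h4 κ' hκ' e he hs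
        · obtain ⟨g1, rfl⟩ := tab_eq_some.1 he
          have g3 := not_not.1 fun h => hg ⟨⟨g1, hs⟩, h⟩
          exact ⟨by omega, not_lt.1 g3.2⟩)
  exact ⟨this.2.1, this.2.2.1, fun κ e => this.2.2.2 κ (by simp) e⟩

end RectScan

namespace RectScan
open RealRAM

/-! ### Regions -/

/-- A family of points with measurements and time stamps. -/
structure Inst where
  n : ℕ
  b : ℕ → ℕ
  X : ℕ → ℝ
  Y : ℕ → ℝ
  T : ℕ → ℝ

namespace Inst

variable (D : Inst)

/-- Total number of ones. -/
def A : ℕ := ∑ i ∈ Finset.range D.n, D.b i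

open Classical in
/-- The points in `[x₀, x₂] × [x₁, x₃]` with time stamp in `[τ, ∞)`. -/
noncomputable def region (x₀ x₁ x₂ x₃ τ : ℝ) : Finset ℕ :=
  (Finset.range D.n).filter fun i =>
    (D.X i ∈ Set.Icc x₀ x₂ ∧ D.Y i ∈ Set.Icc x₁ x₃) ∧ τ ≤ D.T i

/-- Number of ones in a set of points. -/
def ones (S : Finset ℕ) : ℕ := ∑ i ∈ S, D.b i

open Classical in
/-- Number of points with a smaller second coordinate. -/
noncomputable def rank (i : ℕ) : ℕ := ((Finset.range D.n).filter fun q => D.Y q < D.Y i).card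

variable {D}

theorem rank_lt {i : ℕ} (hi : i < D.n) : D.rank i < D.n := by
  classical
  have : ((Finset.range D.n).filter fun q => D.Y q < D.Y i) ⊂ Finset.range D.n :=
    Finset.filter_ssubset.2 ⟨i, Finset.mem_range.2 hi, lt_irrefl _⟩
  simpa [rank] using Finset.card_lt_card this

/-- In particular, points with equal second coordinates share a leaf, so no labelling separates
them. -/
theorem rank_mono {i j : ℕ} (h : D.Y i ≤ D.Y j) : D.rank i ≤ D.rank j := by
  classical
  refine Finset.card_le_card fun q hq => ?_
  simp only [Finset.mem_filter] at hq ⊢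
  exact ⟨hq.1, hq.2.trans_le h⟩

theorem rank_strict {i j : ℕ} (hi : i < D.n) (h : D.Y i < D.Y j) : D.rank i < D.rank j := by
  classical
  refine Finset.card_lt_card (Finset.ssubset_iff_of_subset (fun q hq => ?_) |>.2 ⟨i, ?_, ?_⟩)
  · simp only [Finset.mem_filter] at hq ⊢
    exact ⟨hq.1, hq.2.trans h⟩
  · simp [hi, h]
  · simp

end Inst

/-- The function `o` lists the points `0, …, n - 1` by increasing `f`. -/
structure IsOrder (n : ℕ) (f : ℕ → ℝ) (o : ℕ → ℕ) : Prop where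
  bij : Set.BijOn o (Set.Iio n) (Set.Iio n)
  mono : ∀ u v, u ≤ v → v < n → f (o u) ≤ f (o v)

theorem IsOrder.sum {n : ℕ} {f : ℕ → ℝ} {o : ℕ → ℕ} (h : IsOrder n f o) (g : ℕ → ℕ) :
    ∑ v ∈ Finset.range n, g (o v) = ∑ i ∈ Finset.range n, g i := by
  refine Finset.sum_nbij o ?_ ?_ ?_ fun _ _ => rfl
  · intro v hv
    simpa using h.bij.mapsTo (by simpa using hv)
  · have := h.bij.injOn
    simpa [Set.InjOn] using this
  · intro i hi
    obtain ⟨v, hv, rfl⟩ := h.bij.surjOn (by simpa using hi : i ∈ Set.Iio n)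
    exact ⟨v, by simpa using hv, rfl⟩

theorem IsOrder.lt {n : ℕ} {f : ℕ → ℝ} {o : ℕ → ℕ} (h : IsOrder n f o) {v : ℕ} (hv : v < n) :
    o v < n := h.bij.mapsTo hv

theorem IsOrder.exists_eq {n : ℕ} {f : ℕ → ℝ} {o : ℕ → ℕ} (h : IsOrder n f o) {i : ℕ}
    (hi : i < n) : ∃ v < n, o v = i := h.bij.surjOn hi

/-- A downward closed set of positions is an initial segment, whose length is its cardinality. -/
theorem iff_lt_card_filter {n : ℕ} {P : ℕ → Prop} [DecidablePred P]
    (hP : ∀ u v, u ≤ v → v < n → P v → P u) {v : ℕ} (hv : v < n) :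
    P v ↔ v < ((Finset.range n).filter P).card := by
  constructor
  · intro h
    have : Finset.range (v + 1) ⊆ (Finset.range n).filter P := fun u hu => by
      simp only [Finset.mem_range, Finset.mem_filter] at hu ⊢
      exact ⟨by omega, hP u v (by omega) hv h⟩
    have := Finset.card_le_card this
    rwa [Finset.card_range] at this
  · intro h
    by_contra hn
    have : (Finset.range n).filter P ⊆ Finset.range v := fun u hu => by
      simp only [Finset.mem_range, Finset.mem_filter] at hu ⊢
      by_contra huv
      exact hn (hP v u (by omega) hu.1 hu.2)
    have := Finset.card_le_card this
    rw [Finset.card_range] at this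
    omega

/-! ### Labellings of the whole tree -/

/-- Sum of `g` over the points stored at leaf `l`. -/
def hist (n : ℕ) (leaf g : ℕ → ℕ) (l : ℕ) : ℕ :=
  ∑ i ∈ Finset.range n, if leaf i = l then g i else 0

theorem sum_hist {n L R : ℕ} {leaf : ℕ → ℕ} (g : ℕ → ℕ)
    (hleaf : ∀ i < n, leaf i ∈ Finset.Ico L R) (P : ℕ → Prop) [DecidablePred P] :
    ∑ l ∈ Finset.Ico L R, (if P l then hist n leaf g l else 0) =
      ∑ i ∈ Finset.range n, if P (leaf i) then g i else 0 := by
  have : ∀ l, (if P l then hist n leaf g l else 0) =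
      ∑ i ∈ Finset.range n, if leaf i = l then (if P l then g i else 0) else 0 := fun l => by
    by_cases h : P l <;> simp [hist, h]
  simp_rw [this]
  rw [Finset.sum_comm]
  refine Finset.sum_congr rfl fun i hi => ?_
  rw [Finset.sum_ite_eq, if_pos (hleaf i (Finset.mem_range.1 hi))]

theorem hist_mono {n : ℕ} {leaf g g' : ℕ → ℕ} (h : ∀ i < n, g i ≤ g' i) (l : ℕ) :
    hist n leaf g l ≤ hist n leaf g' l :=
  Finset.sum_le_sum fun i hi => by
    split_ifs
    · exact h i (Finset.mem_range.1 hi)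
    · exact le_rfl

/-- The leaf arrays in memory describe the points, those with `u i = 1` being active. -/
structure LeavesOK (D : Inst) (m : ℕ) (u : ℕ → ℕ) (s : Memory) : Prop where
  count : ∀ l < 2 * m, s.nat 8 l = hist D.n (fun i => m + D.rank i) (fun _ => 1) l
  ones : ∀ l < 2 * m, s.nat 9 l = hist D.n (fun i => m + D.rank i) D.b l
  actCount : ∀ l < 2 * m, s.nat 40 l = hist D.n (fun i => m + D.rank i) u l
  actOnes : ∀ l < 2 * m, s.nat 41 l = hist D.n (fun i => m + D.rank i) (fun i => u i * D.b i) l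

variable {D : Inst} {m : ℕ} {u : ℕ → ℕ} {s : Memory}

theorem leaf_mem (hm : D.n ≤ m) {i : ℕ} (hi : i < D.n) : m + D.rank i ∈ Finset.Ico m (2 * m) := by
  have := Inst.rank_lt hi
  simp only [Finset.mem_Ico]; omega

/-- Components `4` and `5` count all points at the leaves concerned, active or not, because they
will serve as positions in the order of all points. -/
theorem total_leafVec (h : LeavesOK D m u s) (hm : D.n ≤ m) (hu : ∀ i, u i ≤ 1)
    (lab : ℕ → Fin 3) :
    let e := total (leafVec s) lab m (2 * m)
    e 0 = (∑ i ∈ Finset.range D.n, if lab (m + D.rank i) = 1 then u i else 0) ∧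
    e 1 = (∑ i ∈ Finset.range D.n, if lab (m + D.rank i) = 1 then u i * D.b i else 0) ∧
    e 0 + e 2 = D.n ∧ e 1 + e 3 = D.A ∧
    e 4 = ((Finset.range D.n).filter fun i => lab (m + D.rank i) = 0).card ∧
    e 5 = ((Finset.range D.n).filter fun i => lab (m + D.rank i) = 1).card := by
  have hl := fun i hi => leaf_mem (D := D) (m := m) hm (i := i) hi
  have hmem : ∀ l ∈ Finset.Ico m (2 * m), l < 2 * m := fun l hl => (Finset.mem_Ico.1 hl).2
  simp only [total, Finset.sum_apply]
  have e0 : ∑ l ∈ Finset.Ico m (2 * m), leafVec s l (lab l) 0 =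
      ∑ i ∈ Finset.range D.n, if lab (m + D.rank i) = 1 then u i else 0 := by
    rw [← sum_hist u hl fun l => lab l = 1]
    refine Finset.sum_congr rfl fun l hl => ?_
    rw [← h.actCount l (hmem l hl)]; rfl
  have e1 : ∑ l ∈ Finset.Ico m (2 * m), leafVec s l (lab l) 1 =
      ∑ i ∈ Finset.range D.n, if lab (m + D.rank i) = 1 then u i * D.b i else 0 := by
    rw [← sum_hist (fun i => u i * D.b i) hl fun l => lab l = 1]
    refine Finset.sum_congr rfl fun l hl => ?_
    rw [← h.actOnes l (hmem l hl)]; rfl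
  refine ⟨e0, e1, ?_, ?_, ?_, ?_⟩
  · rw [← Finset.sum_add_distrib]
    have := sum_hist (fun _ => 1) hl fun _ => True
    simp only [if_true, Finset.sum_const, Finset.card_range, smul_eq_mul, mul_one] at this
    rw [← this]
    refine Finset.sum_congr rfl fun l hl => ?_
    -- Needed for the truncated subtraction in the leaf vectors to be exact.
    have h1 : s.nat 40 l ≤ s.nat 8 l := by
      rw [h.actCount l (hmem l hl), h.count l (hmem l hl)]
      exact hist_mono (fun i _ => hu i) l
    rw [← h.count l (hmem l hl)]
    simp only [leafVec, Matrix.cons_val]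
    split_ifs <;> omega
  · rw [← Finset.sum_add_distrib]
    have := sum_hist D.b hl fun _ => True
    simp only [if_true] at this
    rw [Inst.A, ← this]
    refine Finset.sum_congr rfl fun l hl => ?_
    have h1 : s.nat 41 l ≤ s.nat 9 l := by
      rw [h.actOnes l (hmem l hl), h.ones l (hmem l hl)]
      exact hist_mono (fun i _ => by nlinarith [hu i]) l
    rw [← h.ones l (hmem l hl)]
    simp only [leafVec, Matrix.cons_val]
    split_ifs <;> omega
  · rw [Finset.card_filter, ← sum_hist (fun _ => 1) hl fun l => lab l = 0]
    refine Finset.sum_congr rfl fun l hl => ?_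
    rw [← h.count l (hmem l hl)]; rfl
  · rw [Finset.card_filter, ← sum_hist (fun _ => 1) hl fun l => lab l = 1]
    refine Finset.sum_congr rfl fun l hl => ?_
    rw [← h.count l (hmem l hl)]; rfl

/-- Points with label `1` are those in the range between the extreme points with label `1`. -/
theorem label_eq_one_iff (hm : D.n ≤ m) {oy : ℕ → ℕ} (hoy : IsOrder D.n D.Y oy) {lab : ℕ → Fin 3}
    (hlab : MonotoneOn lab (Set.Ico m (2 * m))) {d₀ d₁ : ℕ}
    (h₀ : d₀ = ((Finset.range D.n).filter fun i => lab (m + D.rank i) = 0).card)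
    (h₁ : d₁ = ((Finset.range D.n).filter fun i => lab (m + D.rank i) = 1).card)
    (hpos : 0 < d₁) {i : ℕ} (hi : i < D.n) :
    lab (m + D.rank i) = 1 ↔ D.Y (oy d₀) ≤ D.Y i ∧ D.Y i ≤ D.Y (oy (d₀ + d₁ - 1)) := by
  have hmono : ∀ i j, i < D.n → j < D.n → D.Y i ≤ D.Y j →
      lab (m + D.rank i) ≤ lab (m + D.rank j) := fun i j hi hj hij =>
    hlab (Finset.mem_Ico.1 (leaf_mem hm hi)) (Finset.mem_Ico.1 (leaf_mem hm hj))
      (Nat.add_le_add_left (Inst.rank_mono hij) m)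
  have hq : ∀ u v, u ≤ v → v < D.n → lab (m + D.rank (oy u)) ≤ lab (m + D.rank (oy v)) :=
    fun u v huv hv => hmono _ _ (hoy.lt (by omega)) (hoy.lt hv) (hoy.mono u v huv hv)
  -- Along the sorted order the labels increase, so the counts `d₀` and `d₁` alone determine which
  -- positions carry label `1`: those from `d₀` to `d₀ + d₁ - 1`.
  have c₀ : d₀ = ((Finset.range D.n).filter fun v => lab (m + D.rank (oy v)) = 0).card := by
    rw [h₀, Finset.card_filter, Finset.card_filter,
      ← hoy.sum fun i => if lab (m + D.rank i) = 0 then 1 else 0]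
  have c₁ : d₀ + d₁ = ((Finset.range D.n).filter fun v => lab (m + D.rank (oy v)) ≤ 1).card := by
    rw [h₀, h₁, Finset.card_filter, Finset.card_filter, Finset.card_filter,
      ← Finset.sum_add_distrib, hoy.sum fun i => if lab (m + D.rank i) ≤ 1 then 1 else 0]
    refine Finset.sum_congr rfl fun i _ => ?_
    generalize lab (m + D.rank i) = f
    fin_cases f <;> simp
  have z₀ : ∀ v, v < D.n → (lab (m + D.rank (oy v)) = 0 ↔ v < d₀) := fun v hv => by
    rw [c₀]
    refine iff_lt_card_filter (P := fun v => lab (m + D.rank (oy v)) = 0) ?_ hv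
    intro u v huv hv h
    have := hq u v huv hv
    rw [h] at this
    exact Fin.le_zero_iff.1 this
  have z₁ : ∀ v, v < D.n → (lab (m + D.rank (oy v)) ≤ 1 ↔ v < d₀ + d₁) := fun v hv => by
    rw [c₁]
    exact iff_lt_card_filter (P := fun v => lab (m + D.rank (oy v)) ≤ 1)
      (fun u v huv hv h => (hq u v huv hv).trans h) hv
  have hle : d₀ + d₁ ≤ D.n := by
    rw [c₁]
    exact (Finset.card_filter_le _ _).trans (Finset.card_range _).le
  have one_iff : ∀ f : Fin 3, f = 1 ↔ f ≠ 0 ∧ f ≤ 1 := by decide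
  constructor
  · intro h
    obtain ⟨v, hv, rfl⟩ := hoy.exists_eq hi
    obtain ⟨g1, g2⟩ := (one_iff _).1 h
    rw [Ne, z₀ v hv] at g1
    rw [z₁ v hv] at g2
    exact ⟨hoy.mono _ _ (by omega) hv, hoy.mono _ _ (by omega) (by omega)⟩
  · rintro ⟨g1, g2⟩
    refine (one_iff _).2 ⟨fun h => ?_, ?_⟩
    · have := hmono _ _ (hoy.lt (by omega : d₀ < D.n)) hi g1
      rw [h, Fin.le_zero_iff, z₀ d₀ (by omega)] at this
      omega
    · have := hmono _ _ hi (hoy.lt (by omega : d₀ + d₁ - 1 < D.n)) g2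
      exact this.trans ((z₁ _ (by omega)).2 (by omega))

open Classical in
/-- The labelling by a range of second coordinates. -/
noncomputable def rangeLabel (D : Inst) (m : ℕ) (lo hi : ℝ) (l : ℕ) : Fin 3 :=
  if ∃ i < D.n, l ≤ m + D.rank i ∧ D.Y i < lo then 0
  else if ∃ i < D.n, l ≤ m + D.rank i ∧ D.Y i ≤ hi then 1 else 2

/-- The definition looks at points at leaf `l` or later, which labels the empty leaves consistently;
both of its conditions become stronger as `l` grows. -/
theorem rangeLabel_mono (lo hi : ℝ) : Monotone (rangeLabel D m lo hi) := by
  intro a b hab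
  unfold rangeLabel
  have h1 : (∃ i < D.n, b ≤ m + D.rank i ∧ D.Y i < lo) →
      ∃ i < D.n, a ≤ m + D.rank i ∧ D.Y i < lo :=
    fun ⟨i, x, y, z⟩ => ⟨i, x, hab.trans y, z⟩
  have h2 : (∃ i < D.n, b ≤ m + D.rank i ∧ D.Y i ≤ hi) →
      ∃ i < D.n, a ≤ m + D.rank i ∧ D.Y i ≤ hi :=
    fun ⟨i, x, y, z⟩ => ⟨i, x, hab.trans y, z⟩
  split_ifs <;> first
    | decide
    | exact absurd (h1 (by assumption)) (by assumption)
    | exact absurd (h2 (by assumption)) (by assumption)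

theorem rangeLabel_eq_one {lo hi : ℝ} {j : ℕ} (hj : j < D.n) :
    rangeLabel D m lo hi (m + D.rank j) = 1 ↔ lo ≤ D.Y j ∧ D.Y j ≤ hi := by
  have hle : ∀ i < D.n, m + D.rank j ≤ m + D.rank i → D.Y j ≤ D.Y i := fun i hi h => by
    by_contra hlt
    have := Inst.rank_strict hi (not_le.1 hlt)
    omega
  have h1 : (∃ i < D.n, m + D.rank j ≤ m + D.rank i ∧ D.Y i < lo) ↔ D.Y j < lo :=
    ⟨fun ⟨i, x, y, z⟩ => (hle i x y).trans_lt z, fun h => ⟨j, hj, le_rfl, h⟩⟩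
  have h2 : (∃ i < D.n, m + D.rank j ≤ m + D.rank i ∧ D.Y i ≤ hi) ↔ D.Y j ≤ hi :=
    ⟨fun ⟨i, x, y, z⟩ => (hle i x y).trans z, fun h => ⟨j, hj, le_rfl, h⟩⟩
  unfold rangeLabel
  rw [if_congr h1 rfl (if_congr h2 rfl rfl)]
  split_ifs with g1 g2
  · simp [g1]
  · simp [not_lt.1 g1, g2]
  · simp [g2]

/-! ### Root entries and regions -/

theorem supp_bounds {C n A s a : ℝ} (hC : 0 < C) (hn : 0 < n) (hA : 0 ≤ A)
    (h : Supp C n A s a) : 0 < A ∧ C * A / n ≤ a ∧ C * A / n ≤ A - a ∧ C ≤ s ∧ C ≤ n - s := by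
  obtain ⟨⟨h1, h2⟩, h3, h4⟩ := h
  have hCn : 0 < C / n := by positivity
  have hA0 : 0 < A := by
    rcases hA.eq_or_lt with rfl | h
    · rw [div_zero] at h1; linarith
    · exact h
  have e1 := mul_le_mul_of_nonneg_right h1 hA0.le
  have e2 := mul_le_mul_of_nonneg_right h2 hA0.le
  have e3 := mul_le_mul_of_nonneg_right h3 hn.le
  have e4 := mul_le_mul_of_nonneg_right h4 hn.le
  rw [div_mul_cancel₀ _ hA0.ne'] at e1 e2
  rw [div_mul_cancel₀ _ hn.ne'] at e3 e4
  have e5 : C / n * A = C * A / n := by ring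
  rw [sub_mul, one_mul, div_mul_cancel₀ _ hn.ne'] at e4
  rw [div_mul_cancel₀ _ hn.ne'] at e3
  exact ⟨hA0, by linarith, by linarith, e3, by linarith⟩

theorem supp_of_bounds {C n A s a : ℝ} (hn : 0 < n) (hA : 0 < A) (h1 : C * A / n ≤ a)
    (h2 : C * A / n ≤ A - a) (h3 : C ≤ s) (h4 : C ≤ n - s) : Supp C n A s a := by
  have e5 : C / n * A = C * A / n := by ring
  refine ⟨⟨?_, ?_⟩, ?_, ?_⟩
  · rw [le_div_iff₀ hA]; linarith
  · rw [div_le_iff₀ hA]; linarith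
  · gcongr
  · rw [div_le_iff₀ hn, sub_mul, div_mul_cancel₀ _ hn.ne']; linarith

theorem le_of_min_eq {k x y : ℕ} {t : ℝ} (h : min x k = min y k) (ht : t ≤ k) (hx : t ≤ x) :
    t ≤ y := by
  by_cases hk : k ≤ y
  · exact ht.trans (by exact_mod_cast hk)
  · have : x = y := by omega
    rwa [← this]

/-- Support means that the point counts inside and outside reach `C` and the one counts reach `C A /
n`. No threshold exceeds `k`, so the capped counts decide. -/
theorem supp_of_caps_eq {C : ℝ} {k n A : ℕ} {e e' : Entry} (hC : 0 < C) (hn : 0 < n) (hk : C ≤ k)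
    (hAn : A ≤ n) (hcaps : caps k e = caps k e') (h02 : e 0 + e 2 = n) (h13 : e 1 + e 3 = A)
    (h02' : e' 0 + e' 2 = n) (h13' : e' 1 + e' 3 = A) (h : Supp C n A (e 0) (e 1)) :
    Supp C n A (e' 0) (e' 1) := by
  have hn0 : (0 : ℝ) < n := by exact_mod_cast hn
  obtain ⟨hA0, h1, h2, h3, h4⟩ := supp_bounds hC hn0 (Nat.cast_nonneg A) h
  have hm : ∀ i : Fin 4, min (e (i.castLE (by omega))) k = min (e' (i.castLE (by omega))) k :=
    fun i => congrArg Fin.val (congrFun hcaps i)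
  have hθ : C * A / n ≤ k := by
    refine le_trans ?_ hk
    rw [div_le_iff₀ hn0]
    have : (A : ℝ) ≤ n := by exact_mod_cast hAn
    nlinarith
  have c1 : (e 0 : ℝ) + e 2 = n := by exact_mod_cast h02
  have c2 : (e 1 : ℝ) + e 3 = A := by exact_mod_cast h13
  have c3 : (e' 0 : ℝ) + e' 2 = n := by exact_mod_cast h02'
  have c4 : (e' 1 : ℝ) + e' 3 = A := by exact_mod_cast h13'
  have m0 := le_of_min_eq (hm 0) hk h3
  have m1 := le_of_min_eq (hm 1) hθ h1
  have m2 := le_of_min_eq (hm 2) hk (by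
    show C ≤ ((e 2 : ℕ) : ℝ); linarith)
  have m3 := le_of_min_eq (hm 3) hθ (by
    show C * A / n ≤ ((e 3 : ℕ) : ℝ); linarith)
  have m2' : C ≤ ((e' 2 : ℕ) : ℝ) := m2
  have m3' : C * A / n ≤ ((e' 3 : ℕ) : ℝ) := m3
  exact supp_of_bounds hn0 hA0 m1 (by linarith) m0 (by linarith)

theorem feasible_of_supp {C n A s a : ℝ} (hC : 0 < C) (hn : 0 < n) (hA : 0 ≤ A)
    (h : Supp C n A s a) (h1 : a ≤ s) (h2 : A - a ≤ n - s) : Feasible n A s a := by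
  obtain ⟨hA0, g1, g2, g3, g4⟩ := supp_bounds hC hn hA h
  have : 0 < C * A / n := by positivity
  exact ⟨by linarith, by linarith, by linarith, by linarith, h1, h2⟩

variable (D) in
theorem ones_le_card (hb : ∀ i, D.b i ≤ 1) (S : Finset ℕ) : D.ones S ≤ S.card := by
  rw [Inst.ones, Finset.card_eq_sum_ones]
  exact Finset.sum_le_sum fun i _ => hb i

variable (D) in
theorem compl_le (hb : ∀ i, D.b i ≤ 1) {S : Finset ℕ} (hS : S ⊆ Finset.range D.n) :
    D.A + S.card ≤ D.n + D.ones S := by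
  have h1 := Finset.sum_sdiff (f := D.b) hS
  have h2 := Finset.card_sdiff_add_card_eq_card hS
  have h3 := ones_le_card D hb (Finset.range D.n \ S)
  rw [Finset.card_range] at h2
  unfold Inst.A Inst.ones at *
  omega

variable (D) in
theorem feasible_region {C : ℝ} (hC : 0 < C) (hn : 0 < D.n) (hb : ∀ i, D.b i ≤ 1) {S : Finset ℕ}
    (hS : S ⊆ Finset.range D.n) (h : Supp C D.n D.A S.card (D.ones S)) :
    Feasible D.n D.A S.card (D.ones S) := by
  have h1 : (D.ones S : ℝ) ≤ S.card := by exact_mod_cast ones_le_card D hb S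
  have h2 : (D.A : ℝ) + S.card ≤ D.n + D.ones S := by exact_mod_cast compl_le D hb hS
  exact feasible_of_supp hC (by exact_mod_cast hn) (Nat.cast_nonneg _) h h1 (by linarith)

/-- The numbers describe a supported region and its discrepancy. -/
def Valid (D : Inst) (C c : ℝ) (x₀ x₁ x₂ x₃ d τ : ℝ) : Prop :=
  Supp C D.n D.A (D.region x₀ x₁ x₂ x₃ τ).card (D.ones (D.region x₀ x₁ x₂ x₃ τ)) ∧
    d = disc c D.n D.A (D.region x₀ x₁ x₂ x₃ τ).card (D.ones (D.region x₀ x₁ x₂ x₃ τ))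

open Classical in
/-- Indicator of the points in a slab. -/
noncomputable def slab (D : Inst) (x₀ x₂ τ : ℝ) (i : ℕ) : ℕ :=
  if D.X i ∈ Set.Icc x₀ x₂ ∧ τ ≤ D.T i then 1 else 0

theorem slab_le (x₀ x₂ τ : ℝ) (i : ℕ) : slab D x₀ x₂ τ i ≤ 1 := by
  unfold slab; split_ifs <;> simp

theorem card_region {lab : ℕ → Fin 3} {x₀ x₁ x₂ x₃ τ : ℝ}
    (h : ∀ i < D.n, lab (m + D.rank i) = 1 ↔ x₁ ≤ D.Y i ∧ D.Y i ≤ x₃) :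
    (∑ i ∈ Finset.range D.n, if lab (m + D.rank i) = 1 then slab D x₀ x₂ τ i else 0) =
        (D.region x₀ x₁ x₂ x₃ τ).card ∧
    (∑ i ∈ Finset.range D.n, if lab (m + D.rank i) = 1 then slab D x₀ x₂ τ i * D.b i else 0) =
        D.ones (D.region x₀ x₁ x₂ x₃ τ) := by
  constructor
  · rw [Inst.region, Finset.card_filter]
    refine Finset.sum_congr rfl fun i hi => ?_
    simp only [h i (Finset.mem_range.1 hi), slab, ← ite_and, Set.mem_Icc]
    refine if_congr ?_ rfl rfl
    tauto
  · rw [Inst.ones, Inst.region, Finset.sum_filter]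
    refine Finset.sum_congr rfl fun i hi => ?_
    simp only [h i (Finset.mem_range.1 hi), slab, ite_mul, one_mul, zero_mul, ← ite_and,
      Set.mem_Icc]
    refine if_congr ?_ rfl rfl
    tauto

/-- An optimal labelling is not stored; components `4` and `5` suffice to recover a rectangle with
the same points. -/
theorem root_counts {k : ℕ} {C x₀ x₂ τ : ℝ} (hC : 0 < C) (hn : 0 < D.n) {T : Key k → Option Entry}
    {w : ℝ × ℝ} (h : LeavesOK D m (slab D x₀ x₂ τ) s) (hm : D.n ≤ m) {oy : ℕ → ℕ}
    (hoy : IsOrder D.n D.Y oy) (hT : Good k w (leafVec s) T m (2 * m)) {κ : Key k} {e : Entry}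
    (he : T κ = some e) (hs : Supp C D.n D.A (e 0) (e 1)) :
    let S := D.region x₀ (D.Y (oy (e 4))) x₂ (D.Y (oy (e 4 + e 5 - 1))) τ
    e 0 = S.card ∧ e 1 = D.ones S := by
  obtain ⟨lab, hlab, -, rfl⟩ := hT.1 κ e he
  obtain ⟨t0, t1, -, -, t4, t5⟩ := total_leafVec h hm (slab_le _ _ _) lab
  set e := total (leafVec s) lab m (2 * m)
  -- A supported entry has at least `C > 0` points inside, so the position `e 4 + e 5 - 1` of the
  -- topmost inner point is meaningful.
  have hpos : 0 < e 5 := by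
    obtain ⟨-, -, -, h3, -⟩ := supp_bounds hC (by exact_mod_cast hn) (Nat.cast_nonneg _) hs
    have h3' : (0 : ℝ) < e 0 := hC.trans_le h3
    have h3'' : 0 < e 0 := by exact_mod_cast h3'
    refine lt_of_lt_of_le h3'' ?_
    rw [t0, t5, Finset.card_filter]
    refine Finset.sum_le_sum fun i _ => ?_
    split_ifs
    · exact slab_le _ _ _ _
    · exact le_rfl
  obtain ⟨r1, r2⟩ := card_region (m := m) (x₀ := x₀) (x₂ := x₂) (τ := τ)
    fun i hi => label_eq_one_iff hm hoy hlab t4 t5 hpos hi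
  exact ⟨t0.trans r1, t1.trans r2⟩

/-- The labelling by the given range competes in the table under its own key. The winner has the
same capped counts, so it is supported too, and being realized by a rectangle it has feasible
counts. -/
theorem root_covers {k : ℕ} {C x₀ x₁ x₂ x₃ τ : ℝ} (hC : 0 < C) (hk : C ≤ k) (hn : 0 < D.n)
    (hb : ∀ i, D.b i ≤ 1) {T : Key k → Option Entry} {w : ℝ × ℝ}
    (h : LeavesOK D m (slab D x₀ x₂ τ) s) (hm : D.n ≤ m) {oy : ℕ → ℕ} (hoy : IsOrder D.n D.Y oy)
    (hT : Good k w (leafVec s) T m (2 * m))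
    (hs : Supp C D.n D.A (D.region x₀ x₁ x₂ x₃ τ).card (D.ones (D.region x₀ x₁ x₂ x₃ τ))) :
    ∃ κ e, T κ = some e ∧ Supp C D.n D.A (e 0) (e 1) ∧ Feasible D.n D.A (e 0) (e 1) ∧
      w.1 * D.ones (D.region x₀ x₁ x₂ x₃ τ) + w.2 * (D.region x₀ x₁ x₂ x₃ τ).card ≤
        w.1 * e 1 + w.2 * e 0 := by
  set lab := rangeLabel D m x₁ x₃
  obtain ⟨e, he, hv⟩ := hT.2 lab ((rangeLabel_mono x₁ x₃).monotoneOn _)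
  obtain ⟨t0, t1, t2, t3, -, -⟩ := total_leafVec h hm (slab_le _ _ _) lab
  obtain ⟨r1, r2⟩ := card_region (m := m) (x₀ := x₀) (x₂ := x₂) (τ := τ) (lab := lab)
    fun i hi => rangeLabel_eq_one hi
  obtain ⟨lab', hlab', hκ, rfl⟩ := hT.1 _ _ he
  obtain ⟨t0', t1', t2', t3', -, -⟩ := total_leafVec h hm (slab_le _ _ _) lab'
  have hAn : D.A ≤ D.n := by
    have := ones_le_card D hb (Finset.range D.n)
    rwa [Finset.card_range] at this
  have hcaps : caps k (total (leafVec s) lab m (2 * m)) =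
      caps k (total (leafVec s) lab' m (2 * m)) := (congrArg Prod.snd hκ).symm
  set e := total (leafVec s) lab m (2 * m)
  rw [← r1, ← r2, ← t0, ← t1] at hs ⊢
  have hs' := supp_of_caps_eq hC hn hk hAn hcaps t2 t3 t2' t3' hs
  obtain ⟨c0, c1⟩ := root_counts hC hn h hm hoy hT he hs'
  refine ⟨_, _, he, hs', ?_, hv⟩
  rw [c0, c1] at hs' ⊢
  exact feasible_region D hC hn hb (Finset.filter_subset _ _) hs'

end RectScan

namespace RectScan
open RealRAM

/-! ### Sweeping over all slabs -/

/-- The results of the preprocessing. -/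
structure Static (D : Inst) (C c : ℝ) (m : ℕ) (ox oy : ℕ → ℕ) (s : Memory) : Prop where
  n_eq : s.nat 0 0 = D.n
  b_eq : s.nat 1 = D.b
  X_eq : s.real 0 = D.X
  Y_eq : s.real 1 = D.Y
  T_eq : s.real 2 = D.T
  C_eq : s.real 3 1 = C
  c_eq : s.real 3 2 = c
  A_eq : s.nat 2 0 = D.A
  m_eq : s.nat 3 0 = m
  half_eq : ∀ ν < 2 * m, s.nat 4 ν = ν / 2
  leaf_eq : ∀ i < D.n, s.nat 5 i = m + D.rank i
  ox_eq : s.nat 6 = ox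
  oy_eq : s.nat 7 = oy
  count_eq : ∀ l < 2 * m, s.nat 8 l = hist D.n (fun i => m + D.rank i) (fun _ => 1) l
  ones_eq : ∀ l < 2 * m, s.nat 9 l = hist D.n (fun i => m + D.rank i) D.b l

theorem Static.congr {D : Inst} {C c : ℝ} {m : ℕ} {ox oy : ℕ → ℕ} {s s' : Memory}
    (h : Static D C c m ox oy s) (hs : ∀ a < 16, s'.nat a = s.nat a ∧ s'.real a = s.real a) :
    Static D C c m ox oy s' := by
  constructor
  · rw [(hs 0 (by norm_num)).1, h.n_eq]
  · rw [(hs 1 (by norm_num)).1, h.b_eq]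
  · rw [(hs 0 (by norm_num)).2, h.X_eq]
  · rw [(hs 1 (by norm_num)).2, h.Y_eq]
  · rw [(hs 2 (by norm_num)).2, h.T_eq]
  · rw [(hs 3 (by norm_num)).2, h.C_eq]
  · rw [(hs 3 (by norm_num)).2, h.c_eq]
  · rw [(hs 2 (by norm_num)).1, h.A_eq]
  · rw [(hs 3 (by norm_num)).1, h.m_eq]
  · rw [(hs 4 (by norm_num)).1]; exact h.half_eq
  · rw [(hs 5 (by norm_num)).1]; exact h.leaf_eq
  · rw [(hs 6 (by norm_num)).1, h.ox_eq]
  · rw [(hs 7 (by norm_num)).1, h.oy_eq]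
  · rw [(hs 8 (by norm_num)).1]; exact h.count_eq
  · rw [(hs 9 (by norm_num)).1]; exact h.ones_eq

theorem Static.of_agreeOff {D : Inst} {C c : ℝ} {m : ℕ} {ox oy : ℕ → ℕ} {s s' : Memory}
    {S : Set ℕ} (h : Static D C c m ox oy s) (hs : AgreeOff S s s') (hS : S ⊆ Set.Ici 16) :
    Static D C c m ox oy s' :=
  h.congr fun a ha => hs a fun h' => by have := Set.mem_Ici.1 (hS h'); omega

/-- A recorded region is at least as good as `S` with respect to the weights `w`. -/
def Covers (D : Inst) (c : ℝ) (w : ℝ × ℝ) (S : Finset ℕ) (s : Memory) : Prop :=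
  ∃ s' a' : ℕ, Feasible D.n D.A s' a' ∧
    w.1 * D.ones S + w.2 * S.card ≤ w.1 * a' + w.2 * s' ∧ Beats (disc c D.n D.A s' a') s

/-- All supported regions with the given time window and first coordinates are covered. -/
def CoversSlab (D : Inst) (C c : ℝ) (w : ℝ × ℝ) (x₀ x₂ τ : ℝ) (s : Memory) : Prop :=
  ∀ x₁ x₃, Supp C D.n D.A (D.region x₀ x₁ x₂ x₃ τ).card (D.ones (D.region x₀ x₁ x₂ x₃ τ)) →
    Covers D c w (D.region x₀ x₁ x₂ x₃ τ) s

/-- Everything that has been recorded in `s` remains so in `s'`. -/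
def Keeps (s s' : Memory) : Prop := ∀ d, Beats d s → Beats d s'

theorem Keeps.trans {s s' s'' : Memory} (h : Keeps s s') (h' : Keeps s' s'') : Keeps s s'' :=
  fun d hd => h' d (h d hd)

theorem Keeps.of_eq {s s' : Memory} (h : s'.nat 30 = s.nat 30) (h' : s'.real 30 = s.real 30) :
    Keeps s s' := fun d hd => by rwa [Beats, h, h']

theorem CoversSlab.keeps {D : Inst} {C c : ℝ} {w : ℝ × ℝ} {x₀ x₂ τ : ℝ} {s s' : Memory}
    (h : CoversSlab D C c w x₀ x₂ τ s) (hs : Keeps s s') : CoversSlab D C c w x₀ x₂ τ s' :=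
  fun x₁ x₃ hS => by
    obtain ⟨p, q, h1, h2, h3⟩ := h x₁ x₃ hS
    exact ⟨p, q, h1, h2, hs _ h3⟩

theorem BestOK.of_eq {V : ℝ → ℝ → ℝ → ℝ → ℝ → ℝ → Prop} {s s' : Memory} (hb : BestOK V s)
    (h : s'.nat 30 = s.nat 30) (h' : s'.real 30 = s.real 30) : BestOK V s' := by
  rw [BestOK, h, h']; exact hb

/-- The current point lies in the time window and to the right of the left boundary. -/
abbrev passCond : Cond :=
  .and (.not (.realLt (.get 0 curPoint) (.get 0 (nvar 21))))
    (.not (.realLt (.get 2 curPoint) (.get 2 (nvar 20))))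

/-- The next point has a greater first coordinate. -/
abbrev lastCond : Cond :=
  .not (.and (.natLt (.add (nvar 22) (.lit 1)) (nvar 0))
    (.not (.realLt (.get 0 curPoint) (.get 0 (.get 6 (.add (nvar 22) (.lit 1)))))))

/-- Advance the right boundary of the slab. -/
noncomputable def advance (k : ℕ) : Prog :=
  .seq (.ite passCond (insertPoint k) .skip) (.ite lastCond (query k) .skip)

/-- Bound for the steps of `advance` with `2 ^ h` leaves. -/
noncomputable def advanceCost (k h : ℕ) : ℕ := (h + 1) * nodeCost k + (query k).bound + 80

open Classical in
/-- Indicator of the points that enter the sweep. -/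
noncomputable def passes (D : Inst) (x₀ τ : ℝ) (i : ℕ) : ℕ :=
  if x₀ ≤ D.X i ∧ τ ≤ D.T i then 1 else 0

/-- The leaves hold the first `v` points. -/
structure Swept (D : Inst) (k m : ℕ) (ox : ℕ → ℕ) (x₀ τ : ℝ) (v : ℕ) (s : Memory) : Prop where
  tree : TreeOK k s m
  count : ∀ l < 2 * m, s.nat 40 l = ∑ v' ∈ Finset.range v,
    if m + D.rank (ox v') = l then passes D x₀ τ (ox v') else 0
  ones : ∀ l < 2 * m, s.nat 41 l = ∑ v' ∈ Finset.range v,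
    if m + D.rank (ox v') = l then passes D x₀ τ (ox v') * D.b (ox v') else 0

/-- When the next point lies strictly further right, the active points among the first `v + 1` are
exactly those of the slab. Within a group of equal first coordinates some would be missing. -/
theorem sum_prefix {D : Inst} {ox : ℕ → ℕ} (hox : IsOrder D.n D.X ox) {v : ℕ} (hv : v < D.n)
    (hlast : v + 1 < D.n → D.X (ox v) < D.X (ox (v + 1))) (x₀ τ : ℝ) (P : ℕ → Prop)
    [DecidablePred P] (g : ℕ → ℕ) :
    (∑ v' ∈ Finset.range (v + 1), if P (ox v') then passes D x₀ τ (ox v') * g (ox v') else 0) =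
      ∑ i ∈ Finset.range D.n, if P i then slab D x₀ (D.X (ox v)) τ i * g i else 0 := by
  rw [← hox.sum fun i => if P i then slab D x₀ (D.X (ox v)) τ i * g i else 0]
  have h1 : ∀ v' ∈ Finset.range (v + 1),
      (if P (ox v') then passes D x₀ τ (ox v') * g (ox v') else 0) =
        if P (ox v') then slab D x₀ (D.X (ox v)) τ (ox v') * g (ox v') else 0 := fun v' hv' => by
    rw [Finset.mem_range] at hv'
    have := hox.mono v' v (by omega) hv
    simp [passes, slab, this]
  rw [Finset.sum_congr rfl h1]
  refine Finset.sum_subset (Finset.range_subset_range.2 hv) fun v' hv' hv'' => ?_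
  rw [Finset.mem_range] at hv' hv''
  have h2 := hox.mono (v + 1) v' (by omega) hv'
  have h3 := hlast (by omega)
  have : slab D x₀ (D.X (ox v)) τ (ox v') = 0 := by
    rw [slab, if_neg]
    rintro ⟨⟨-, h⟩, -⟩
    linarith
  simp [this]

theorem root_good {k h : ℕ} {s : Memory} (ht : TreeOK k s (2 ^ h)) :
    Good k (weights s) (leafVec s) (tab k s 1) (2 ^ h) (2 * 2 ^ h) := by
  simpa [one_mul] using ht 1 le_rfl h (by simp) (by simp)

theorem advance_writesIn (k : ℕ) : (advance k).WritesIn (Set.Ici 23) :=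
  ⟨⟨(insertPoint_writesIn k).mono (Set.Ici_subset_Ici.2 (by norm_num)), trivial⟩,
    (query_writesIn k).mono (by intro a ha; rw [ha]; simp), trivial⟩

variable {D : Inst} {C c : ℝ} {k h : ℕ} {ox oy : ℕ → ℕ}

/-- Points left of the slab or before the window are skipped. Coverage is claimed only at the end of
a group of equal first coordinates, where the leaves describe a genuine slab. -/
theorem advance_wp (hC : 0 < C) (hk : C ≤ k) (hb : ∀ i, D.b i ≤ 1) (hm : D.n ≤ 2 ^ h)
    (hox : IsOrder D.n D.X ox) (hoy : IsOrder D.n D.Y oy) {s : Memory}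
    (hs : Static D C c (2 ^ h) ox oy s) {x₀ τ : ℝ} {v : ℕ} (hx : D.X (s.nat 21 0) = x₀)
    (hτ : D.T (s.nat 20 0) = τ) (hv : s.nat 22 0 = v) (hvn : v < D.n)
    (hsw : Swept D k (2 ^ h) ox x₀ τ v s) (hbest : BestOK (Valid D C c) s) :
    wp (advance k) (fun s' => Swept D k (2 ^ h) ox x₀ τ (v + 1) s' ∧ BestOK (Valid D C c) s' ∧
      Keeps s s' ∧ ((v + 1 < D.n → D.X (ox v) < D.X (ox (v + 1))) →
        CoversSlab D C c (weights s) x₀ (D.X (ox v)) τ s')) s (advanceCost k h) := by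
  have hp : s.nat 6 (s.nat 22 0) = ox v := by rw [hs.ox_eq, hv]
  have hpn : ox v < D.n := hox.lt hvn
  have hleaf := leaf_mem hm hpn
  rw [Finset.mem_Ico] at hleaf
  have hins : wp (.ite passCond (insertPoint k) .skip)
      (fun s' => (Swept D k (2 ^ h) ox x₀ τ (v + 1) s' ∧ s'.nat 30 = s.nat 30 ∧
        s'.real 30 = s.real 30) ∧ AgreeOff (Set.Ici 40) s s') s
      (passCond.cost + 1 + ((h + 1) * nodeCost k + 31)) := by
    refine wp.frame (wp_ite (fun hpass => ?_) fun hpass => ?_)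
      ⟨insertPoint_writesIn k, trivial⟩
    · simp only [Cond.Holds, RealExpr.eval, NatExpr.eval, hp, hs.X_eq, hs.T_eq, hx, hτ, not_lt] at hpass
      have hps : passes D x₀ τ (ox v) = 1 := if_pos hpass
      refine ((insertPoint_wp k hp (hs.leaf_eq _ hpn) hleaf.1 hleaf.2 hs.half_eq hsw.tree).mono ?_ ?_)
      · rintro s' ⟨h1, h2, h3, h4, h5⟩
        refine ⟨⟨h1, fun l hl => ?_, fun l hl => ?_⟩, h4, h5⟩
        · rw [h2, hsw.count l hl, Finset.sum_range_succ, hps]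
          simp only [eq_comm]
        · rw [h3, hsw.ones l hl, Finset.sum_range_succ, hps, hs.b_eq, one_mul]
          simp only [eq_comm]
      · have h1 : Nat.log 2 (2 ^ h + D.rank (ox v)) ≤ h := by
          have : Nat.log 2 (2 ^ h + D.rank (ox v)) < h + 1 :=
            Nat.log_lt_of_lt_pow (by omega) (by rw [pow_succ]; omega)
          omega
        have := Nat.mul_le_mul_right (nodeCost k) (Nat.add_le_add_right h1 1)
        omega
    · simp only [Cond.Holds, RealExpr.eval, NatExpr.eval, hp, hs.X_eq, hs.T_eq, hx, hτ, not_lt] at hpass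
      have hps : passes D x₀ τ (ox v) = 0 := if_neg hpass
      refine (wp_skip ⟨⟨hsw.tree, fun l hl => ?_, fun l hl => ?_⟩, rfl, rfl⟩).mono
        (fun _ h => h) (by omega)
      · rw [hsw.count l hl, Finset.sum_range_succ, hps]; simp
      · rw [hsw.ones l hl, Finset.sum_range_succ, hps]; simp
  refine (wp_seq hins (B₂ := lastCond.cost + 1 + ((query k).bound + 1)) ?_).mono (fun _ h => h)
    (by simp only [advanceCost, Cond.cost, RealExpr.cost, NatExpr.cost]; omega)
  rintro s₁ ⟨⟨h1, h2, h3⟩, h4⟩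
  have hs₁ := hs.of_agreeOff h4 (Set.Ici_subset_Ici.2 (by norm_num))
  have e20 : s₁.nat 20 = s.nat 20 := (h4 20 (by simp)).1
  have e21 : s₁.nat 21 = s.nat 21 := (h4 21 (by simp)).1
  have e22 : s₁.nat 22 = s.nat 22 := (h4 22 (by simp)).1
  have ew : weights s₁ = weights s := by simp [weights, (h4 18 (by simp)).2]
  have hlast : lastCond.Holds s₁ ↔ (v + 1 < D.n → D.X (ox v) < D.X (ox (v + 1))) := by
    simp only [Cond.Holds, RealExpr.eval, NatExpr.eval, e22, hv, hs₁.n_eq, hs₁.X_eq, hs₁.ox_eq]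
    tauto
  refine wp_ite (fun hl => ?_) fun hl => ?_
  · rw [hlast] at hl
    have hlv : LeavesOK D (2 ^ h) (slab D x₀ (D.X (ox v)) τ) s₁ := by
      refine ⟨hs₁.count_eq, hs₁.ones_eq, fun l hl' => ?_, fun l hl' => ?_⟩
      · rw [h1.count l hl']
        have := sum_prefix hox hvn hl x₀ τ (fun i => 2 ^ h + D.rank i = l) (fun _ => 1)
        simp only [mul_one] at this
        exact this
      · rw [h1.ones l hl']
        exact sum_prefix hox hvn hl x₀ τ (fun i => 2 ^ h + D.rank i = l) D.b
    have hT := root_good h1.tree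
    have hn0 : 0 < D.n := by omega
    obtain ⟨q1, q2, q3⟩ := query_spec (k := k) (V := Valid D C c) s₁ hs₁.C_eq hs₁.c_eq hs₁.n_eq hs₁.A_eq
      (fun κ e he hsupp => by
        rw [hs₁.X_eq, hs₁.Y_eq, hs₁.T_eq, hs₁.ox_eq, hs₁.oy_eq, e20, e21, e22, hx, hτ, hv]
        obtain ⟨c0, c1⟩ := root_counts hC hn0 hlv hm hoy hT he hsupp
        rw [Valid, ← c0, ← c1]
        exact ⟨hsupp, rfl⟩) (hbest.of_eq h2 h3)
    have hq := (query_loopFree k).agreeOff (query_writesIn k) s₁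
    refine ((query_loopFree k).wp ⟨⟨?_, ?_, ?_⟩, q1, (Keeps.of_eq h2 h3).trans q2, ?_⟩).mono
      (fun _ h => h) (by omega)
    · have a1 : ∀ a, a ≠ 30 → ((query k).exec s₁).nat a = s₁.nat a := fun a ha =>
        (hq a (by simpa using ha)).1
      have a2 : tab k ((query k).exec s₁) = tab k s₁ := by
        funext ν κ
        have : ∀ i, ((query k).exec s₁).nat (nm κ i) = s₁.nat (nm κ i) := fun i =>
          a1 _ (ne_nm κ i (by norm_num)).symm
        simp only [tab, this]
      have a3 : leafVec ((query k).exec s₁) = leafVec s₁ := by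
        funext l f
        simp [leafVec, a1]
      have a4 : weights ((query k).exec s₁) = weights s₁ := by
        simp [weights, (hq 18 (by simp)).2]
      intro ν hν
      rw [a2, a3, a4]
      exact h1.tree ν hν
    · rw [(hq 40 (by simp)).1]; exact h1.count
    · rw [(hq 41 (by simp)).1]; exact h1.ones
    · intro _ x₁ x₃ hsupp
      obtain ⟨κ, e, he, g1, g2, g3⟩ := root_covers hC hk hn0 hb hlv hm hoy hT hsupp
      exact ⟨e 0, e 1, g2, by rw [← ew]; exact g3, q3 κ e he g1⟩
  · refine (wp_skip ⟨h1, hbest.of_eq h2 h3, Keeps.of_eq h2 h3, fun h' => ?_⟩).mono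
      (fun _ h => h) (by omega)
    exact absurd (hlast.2 h') hl

end RectScan

namespace RectScan
open RealRAM

variable {D : Inst} {C c : ℝ} {k h : ℕ} {ox oy : ℕ → ℕ}

/-! ### Loops over right sides, left sides and time windows -/

theorem Swept.writeNat {m : ℕ} {x₀ τ : ℝ} {v : ℕ} {s : Memory} (hs : Swept D k m ox x₀ τ v s)
    {a i x : ℕ} (ha : 9 < a) (ha' : a < 40) : Swept D k m ox x₀ τ v (s.writeNat a i x) := by
  have hl : leafVec (s.writeNat a i x) = leafVec s := by
    funext l f
    simp only [leafVec, Memory.writeNat_nat_of_ne s (show 40 ≠ a by omega),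
      Memory.writeNat_nat_of_ne s (show 41 ≠ a by omega),
      Memory.writeNat_nat_of_ne s (show 8 ≠ a by omega),
      Memory.writeNat_nat_of_ne s (show 9 ≠ a by omega)]
  refine ⟨fun ν hν => ?_, ?_, ?_⟩
  · rw [hl, tab_writeNat _ (by omega)]
    exact hs.tree ν hν
  · rw [Memory.writeNat_nat_of_ne _ (by omega)]; exact hs.count
  · rw [Memory.writeNat_nat_of_ne _ (by omega)]; exact hs.ones

/-- Deactivate all points. -/
def zeroLeaves : Prog :=
  forLoop 39 (.add (nvar 3) (nvar 3))
    (.seq (.setNat 40 (nvar 39) (.lit 0)) (.setNat 41 (nvar 39) (.lit 0)))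

theorem zeroLeaves_wp {s : Memory} {m : ℕ} (hm : s.nat 3 0 = m) :
    wp zeroLeaves (fun s' => (∀ l < 2 * m, s'.nat 40 l = 0 ∧ s'.nat 41 l = 0) ∧
      AgreeOff {39, 40, 41} s s') s (46 * m + 13) := by
  have hw : Prog.WritesIn {40, 41}
      (.seq (.setNat 40 (nvar 39) (.lit 0)) (.setNat 41 (nvar 39) (.lit 0))) :=
    ⟨Or.inl rfl, Or.inr rfl⟩
  refine (wp_forLoop (S := {40, 41}) (m + m)
    (fun j s' => ∀ l < j, s'.nat 40 l = 0 ∧ s'.nat 41 l = 0) (by simp) (B := 8) ?_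
    hw (by simp) ?_).mono ?_ ?_
  · intro s' hs'
    simp only [NatExpr.eval, (hs' 3 (by simp)).1, hm]
  · intro j _ s' _ hj hinv
    refine wp_setNat_seq (wp_setNat ?_)
    intro l hl
    simp only [NatExpr.eval, hj, Memory.writeNat_nat]
    have : (39 : ℕ) ≠ 40 := by norm_num
    simp only [this, false_and, if_false]
    by_cases hlj : l = j
    · simp [hlj]
    · have := hinv l (by omega)
      simp [hlj, this]
  · rintro s' ⟨h1, h2⟩
    exact ⟨fun l hl => h1 l (by omega), h2⟩
  · simp only [NatExpr.cost]; omega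

/-- Sweep over all slabs with the given left boundary. -/
noncomputable def slabs (k : ℕ) : Prog :=
  .seq zeroLeaves (.seq (build k) (forLoop 22 (nvar 0) (advance k)))

/-- Bound for the steps of `slabs`. -/
noncomputable def slabsCost (k h n : ℕ) : ℕ :=
  46 * 2 ^ h + 13 + ((2 * 2 ^ h + 1) * nodeCost k + (n * (advanceCost k h + 12) + 10))

theorem slabs_writesIn (k : ℕ) : (slabs k).WritesIn (Set.Ici 22) := by
  refine ⟨forLoop_writesIn (by simp) ⟨Set.mem_Ici.2 (by norm_num), Set.mem_Ici.2 (by norm_num)⟩,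
    ?_, ?_⟩
  · exact (build_writesIn k).mono (Set.Ici_subset_Ici.2 (by norm_num))
  · exact forLoop_writesIn (by simp)
      ((advance_writesIn k).mono (Set.Ici_subset_Ici.2 (by norm_num)))

theorem insert_Ici (i : ℕ) : insert i (Set.Ici (i + 1)) = Set.Ici i := by
  ext a; simp only [Set.mem_insert_iff, Set.mem_Ici]; omega

/-- For each left side the tree is rebuilt in linear time with no active points, after which each
point is inserted at most once. -/
theorem slabs_wp (hC : 0 < C) (hk : C ≤ k) (hb : ∀ i, D.b i ≤ 1) (hm : D.n ≤ 2 ^ h)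
    (hox : IsOrder D.n D.X ox) (hoy : IsOrder D.n D.Y oy) {s : Memory}
    (hs : Static D C c (2 ^ h) ox oy s) {x₀ τ : ℝ} (hx : D.X (s.nat 21 0) = x₀)
    (hτ : D.T (s.nat 20 0) = τ) (hbest : BestOK (Valid D C c) s) :
    wp (slabs k) (fun s' => BestOK (Valid D C c) s' ∧ Keeps s s' ∧
      ∀ v < D.n, (v + 1 < D.n → D.X (ox v) < D.X (ox (v + 1))) →
        CoversSlab D C c (weights s) x₀ (D.X (ox v)) τ s') s (slabsCost k h D.n) := by
  refine wp_seq (zeroLeaves_wp hs.m_eq) ?_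
  rintro s₁ ⟨hz, ha₁⟩
  have hs₁ : Static D C c (2 ^ h) ox oy s₁ := hs.of_agreeOff ha₁ (by
    intro a ha; simp only [Set.mem_insert_iff, Set.mem_singleton_iff] at ha
    simp only [Set.mem_Ici]; omega)
  refine wp_seq ((build_wp k hs₁.m_eq).frame (build_writesIn k)) ?_
  rintro s₂ ⟨ht, ha₂⟩
  have hs₂ : Static D C c (2 ^ h) ox oy s₂ :=
    hs₁.of_agreeOff ha₂ (Set.Ici_subset_Ici.2 (by norm_num))
  have e20 : s₂.nat 20 = s.nat 20 := (ha₂ 20 (by simp)).1.trans (ha₁ 20 (by simp)).1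
  have e21 : s₂.nat 21 = s.nat 21 := (ha₂ 21 (by simp)).1.trans (ha₁ 21 (by simp)).1
  have e30 : s₂.nat 30 = s.nat 30 := (ha₂ 30 (by simp)).1.trans (ha₁ 30 (by simp)).1
  have e30' : s₂.real 30 = s.real 30 := (ha₂ 30 (by simp)).2.trans (ha₁ 30 (by simp)).2
  have ew : weights s₂ = weights s := by
    simp [weights, (ha₂ 18 (by simp)).2, (ha₁ 18 (by simp)).2]
  refine (wp_forLoop (S := Set.Ici 23) D.n (fun v s' =>
    Swept D k (2 ^ h) ox x₀ τ v s' ∧ BestOK (Valid D C c) s' ∧ Keeps s s' ∧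
      ∀ v' < v, (v' + 1 < D.n → D.X (ox v') < D.X (ox (v' + 1))) →
        CoversSlab D C c (weights s) x₀ (D.X (ox v')) τ s') (by simp) (B := advanceCost k h) ?_
    (advance_writesIn k) ?_ ?_).mono ?_ ?_
  · intro s' hs'
    rw [insert_Ici] at hs'
    exact (hs₂.of_agreeOff hs' (Set.Ici_subset_Ici.2 (by norm_num))).n_eq
  · have : Swept D k (2 ^ h) ox x₀ τ 0 s₂ := by
      refine ⟨ht, fun l hl => ?_, fun l hl => ?_⟩
      · rw [(ha₂ 40 (by simp)).1, (hz l hl).1]; simp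
      · rw [(ha₂ 41 (by simp)).1, (hz l hl).2]; simp
    exact ⟨this.writeNat (by norm_num) (by norm_num), hbest.of_eq e30 e30', Keeps.of_eq e30 e30',
      by simp⟩
  · rintro v hv s' hs' hv' ⟨h1, h2, h3, h4⟩
    rw [insert_Ici] at hs'
    have hs'' := hs₂.of_agreeOff hs' (Set.Ici_subset_Ici.2 (by norm_num))
    have ew' : weights s' = weights s := by rw [← ew]; simp [weights, (hs' 18 (by simp)).2]
    refine (advance_wp hC hk hb hm hox hoy hs'' (x₀ := x₀) (τ := τ)
      (by rw [(hs' 21 (by simp)).1, e21, hx]) (by rw [(hs' 20 (by simp)).1, e20, hτ]) hv' hv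
      h1 h2).mono ?_ le_rfl
    rintro s₃ ⟨g1, g2, g3, g4⟩
    have hK : Keeps s₃ (s₃.writeNat 22 0 (v + 1)) := Keeps.of_eq rfl rfl
    refine ⟨g1.writeNat (by norm_num) (by norm_num), g2.of_eq rfl rfl, (h3.trans g3).trans hK,
      fun v' hv' hlast => ?_⟩
    rcases Nat.lt_succ_iff_lt_or_eq.1 hv' with hlt | rfl
    · exact (h4 v' hlt hlast).keeps (g3.trans hK)
    · rw [← ew']; exact (g4 hlast).keeps hK
  · rintro s' ⟨⟨-, h1, h2, h3⟩, -⟩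
    exact ⟨h1, h2, h3⟩
  · simp only [NatExpr.cost, Nat.add_assoc, Nat.reduceAdd]; omega

/-- Sweep over all slabs and all time windows; `W` is the number of time windows. -/
noncomputable def sweep (k : ℕ) (W : NatExpr) : Prog :=
  forLoop 20 W (forLoop 21 (nvar 0) (slabs k))

/-- Bound for the steps of `sweep`. -/
noncomputable def sweepCost (k h n W : ℕ) (cW : ℕ) : ℕ :=
  W * (n * (slabsCost k h n + 12) + 10 + cW + 10) + cW + 8

theorem sweep_writesIn (k : ℕ) (W : NatExpr) : (sweep k W).WritesIn (Set.Ici 20) :=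
  forLoop_writesIn (by simp) (forLoop_writesIn (by simp)
    ((slabs_writesIn k).mono (Set.Ici_subset_Ici.2 (by norm_num))))

theorem sweep_wp (hC : 0 < C) (hk : C ≤ k) (hb : ∀ i, D.b i ≤ 1) (hm : D.n ≤ 2 ^ h)
    (hox : IsOrder D.n D.X ox) (hoy : IsOrder D.n D.Y oy) {W : NatExpr} {W' : ℕ}
    (hW : ∀ s : Memory, s.nat 0 0 = D.n → W.eval s = W') {s : Memory}
    (hs : Static D C c (2 ^ h) ox oy s) (hbest : BestOK (Valid D C c) s) :
    wp (sweep k W) (fun s' => BestOK (Valid D C c) s' ∧ Keeps s s' ∧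
      ∀ w < W', ∀ u < D.n, ∀ v < D.n, (v + 1 < D.n → D.X (ox v) < D.X (ox (v + 1))) →
        CoversSlab D C c (weights s) (D.X u) (D.X (ox v)) (D.T w) s') s
      (sweepCost k h D.n W' W.cost) := by
  have h20 : Set.Ici 20 ⊆ Set.Ici 16 := Set.Ici_subset_Ici.2 (by norm_num)
  have h21 : Set.Ici 21 ⊆ Set.Ici 16 := Set.Ici_subset_Ici.2 (by norm_num)
  refine (wp_forLoop (S := Set.Ici 21) W' (fun w s' =>
    BestOK (Valid D C c) s' ∧ Keeps s s' ∧
      ∀ w' < w, ∀ u < D.n, ∀ v < D.n, (v + 1 < D.n → D.X (ox v) < D.X (ox (v + 1))) →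
        CoversSlab D C c (weights s) (D.X u) (D.X (ox v)) (D.T w') s') (by simp)
    (B := D.n * (slabsCost k h D.n + 12) + 10) ?_
    (forLoop_writesIn (by simp) ((slabs_writesIn k).mono (Set.Ici_subset_Ici.2 (by norm_num))))
    ⟨hbest.of_eq rfl rfl, Keeps.of_eq rfl rfl, by simp⟩ ?_).mono
    (fun s' h => h.1) (by simp only [sweepCost]; omega)
  · intro s' hs'
    rw [insert_Ici] at hs'
    exact hW _ (hs.of_agreeOff hs' h20).n_eq
  rintro w hw s₁ hs₁ hw₁ ⟨b1, b2, b3⟩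
  rw [insert_Ici] at hs₁
  have st₁ := hs.of_agreeOff hs₁ h20
  have ew₁ : weights s₁ = weights s := by simp [weights, (hs₁ 18 (by simp)).2]
  refine (wp_forLoop (S := Set.Ici 22) D.n (fun u s' =>
    BestOK (Valid D C c) s' ∧ Keeps s₁ s' ∧
      ∀ u' < u, ∀ v < D.n, (v + 1 < D.n → D.X (ox v) < D.X (ox (v + 1))) →
        CoversSlab D C c (weights s) (D.X u') (D.X (ox v)) (D.T w) s') (by simp)
    (B := slabsCost k h D.n) ?_ (slabs_writesIn k)
    ⟨b1.of_eq rfl rfl, Keeps.of_eq rfl rfl, by simp⟩ ?_).mono ?_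
    (by simp only [NatExpr.cost, Nat.add_assoc, Nat.reduceAdd]; omega)
  · intro s' hs'
    rw [insert_Ici] at hs'
    exact (st₁.of_agreeOff hs' h21).n_eq
  · rintro u hu s₂ hs₂ hu₂ ⟨d1, d2, d3⟩
    rw [insert_Ici] at hs₂
    have st₂ := st₁.of_agreeOff hs₂ h21
    have ew₂ : weights s₂ = weights s := by rw [← ew₁]; simp [weights, (hs₂ 18 (by simp)).2]
    refine (slabs_wp hC hk hb hm hox hoy st₂ (x₀ := D.X u) (τ := D.T w) (by rw [hu₂])
      (by rw [(hs₂ 20 (by simp)).1, hw₁]) d1).mono ?_ le_rfl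
    rintro s₃ ⟨f1, f2, f3⟩
    have hK : Keeps s₃ (s₃.writeNat 21 0 (u + 1)) := Keeps.of_eq rfl rfl
    refine ⟨f1.of_eq rfl rfl, (d2.trans f2).trans hK, fun u' hu' v hv hlast => ?_⟩
    rcases Nat.lt_succ_iff_lt_or_eq.1 hu' with hlt | rfl
    · exact (d3 u' hlt v hv hlast).keeps (f2.trans hK)
    · rw [← ew₂]; exact (f3 v hv hlast).keeps hK
  · rintro s₃ ⟨⟨f1, f2, f3⟩, -⟩
    have hK : Keeps s₃ (s₃.writeNat 20 0 (w + 1)) := Keeps.of_eq rfl rfl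
    refine ⟨f1.of_eq rfl rfl, (b2.trans f2).trans hK, fun w' hw' u hu v hv hlast => ?_⟩
    rcases Nat.lt_succ_iff_lt_or_eq.1 hw' with hlt | rfl
    · exact (b3 w' hlt u hu v hv hlast).keeps (f2.trans hK)
    · exact (f3 u hu v hv hlast).keeps hK

/-- Every supported region agrees with one whose boundaries have been swept over. -/
theorem covers_region (hC : 0 < C) (hn : 0 < D.n) (hox : IsOrder D.n D.X ox) {W' : ℕ}
    (hT : ∀ τ, (∃ i < D.n, τ ≤ D.T i) → ∃ w < W', ∀ i < D.n, τ ≤ D.T i ↔ D.T w ≤ D.T i)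
    {w : ℝ × ℝ} {s : Memory}
    (h : ∀ w' < W', ∀ u < D.n, ∀ v < D.n, (v + 1 < D.n → D.X (ox v) < D.X (ox (v + 1))) →
        CoversSlab D C c w (D.X u) (D.X (ox v)) (D.T w') s) {x₀ x₁ x₂ x₃ τ : ℝ}
    (hs : Supp C D.n D.A (D.region x₀ x₁ x₂ x₃ τ).card (D.ones (D.region x₀ x₁ x₂ x₃ τ))) :
    Covers D c w (D.region x₀ x₁ x₂ x₃ τ) s := by
  classical
  have hne : (D.region x₀ x₁ x₂ x₃ τ).Nonempty := by
    rw [Finset.nonempty_iff_ne_empty]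
    intro he
    rw [he] at hs
    have hCn := hs.2.1
    have : (0 : ℝ) < D.n := by exact_mod_cast hn
    rw [Finset.card_empty, Nat.cast_zero, zero_div] at hCn
    have : 0 < C / D.n := by positivity
    linarith
  obtain ⟨i₀, hi₀⟩ := hne
  simp only [Inst.region, Finset.mem_filter, Finset.mem_range, Set.mem_Icc] at hi₀
  obtain ⟨hi₀n, ⟨⟨hx0, hx2⟩, -⟩, hτ0⟩ := hi₀
  obtain ⟨w', hw', hwT⟩ := hT τ ⟨i₀, hi₀n, hτ0⟩
  -- Move the left side to the leftmost point that is not left of `x₀`.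
  obtain ⟨u, hu, humin⟩ := Finset.exists_min_image
    ((Finset.range D.n).filter fun i => x₀ ≤ D.X i) D.X ⟨i₀, by simp [hi₀n, hx0]⟩
  simp only [Finset.mem_filter, Finset.mem_range] at hu humin
  have hP : ∀ a b, a ≤ b → b < D.n → D.X (ox b) ≤ x₂ → D.X (ox a) ≤ x₂ := fun a b hab hb hx =>
    (hox.mono a b hab hb).trans hx
  have hiff := fun v hv => iff_lt_card_filter (P := fun v => D.X (ox v) ≤ x₂) hP (v := v) hv
  -- Position `V - 1` is the last one with first coordinate at most `x₂`. It ends its group of equal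
  -- coordinates, so this slab has been queried.
  set V := ((Finset.range D.n).filter fun v => D.X (ox v) ≤ x₂).card
  have hVn : V ≤ D.n := (Finset.card_filter_le _ _).trans (Finset.card_range _).le
  obtain ⟨v₀, hv₀, rfl⟩ := hox.exists_eq hi₀n
  have hV0 := (hiff v₀ hv₀).1 hx2
  have hlast : V - 1 + 1 < D.n → D.X (ox (V - 1)) < D.X (ox (V - 1 + 1)) := fun hlt => by
    have h1 := (hiff (V - 1) (by omega)).2 (by omega)
    have h2 := (not_congr (hiff (V - 1 + 1) hlt)).2 (by omega)
    exact h1.trans_lt (not_le.1 h2)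
  have hreg : D.region x₀ x₁ x₂ x₃ τ =
      D.region (D.X u) x₁ (D.X (ox (V - 1))) x₃ (D.T w') := by
    refine Finset.filter_congr fun i hi => ?_
    rw [Finset.mem_range] at hi
    have e1 : x₀ ≤ D.X i ↔ D.X u ≤ D.X i := ⟨fun h => humin i ⟨hi, h⟩, fun h => hu.2.trans h⟩
    have e2 : D.X i ≤ x₂ ↔ D.X i ≤ D.X (ox (V - 1)) := by
      obtain ⟨v, hv, rfl⟩ := hox.exists_eq hi
      refine ⟨fun h => ?_, fun h => h.trans ((hiff (V - 1) (by omega)).2 (by omega))⟩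
      have := (hiff v hv).1 h
      exact hox.mono _ _ (by omega) (by omega)
    simp only [Set.mem_Icc, e1, e2, hwT i hi]
  rw [hreg] at hs ⊢
  exact h w' hw' u hu.1 (V - 1) (by omega) hlast x₁ x₃ hs

end RectScan

namespace RectScan
open RealRAM

variable {D : Inst} {C c : ℝ} {k h : ℕ} {ox oy : ℕ → ℕ}

/-! ### All directions -/

theorem wp_setReal_seq {a : ℕ} {i : NatExpr} {e : RealExpr} {q : Prog} {Q : Memory → Prop}
    {s : Memory} {B : ℕ} (h : wp q Q (s.writeReal a (i.eval s) (e.eval s)) B) :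
    wp (.seq (.setReal a i e) q) Q s (i.cost + e.cost + 1 + B) :=
  wp_seq (R := fun s' => s' = s.writeReal a (i.eval s) (e.eval s))
    ⟨_, _, .setReal _ _ _ _, le_rfl, rfl⟩ fun _ h' => h' ▸ h

theorem wp_setReal {a : ℕ} {i : NatExpr} {e : RealExpr} {Q : Memory → Prop} {s : Memory}
    (h : Q (s.writeReal a (i.eval s) (e.eval s))) :
    wp (.setReal a i e) Q s (i.cost + e.cost + 1) :=
  ⟨_, _, .setReal _ _ _ _, le_rfl, h⟩

/-- All supported regions are covered with respect to the weights `w`. -/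
def CoversAll (D : Inst) (C c : ℝ) (w : ℝ × ℝ) (s : Memory) : Prop :=
  ∀ x₀ x₁ x₂ x₃ τ,
    Supp C D.n D.A (D.region x₀ x₁ x₂ x₃ τ).card (D.ones (D.region x₀ x₁ x₂ x₃ τ)) →
    Covers D c w (D.region x₀ x₁ x₂ x₃ τ) s

theorem CoversAll.keeps {w : ℝ × ℝ} {s s' : Memory} (h : CoversAll D C c w s) (hs : Keeps s s') :
    CoversAll D C c w s' := fun x₀ x₁ x₂ x₃ τ hS => by
  obtain ⟨p, q, h1, h2, h3⟩ := h x₀ x₁ x₂ x₃ τ hS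
  exact ⟨p, q, h1, h2, hs _ h3⟩

/-- The time windows starting at the time stamps of the first `W` points suffice. -/
def TimesSuffice (D : Inst) (W : ℕ) : Prop :=
  ∀ τ, (∃ i < D.n, τ ≤ D.T i) → ∃ w < W, ∀ i < D.n, τ ≤ D.T i ↔ D.T w ≤ D.T i

/-- What the direction loop needs to know about the instance. -/
structure Params (D : Inst) (C : ℝ) (k h : ℕ) (ox oy : ℕ → ℕ) (W : NatExpr) (W' : ℕ) : Prop where
  C_pos : 0 < C
  n_pos : 0 < D.n
  C_le : C ≤ k
  b_le : ∀ i, D.b i ≤ 1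
  n_le : D.n ≤ 2 ^ h
  ox : IsOrder D.n D.X ox
  oy : IsOrder D.n D.Y oy
  times : TimesSuffice D W'
  W_eq : ∀ s : Memory, s.nat 0 0 = D.n → W.eval s = W'

variable {W : NatExpr} {W' : ℕ}

theorem sweep_covers (hp : Params D C k h ox oy W W') {s : Memory}
    (hs : Static D C c (2 ^ h) ox oy s) (hbest : BestOK (Valid D C c) s) :
    wp (sweep k W) (fun s' => (BestOK (Valid D C c) s' ∧ Keeps s s' ∧
      CoversAll D C c (weights s) s') ∧ AgreeOff (Set.Ici 20) s s') s
      (sweepCost k h D.n W' W.cost) := by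
  refine ((sweep_wp hp.C_pos hp.C_le hp.b_le hp.n_le hp.ox hp.oy hp.W_eq hs hbest).mono ?_
    le_rfl).frame (sweep_writesIn k W)
  rintro s' ⟨h1, h2, h3⟩
  exact ⟨h1, h2, fun x₀ x₁ x₂ x₃ τ hS =>
    covers_region hp.C_pos hp.n_pos hp.ox hp.times h3 hS⟩

/-- Weights belonging to a pair of odds. -/
noncomputable def oddsWeights (r t : ℝ) : ℝ × ℝ :=
  (Real.log r - Real.log t, Real.log (1 + t) - Real.log (1 + r))

/-- First odds of the current pair. -/
abbrev oddsE : RealExpr := .get 5 (nvar 16)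

/-- Second odds of the current pair. -/
abbrev oddsE' : RealExpr := .get 6 (nvar 17)

/-- Sweep with the weights belonging to the current pair of odds, in both orders. -/
noncomputable def sweepPair (k : ℕ) (W : NatExpr) : Prog :=
  .seq (.setReal 18 (.lit 0) (.sub (.log oddsE) (.log oddsE')))
    (.seq (.setReal 18 (.lit 1) (.sub (.log (.add oneE oddsE')) (.log (.add oneE oddsE))))
      (.seq (sweep k W)
        (.seq (.setReal 18 (.lit 0) (.sub (.log oddsE') (.log oddsE)))
          (.seq (.setReal 18 (.lit 1) (.sub (.log (.add oneE oddsE)) (.log (.add oneE oddsE'))))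
            (sweep k W)))))

theorem sweepPair_writesIn (k : ℕ) (W : NatExpr) : (sweepPair k W).WritesIn (Set.Ici 18) :=
  have h18 : (18 : ℕ) ∈ Set.Ici 18 := Set.mem_Ici.2 le_rfl
  have hs := (sweep_writesIn k W).mono (Set.Ici_subset_Ici.2 (by norm_num : 18 ≤ 20))
  ⟨h18, h18, hs, h18, h18, hs⟩

/-- Both orders are swept because either the set or its complement may be the smaller side, to which
the geometric grid applies. -/
theorem sweepPair_wp (hp : Params D C k h ox oy W W') {s : Memory}
    (hs : Static D C c (2 ^ h) ox oy s) (hbest : BestOK (Valid D C c) s) {r t : ℝ}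
    (hr : s.real 5 (s.nat 16 0) = r) (ht : s.real 6 (s.nat 17 0) = t) :
    wp (sweepPair k W) (fun s' => BestOK (Valid D C c) s' ∧ Keeps s s' ∧
      CoversAll D C c (oddsWeights r t) s' ∧ CoversAll D C c (oddsWeights t r) s') s
      (2 * sweepCost k h D.n W' W.cost + 56) := by
  have h18 : Set.Ici 18 ⊆ Set.Ici 16 := Set.Ici_subset_Ici.2 (by norm_num)
  have m18 : (18 : ℕ) ∈ Set.Ici 18 := Set.mem_Ici.2 le_rfl
  refine wp.mono (wp_setReal_seq (wp_setReal_seq (wp_seq (B₁ := sweepCost k h D.n W' W.cost)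
    (sweep_covers (c := c) hp ?_ ?_) (B₂ := 28 + sweepCost k h D.n W' W.cost)
    fun s₁ ⟨⟨b1, b2, b3⟩, b4⟩ => ?_))) (fun _ h => h)
    (by simp only [NatExpr.cost, RealExpr.cost]; omega)
  · exact hs.of_agreeOff (((AgreeOff.refl (Set.Ici 18) s).writeReal m18).writeReal m18) h18
  · exact hbest.of_eq rfl (by rw [Memory.writeReal_real_of_ne _ (by norm_num),
      Memory.writeReal_real_of_ne _ (by norm_num)])
  set s₀ := (s.writeReal 18 (NatExpr.eval s (.lit 0))
    (RealExpr.eval s (.sub (.log oddsE) (.log oddsE')))) with hs₀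
  have a₀ : AgreeOff (Set.Ici 18) s s₀ := (AgreeOff.refl (Set.Ici 18) s).writeReal m18
  have a₁ : AgreeOff (Set.Ici 18) s s₁ := (a₀.writeReal m18).trans
    (b4.mono (Set.Ici_subset_Ici.2 (by norm_num)))
  have e : ∀ s' : Memory, AgreeOff (Set.Ici 18) s s' →
      oddsE.eval s' = r ∧ oddsE'.eval s' = t := fun s' h' => by
    simp only [RealExpr.eval, NatExpr.eval, (h' 5 (by simp)).2, (h' 6 (by simp)).2,
      (h' 16 (by simp)).1, (h' 17 (by simp)).1, hr, ht, and_self]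
  have ew : weights (s₀.writeReal 18 (NatExpr.eval s₀ (.lit 1)) (RealExpr.eval s₀
      (.sub (.log (.add oneE oddsE')) (.log (.add oneE oddsE))))) = oddsWeights r t := by
    simp only [weights, oddsWeights, Memory.writeReal_real, hs₀]
    obtain ⟨e1, e2⟩ := e s (.refl _ _)
    simp only [RealExpr.eval, NatExpr.eval] at e1 e2 ⊢
    simp [e1, e2, Memory.writeReal_real]
  rw [ew] at b3
  set s₂ := (s₁.writeReal 18 (NatExpr.eval s₁ (.lit 0))
    (RealExpr.eval s₁ (.sub (.log oddsE') (.log oddsE)))) with hs₂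
  have a₂ : AgreeOff (Set.Ici 18) s s₂ := a₁.writeReal m18
  set s₃ := (s₂.writeReal 18 (NatExpr.eval s₂ (.lit 1)) (RealExpr.eval s₂
      (.sub (.log (.add oneE oddsE)) (.log (.add oneE oddsE'))))) with hs₃
  have a₃ : AgreeOff (Set.Ici 18) s s₃ := a₂.writeReal m18
  have ew' : weights s₃ = oddsWeights t r := by
    obtain ⟨e1, e2⟩ := e s₁ a₁
    simp only [weights, oddsWeights, hs₃, hs₂, Memory.writeReal_real]
    simp only [RealExpr.eval, NatExpr.eval] at e1 e2 ⊢
    simp [e1, e2, Memory.writeReal_real]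
  have k₃ : s₃.real 30 = s₁.real 30 := by
    rw [hs₃, hs₂, Memory.writeReal_real_of_ne _ (by norm_num),
      Memory.writeReal_real_of_ne _ (by norm_num)]
  have k₀ : Keeps s (s₀.writeReal 18 (NatExpr.eval s₀ (.lit 1)) (RealExpr.eval s₀
      (.sub (.log (.add oneE oddsE')) (.log (.add oneE oddsE))))) :=
    Keeps.of_eq rfl (by rw [hs₀, Memory.writeReal_real_of_ne _ (by norm_num),
      Memory.writeReal_real_of_ne _ (by norm_num)])
  refine wp.mono (wp_setReal_seq (wp_setReal_seq (Q := fun s' => BestOK (Valid D C c) s' ∧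
    Keeps s s' ∧ CoversAll D C c (oddsWeights r t) s' ∧ CoversAll D C c (oddsWeights t r) s')
    (B := sweepCost k h D.n W' W.cost) ?_))
    (fun _ h => h) (by simp only [NatExpr.cost, RealExpr.cost]; omega)
  refine (sweep_covers hp (hs.of_agreeOff a₃ h18) (b1.of_eq rfl k₃)).mono ?_ le_rfl
  rintro s₄ ⟨⟨d1, d2, d3⟩, -⟩
  have kk : Keeps s₁ s₄ := (Keeps.of_eq rfl k₃).trans d2
  rw [ew'] at d3
  exact ⟨d1, (k₀.trans b2).trans kk, b3.keeps kk, d3⟩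

/-- Sweep for all pairs of odds. -/
noncomputable def directions (k : ℕ) (W : NatExpr) : Prog :=
  forLoop 16 (nvar 11) (forLoop 17 (nvar 12) (sweepPair k W))

/-- Bound for the steps of `directions`. -/
noncomputable def directionsCost (k h n W cW I J : ℕ) : ℕ :=
  I * (J * (2 * sweepCost k h n W cW + 68) + 22) + 10

theorem directions_wp (hp : Params D C k h ox oy W W') {s : Memory}
    (hs : Static D C c (2 ^ h) ox oy s) (hbest : BestOK (Valid D C c) s) {I J : ℕ} {r t : ℕ → ℝ}
    (hI : s.nat 11 0 = I) (hJ : s.nat 12 0 = J) (hr : s.real 5 = r) (ht : s.real 6 = t) :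
    wp (directions k W) (fun s' => BestOK (Valid D C c) s' ∧
      ∀ i < I, ∀ j < J, CoversAll D C c (oddsWeights (r i) (t j)) s' ∧
        CoversAll D C c (oddsWeights (t j) (r i)) s') s
      (directionsCost k h D.n W' W.cost I J) := by
  refine (wp_forLoop (S := Set.Ici 17) I (fun i s' => BestOK (Valid D C c) s' ∧
      ∀ i' < i, ∀ j < J, CoversAll D C c (oddsWeights (r i') (t j)) s' ∧
        CoversAll D C c (oddsWeights (t j) (r i')) s') (by simp)
    (B := J * (2 * sweepCost k h D.n W' W.cost + 68) + 10) ?_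
    (forLoop_writesIn (by simp) ((sweepPair_writesIn k W).mono
      (Set.Ici_subset_Ici.2 (by norm_num)))) ⟨hbest.of_eq rfl rfl, by simp⟩ ?_).mono
    (fun _ h => h.1) (by simp only [NatExpr.cost, directionsCost, Nat.add_assoc, Nat.reduceAdd]; omega)
  · intro s' hs'
    simp only [NatExpr.eval, (hs' 11 (by simp)).1, hI]
  rintro i hi s₁ a₁ hi₁ ⟨b1, b2⟩
  rw [insert_Ici] at a₁
  refine (wp_forLoop (S := Set.Ici 18) J (fun j s' => BestOK (Valid D C c) s' ∧ Keeps s₁ s' ∧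
      ∀ j' < j, CoversAll D C c (oddsWeights (r i) (t j')) s' ∧
        CoversAll D C c (oddsWeights (t j') (r i)) s') (by simp)
    (B := 2 * sweepCost k h D.n W' W.cost + 56) ?_ (sweepPair_writesIn k W)
    ⟨b1.of_eq rfl rfl, Keeps.of_eq rfl rfl, by simp⟩ ?_).mono ?_
    (by simp only [NatExpr.cost, Nat.add_assoc, Nat.reduceAdd]; omega)
  · intro s' hs'
    simp only [NatExpr.eval, (hs' 12 (by simp)).1, (a₁ 12 (by simp)).1, hJ]
  · rintro j hj s₂ a₂ hj₂ ⟨d1, d2, d3⟩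
    rw [insert_Ici] at a₂
    refine (sweepPair_wp hp ((hs.of_agreeOff a₁ subset_rfl).of_agreeOff a₂
      (Set.Ici_subset_Ici.2 (by norm_num))) d1 (r := r i) (t := t j) ?_ ?_).mono ?_ le_rfl
    · rw [(a₂ 5 (by simp)).2, (a₁ 5 (by simp)).2, (a₂ 16 (by simp)).1, hi₁, hr]
    · rw [(a₂ 6 (by simp)).2, (a₁ 6 (by simp)).2, hj₂, ht]
    rintro s₃ ⟨f1, f2, f3, f4⟩
    have hK : Keeps s₃ (s₃.writeNat 17 0 (j + 1)) := Keeps.of_eq rfl rfl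
    refine ⟨f1.of_eq rfl rfl, (d2.trans f2).trans hK, fun j' hj' => ?_⟩
    rcases Nat.lt_succ_iff_lt_or_eq.1 hj' with hlt | rfl
    · exact ⟨(d3 j' hlt).1.keeps (f2.trans hK), (d3 j' hlt).2.keeps (f2.trans hK)⟩
    · exact ⟨f3.keeps hK, f4.keeps hK⟩
  · rintro s₃ ⟨⟨f1, f2, f3⟩, -⟩
    have hK : Keeps s₃ (s₃.writeNat 16 0 (i + 1)) := Keeps.of_eq rfl rfl
    refine ⟨f1.of_eq rfl rfl, fun i' hi' j hj => ?_⟩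
    rcases Nat.lt_succ_iff_lt_or_eq.1 hi' with hlt | rfl
    · exact ⟨(b2 i' hlt j hj).1.keeps (f2.trans hK), (b2 i' hlt j hj).2.keeps (f2.trans hK)⟩
    · exact ⟨(f3 j hj).1.keeps hK, (f3 j hj).2.keeps hK⟩

/-- Once all directions have been swept, the recorded region is nearly optimal. -/
theorem directions_spec (hp : Params D C k h ox oy W W') (hc : 0 < c) {M N : ℕ} (hM : 1 ≤ M)
    (hN : (D.n : ℝ) < geo D.n M N) {s : Memory}
    (hs : ∀ i < N + 1, ∀ j < 2 * M,
      CoversAll D C c (oddsWeights (fine D.n M N i) (quad (D.A / D.n) M j)) s ∧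
      CoversAll D C c (oddsWeights (quad (D.A / D.n) M j) (fine D.n M N i)) s)
    {x₀ x₁ x₂ x₃ τ : ℝ}
    (hS : Supp C D.n D.A (D.region x₀ x₁ x₂ x₃ τ).card (D.ones (D.region x₀ x₁ x₂ x₃ τ))) :
    s.nat 30 0 ≠ 0 ∧ disc c D.n D.A (D.region x₀ x₁ x₂ x₃ τ).card
      (D.ones (D.region x₀ x₁ x₂ x₃ τ)) ≤ s.real 30 4 + c * 17 / M ^ 2 := by
  classical
  have hn : (0 : ℝ) < D.n := by exact_mod_cast hp.n_pos
  have hf := feasible_region D hp.C_pos hp.n_pos hp.b_le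
    (S := D.region x₀ x₁ x₂ x₃ τ) (Finset.filter_subset _ _) hS
  have hA : (0 : ℝ) < D.A := hf.a_pos.trans hf.a_lt
  have hM0 : (0 : ℝ) < M := by exact_mod_cast hM
  obtain ⟨i, hi, j, hj, hE⟩ := exists_direction hM hf hN
  have hfp : 0 < fine (D.n : ℝ) M N i := fine_pos hn hM i
  have hqp : 0 < quad ((D.A : ℝ) / D.n) M j := quad_pos (by positivity) hM j
  have key : ∀ r t : ℝ, 0 < r → 0 < t → CoversAll D C c (oddsWeights r t) s →
      loss (D.region x₀ x₁ x₂ x₃ τ).card (D.ones (D.region x₀ x₁ x₂ x₃ τ)) r +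
        loss (D.n - (D.region x₀ x₁ x₂ x₃ τ).card) (D.A - D.ones (D.region x₀ x₁ x₂ x₃ τ)) t ≤
        17 * D.A / M ^ 2 →
      s.nat 30 0 ≠ 0 ∧ disc c D.n D.A (D.region x₀ x₁ x₂ x₃ τ).card
        (D.ones (D.region x₀ x₁ x₂ x₃ τ)) ≤ s.real 30 4 + c * 17 / M ^ 2 := by
    intro r t hr ht hcov hl
    obtain ⟨s', a', g1, g2, g3⟩ := hcov x₀ x₁ x₂ x₃ τ hS
    refine ⟨g3.1, ?_⟩
    have := disc_le hc hf g1 hr ht hl g2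
    -- Losses are measured on the scale of `A * fB`, so the division by `A` makes the error
    -- independent of the data.
    have e : c * (17 * D.A / M ^ 2) / D.A = c * 17 / (M : ℝ) ^ 2 := by
      field_simp
    rw [e] at this
    linarith [g3.2]
  rcases hE with hE | hE
  · exact key _ _ hfp hqp (hs i hi j hj).1 hE
  · exact key _ _ hqp hfp (hs i hi j hj).2 hE

/-- Copy the recorded region to the output. -/
noncomputable def output : Prog :=
  block ((List.range 6).map fun i => .setReal 4 (.lit i) (.get 30 (.lit i)))

theorem output_wp (s : Memory) :
    wp output (fun s' => ∀ i < 6, s'.real 4 i = s.real 30 i) s 25 := by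
  have hl : output.LoopFree := loopFree_block (by
    simp only [List.mem_map]; rintro _ ⟨i, -, rfl⟩; trivial)
  refine (hl.wp ?_).mono (fun _ h => h) (by decide)
  intro i hi
  simp only [output, exec_block, List.range_succ, List.range_zero, List.nil_append,
    List.map_append, List.map_cons, List.map_nil, List.foldl_append, List.foldl_cons,
    List.foldl_nil, Prog.exec, RealExpr.eval, NatExpr.eval]
  simp only [Memory.writeReal_real, Nat.reduceEqDiff, false_and, if_false, true_and]
  interval_cases i <;> simp

end RectScan

/-! ### Programs that leave the real arrays unchanged -/

namespace RealRAM

/-- The program writes to no real array. -/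
def Prog.NatOnly : Prog → Prop
  | .skip => True
  | .setNat _ _ _ => True
  | .setReal _ _ _ => False
  | .seq p q => p.NatOnly ∧ q.NatOnly
  | .ite _ p q => p.NatOnly ∧ q.NatOnly
  | .loop _ p => p.NatOnly

theorem Runs.real_eq {p : Prog} {s s' : Memory} {T : ℕ} (h : Runs p s s' T) (hp : p.NatOnly) :
    s'.real = s.real := by
  induction h with
  | skip s => rfl
  | setNat a i e s => rfl
  | setReal a i e s => exact hp.elim
  | seq _ _ ih₁ ih₂ => exact (ih₂ hp.2).trans (ih₁ hp.1)
  | ite_true _ _ ih => exact ih hp.1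
  | ite_false _ _ ih => exact ih hp.2
  | loop_false _ => rfl
  | loop_true _ _ _ ih₁ ih₂ => exact (ih₂ hp).trans (ih₁ hp)

theorem wp.frame_real {p : Prog} {Q : Memory → Prop} {s : Memory} {B : ℕ}
    (h : wp p Q s B) (hp : p.NatOnly) : wp p (fun s' => Q s' ∧ s'.real = s.real) s B := by
  obtain ⟨s', T, h1, h2, h3⟩ := h
  exact ⟨s', T, h1, h2, h3, h1.real_eq hp⟩

end RealRAM

namespace RectScan
open RealRAM

/-! ### Sorting by counting -/

/-- Count the indices below `n` that satisfy a test. -/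
def countIf (b : Cond) : Prog :=
  .seq (.setNat 24 (.lit 0) (.lit 0)) (forLoop 23 (nvar 0) (.ite b (incr 24) .skip))

theorem countIf_writesIn (b : Cond) : (countIf b).WritesIn {23, 24} :=
  ⟨Or.inr rfl, forLoop_writesIn (Or.inl rfl) ⟨Or.inr rfl, trivial⟩⟩

theorem countIf_wp {b : Cond} {n : ℕ} {P : ℕ → Prop} [DecidablePred P] {s : Memory}
    (hn : s.nat 0 0 = n)
    (hb : ∀ q < n, ∀ s', AgreeOff {23, 24} s s' → s'.nat 23 0 = q → (b.Holds s' ↔ P q)) :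
    wp (countIf b) (fun s' => s'.nat 24 0 = ((Finset.range n).filter P).card ∧
      AgreeOff {23, 24} s s') s (n * (b.cost + 19) + 13) := by
  have hw : Prog.WritesIn {24} (.ite b (incr 24) .skip) := ⟨rfl, trivial⟩
  refine wp.frame (wp.mono (wp_setNat_seq (wp_forLoop (S := {24}) n
    (fun q s' => s'.nat 24 0 = ((Finset.range q).filter P).card) (by simp)
    (B := b.cost + 7) ?_ hw (by simp [Memory.writeNat_nat, NatExpr.eval]) ?_)) (fun _ h => h.1)
    (by simp only [NatExpr.cost, Nat.add_assoc, Nat.reduceAdd]; omega)) (countIf_writesIn b)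
  · intro s' hs'
    simp only [NatExpr.eval, (hs' 0 (by simp)).1, Memory.writeNat_nat_of_ne s (show 0 ≠ 24 by simp),
      hn]
  · intro q hq s' hs' hq' hinv
    have ha : AgreeOff {23, 24} s s' :=
      ((AgreeOff.refl {23, 24} s).writeNat (by simp)).trans hs'
    have hs := hb q hq s' ha hq'
    refine (wp_ite (B := 6) (fun h => (wp_setNat ?_).mono (fun _ h => h) (by simp [NatExpr.cost]))
      fun h => (wp_skip ?_).mono (fun _ h => h) (by norm_num)).mono (fun _ h => h) (by omega)
    · rw [hs] at h
      simp [NatExpr.eval, Memory.writeNat_nat, hinv, Finset.range_add_one, Finset.filter_insert, h]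
    · rw [hs] at h
      simp [Memory.writeNat_nat, hinv, Finset.range_add_one, Finset.filter_insert, h]

/-- The order by `f`, ties being broken by the index. -/
def Prec (f : ℕ → ℝ) (q i : ℕ) : Prop := f q < f i ∨ f q ≤ f i ∧ q < i

theorem prec_irrefl (f : ℕ → ℝ) (i : ℕ) : ¬ Prec f i i := by simp [Prec]

open Classical in
/-- Position of `i` in the order `Prec f`. -/
noncomputable def position (n : ℕ) (f : ℕ → ℝ) (i : ℕ) : ℕ :=
  ((Finset.range n).filter fun q => Prec f q i).card

theorem position_strict {n : ℕ} {f : ℕ → ℝ} {i j : ℕ} (hi : i < n) (h : Prec f i j) :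
    position n f i < position n f j := by
  classical
  refine Finset.card_lt_card (Finset.ssubset_iff_of_subset (fun q hq => ?_) |>.2 ⟨i, ?_, ?_⟩)
  · simp only [Finset.mem_filter] at hq ⊢
    refine ⟨hq.1, ?_⟩
    rcases hq.2 with h1 | ⟨h1, h1'⟩ <;> rcases h with h2 | ⟨h2, h2'⟩
    · exact Or.inl (h1.trans h2)
    · exact Or.inl (h1.trans_le h2)
    · exact Or.inl (h1.trans_lt h2)
    · exact Or.inr ⟨h1.trans h2, h1'.trans h2'⟩
  · simp [hi, h]
  · exact fun hm => prec_irrefl f i (Finset.mem_filter.1 hm).2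

theorem position_lt {n : ℕ} {f : ℕ → ℝ} {i : ℕ} (hi : i < n) : position n f i < n := by
  classical
  have : ((Finset.range n).filter fun q => Prec f q i) ⊂ Finset.range n :=
    Finset.filter_ssubset.2 ⟨i, Finset.mem_range.2 hi, prec_irrefl f i⟩
  simpa [position] using Finset.card_lt_card this

theorem prec_or {f : ℕ → ℝ} {i j : ℕ} (h : i ≠ j) : Prec f i j ∨ Prec f j i := by
  unfold Prec
  rcases lt_trichotomy (f i) (f j) with h1 | h1 | h1
  · exact Or.inl (Or.inl h1)
  · rcases Nat.lt_or_gt_of_ne h with h2 | h2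
    · exact Or.inl (Or.inr ⟨h1.le, h2⟩)
    · exact Or.inr (Or.inr ⟨h1.ge, h2⟩)
  · exact Or.inr (Or.inl h1)

/-- Having a left inverse, `position` is injective on `n` indices with values below `n`, hence a
bijection, and `o` is its inverse. -/
theorem isOrder_of_position {n : ℕ} {f : ℕ → ℝ} {o : ℕ → ℕ}
    (h : ∀ i < n, o (position n f i) = i) : IsOrder n f o := by
  have hinj : Set.InjOn (position n f) (Finset.range n) := fun i hi j hj hij => by
    simp only [Finset.coe_range, Set.mem_Iio] at hi hj
    rw [← h i hi, ← h j hj, hij]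
  have hsurj : ∀ v < n, ∃ i < n, position n f i = v := by
    have := Finset.surjOn_of_injOn_of_card_le (s := Finset.range n) (t := Finset.range n)
      (position n f) (fun i hi => by
        simp only [Finset.coe_range, Set.mem_Iio] at hi ⊢; exact position_lt hi) hinj le_rfl
    intro v hv
    obtain ⟨i, hi, hi'⟩ := this (by simpa using hv : v ∈ (Finset.range n : Set ℕ))
    exact ⟨i, by simpa using hi, hi'⟩
  refine ⟨⟨fun v hv => ?_, fun u hu v hv huv => ?_, fun i hi => ?_⟩, fun u v huv hv => ?_⟩
  · obtain ⟨i, hi, rfl⟩ := hsurj v hv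
    rw [h i hi]; exact hi
  · obtain ⟨i, hi, rfl⟩ := hsurj u hu
    obtain ⟨j, hj, rfl⟩ := hsurj v hv
    rw [h i hi, h j hj] at huv
    rw [huv]
  · exact ⟨position n f i, position_lt hi, h i hi⟩
  · obtain ⟨i, hi, rfl⟩ := hsurj u (by omega)
    obtain ⟨j, hj, rfl⟩ := hsurj v hv
    rw [h i hi, h j hj]
    by_contra hlt
    have := position_strict hj (Or.inl (not_le.1 hlt) : Prec f j i)
    omega

/-- The order `Prec` as a test. -/
def precCond (a : ℕ) : Cond :=
  .not (.and (.not (.realLt (.get a (nvar 23)) (.get a (nvar 25))))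
    (.not (.and (.not (.realLt (.get a (nvar 25)) (.get a (nvar 23))))
      (.natLt (nvar 23) (nvar 25)))))

/-- Sort the real array `a`; the order is stored in the array `o`. -/
def sortInto (a o : ℕ) : Prog :=
  forLoop 25 (nvar 0) (.seq (countIf (precCond a)) (.setNat o (nvar 24) (nvar 25)))

/-- Sorting by counting predecessors takes quadratic time, which the overall bound absorbs. -/
theorem sortInto_wp {a o n : ℕ} {s : Memory} (hn : s.nat 0 0 = n) (ha : a < 23) (ho : o < 23)
    (ho0 : o ≠ 0) (hao : a ≠ o) :
    wp (sortInto a o) (fun s' => IsOrder n (s.real a) (s'.nat o) ∧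
      AgreeOff {25, o, 23, 24} s s') s (n * (n * 44 + 30) + 10) := by
  have hw : Prog.WritesIn {o, 23, 24} (.seq (countIf (precCond a)) (.setNat o (nvar 24) (nvar 25))) :=
    ⟨(countIf_writesIn _).mono (by intro x; simp; tauto), by simp [Prog.WritesIn]⟩
  refine wp.mono (wp_forLoop (S := {o, 23, 24}) n
    (fun k s' => ∀ i < k, s'.nat o (position n (s.real a) i) = i) (by simp; omega)
    (B := n * 44 + 18) ?_ hw (by simp) ?_) ?_
    (by simp only [NatExpr.cost, Nat.add_assoc, Nat.reduceAdd]; omega)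
  · intro s' hs'
    simp only [NatExpr.eval, (hs' 0 (by simp; omega)).1, hn]
  · intro k hk s' hs' hk' hinv
    classical
    have hA : ∀ x, x ≠ 25 → x ≠ o → x ≠ 23 → x ≠ 24 → s'.nat x = s.nat x ∧ s'.real x = s.real x :=
      fun x h1 h2 h3 h4 => hs' x (by simp [h1, h2, h3, h4])
    have e0 : s'.nat 0 0 = n := by
      rw [(hA 0 (by norm_num) (Ne.symm ho0) (by norm_num) (by norm_num)).1, hn]
    have ea : s'.real a = s.real a := (hA a (by omega) hao (by omega) (by omega)).2
    have hcount := countIf_wp (b := precCond a) (P := fun q => Prec (s.real a) q k) e0 ?_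
    · refine (wp_seq hcount (B₂ := 5) ?_).mono (fun _ h => h) (by
        simp only [precCond, Cond.cost, RealExpr.cost, NatExpr.cost, Nat.add_assoc,
          Nat.reduceAdd]; omega)
      rintro s₂ ⟨h1, h2⟩
      refine (wp_setNat ?_).mono (fun _ h => h) (by simp [NatExpr.cost])
      intro i hi
      have e25 : s₂.nat 25 0 = k := by rw [(h2 25 (by simp)).1, hk']
      simp only [NatExpr.eval, h1, e25, Memory.writeNat_nat]
      have : o ≠ 25 := by omega
      simp only [this, false_and, if_false, true_and]
      rcases Nat.lt_succ_iff_lt_or_eq.1 hi with hlt | rfl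
      · have hne : position n (s.real a) i ≠ position n (s.real a) k := by
          rcases prec_or (f := s.real a) (show i ≠ k by omega) with h | h
          · exact (position_strict (by omega) h).ne
          · exact (position_strict hk h).ne'
        change (if position n (s.real a) i = position n (s.real a) k then k else _) = i
        rw [if_neg hne, (h2 o (by simp; omega)).1]
        exact hinv i hlt
      · exact if_pos rfl
    · intro q hq s'' hs'' hq'
      simp only [precCond, Cond.Holds, RealExpr.eval, NatExpr.eval, hq',
        (hs'' 25 (by simp)).1, hk', (hs'' a (by simp; omega)).2, ea, Prec, not_lt]
      rw [not_and_or, not_not, not_le]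
  · rintro s' ⟨h1, h2⟩
    exact ⟨isOrder_of_position h1, h2⟩

end RectScan

namespace RectScan
open RealRAM

/-! ### Setting up the tree -/

/-- Compute the least power of two that is at least the number of points. -/
def findSize : Prog :=
  .seq (.setNat 3 (.lit 0) (.lit 1))
    (.loop (.natLt (nvar 3) (nvar 0)) (.setNat 3 (.lit 0) (.add (nvar 3) (nvar 3))))

theorem findSize_writesIn : findSize.WritesIn {3} := ⟨rfl, rfl⟩

/-- Doubling happens only below `n`, so the result is at most `2 n`; this keeps the tree linear in
size and logarithmic in depth. -/
theorem findSize_wp {n : ℕ} {s : Memory} (hn : s.nat 0 0 = n) (hn0 : 0 < n) :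
    wp findSize (fun s' => (∃ h, s'.nat 3 0 = 2 ^ h ∧ n ≤ 2 ^ h ∧ 2 ^ h ≤ 2 * n) ∧
      AgreeOff {3} s s') s (n * 13 + 9) := by
  refine wp.frame ?_ findSize_writesIn
  let J : Memory → Prop := fun s' => s'.nat 0 0 = n ∧ ∃ h, s'.nat 3 0 = 2 ^ h ∧ 2 ^ h ≤ 2 * n
  have hloop := wp_loop (b := .natLt (nvar 3) (nvar 0))
    (p := .setNat 3 (.lit 0) (.add (nvar 3) (nvar 3))) (B := 7) J (fun s' => n - s'.nat 3 0) (by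
      rintro s' ⟨h1, h, h2, h3⟩ hlt
      simp only [Cond.Holds, NatExpr.eval, h1] at hlt
      refine (wp_setNat ⟨⟨?_, h + 1, ?_, ?_⟩, ?_⟩).mono (fun _ h => h) (by simp [NatExpr.cost])
      · simp [Memory.writeNat_nat, h1]
      · simp [Memory.writeNat_nat, NatExpr.eval, h2, pow_succ]; ring
      · rw [pow_succ]; omega
      · have : 0 < 2 ^ h := by positivity
        simp only [Memory.writeNat_nat, NatExpr.eval, and_self, if_true]; omega)
  refine (wp_setNat_seq (hloop _ ⟨?_, 0, ?_, by omega⟩)).mono ?_ ?_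
  · simp [Memory.writeNat_nat, hn]
  · simp [Memory.writeNat_nat, NatExpr.eval]
  · rintro s' ⟨⟨h1, h, h2, h3⟩, h4⟩
    simp only [Cond.Holds, NatExpr.eval, h1, not_lt] at h4
    exact ⟨h, h2, h2 ▸ h4, h3⟩
  · simp only [NatExpr.cost, Cond.cost, Memory.writeNat_nat, NatExpr.eval, and_self, if_true,
      Nat.reduceAdd]
    omega

/-- Tabulate division by two. -/
def halves : Prog :=
  forLoop 25 (nvar 3) (.seq (.setNat 4 (.add (nvar 25) (nvar 25)) (nvar 25))
    (.setNat 4 (.add (.add (nvar 25) (nvar 25)) (.lit 1)) (nvar 25)))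

/-- Natural numbers cannot be divided on this machine; the table makes the step to a parent node a
single lookup. -/
theorem halves_wp {m : ℕ} {s : Memory} (hm : s.nat 3 0 = m) :
    wp halves (fun s' => (∀ ν < 2 * m, s'.nat 4 ν = ν / 2) ∧ AgreeOff {25, 4} s s') s
      (m * 30 + 10) := by
  have hw : Prog.WritesIn {4} (.seq (.setNat 4 (.add (nvar 25) (nvar 25)) (nvar 25))
      (.setNat 4 (.add (.add (nvar 25) (nvar 25)) (.lit 1)) (nvar 25))) := ⟨rfl, rfl⟩
  refine wp_forLoop (S := {4}) m (fun j s' => ∀ ν < 2 * j, s'.nat 4 ν = ν / 2) (by simp)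
    (B := 18) ?_ hw (by simp) ?_
  · intro s' hs'
    simp only [NatExpr.eval, (hs' 3 (by simp)).1, hm]
  · intro j _ s' _ hj hinv
    refine (wp_setNat_seq (wp_setNat ?_)).mono (fun _ h => h) (by simp [NatExpr.cost])
    intro ν hν
    simp only [NatExpr.eval, hj, Memory.writeNat_nat, true_and]
    by_cases h1 : ν = j + j + 1
    · simp [h1]; omega
    · by_cases h2 : ν = j + j
      · simp [h2]; omega
      · have := hinv ν (by omega)
        simp [h1, h2, this]

/-- Compute the leaves of all points. -/
def leaves : Prog :=
  forLoop 25 (nvar 0) (.seq (countIf (.realLt (.get 1 (nvar 23)) (.get 1 (nvar 25))))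
    (.setNat 5 (nvar 25) (.add (nvar 3) (nvar 24))))

theorem leaves_wp {D : Inst} {m : ℕ} {s : Memory} (hn : s.nat 0 0 = D.n) (hY : s.real 1 = D.Y)
    (hm : s.nat 3 0 = m) :
    wp leaves (fun s' => (∀ i < D.n, s'.nat 5 i = m + D.rank i) ∧
      AgreeOff {25, 5, 23, 24} s s') s (D.n * (D.n * 26 + 34) + 10) := by
  have hw : Prog.WritesIn {5, 23, 24}
      (.seq (countIf (.realLt (.get 1 (nvar 23)) (.get 1 (nvar 25))))
        (.setNat 5 (nvar 25) (.add (nvar 3) (nvar 24)))) :=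
    ⟨(countIf_writesIn _).mono (by intro x; simp; tauto), Or.inl rfl⟩
  refine (wp_forLoop (S := {5, 23, 24}) D.n (fun k s' => ∀ i < k, s'.nat 5 i = m + D.rank i)
    (by simp) (B := D.n * 26 + 22) ?_ hw (by simp) ?_).mono (fun _ h => h)
    (by simp only [NatExpr.cost, Nat.add_assoc, Nat.reduceAdd]; omega)
  · intro s' hs'
    simp only [NatExpr.eval, (hs' 0 (by simp)).1, hn]
  · intro k hk s' hs' hk' hinv
    classical
    have e0 : s'.nat 0 0 = D.n := by rw [(hs' 0 (by simp)).1, hn]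
    have hcount := countIf_wp (b := .realLt (.get 1 (nvar 23)) (.get 1 (nvar 25)))
      (P := fun q => D.Y q < D.Y k) e0 ?_
    · refine (wp_seq hcount (B₂ := 8) ?_).mono (fun _ h => h) (by
        simp only [Cond.cost, RealExpr.cost, NatExpr.cost, Nat.add_assoc, Nat.reduceAdd]; omega)
      rintro s₂ ⟨h1, h2⟩
      refine (wp_setNat ?_).mono (fun _ h => h) (by simp [NatExpr.cost])
      intro i hi
      have e25 : s₂.nat 25 0 = k := by rw [(h2 25 (by simp)).1, hk']
      have e3 : s₂.nat 3 0 = m := by rw [(h2 3 (by simp)).1, (hs' 3 (by simp)).1, hm]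
      simp only [NatExpr.eval, h1, e25, e3, Memory.writeNat_nat]
      rcases Nat.lt_succ_iff_lt_or_eq.1 hi with hlt | rfl
      · simp [hlt.ne, (h2 5 (by simp)).1, hinv i hlt]
      · simp [Inst.rank]
    · intro q hq s'' hs'' hq'
      simp only [Cond.Holds, RealExpr.eval, NatExpr.eval, hq', (hs'' 25 (by simp)).1, hk',
        (hs'' 1 (by simp)).2, (hs' 1 (by simp)).2, hY]

theorem hist_succ (n : ℕ) (leaf g : ℕ → ℕ) (l : ℕ) :
    hist (n + 1) leaf g l = hist n leaf g l + if leaf n = l then g n else 0 :=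
  Finset.sum_range_succ _ _

/-- Count the points at each leaf. -/
def histograms : Prog :=
  forLoop 25 (nvar 0) (.seq
    (.setNat 8 (.get 5 (nvar 25)) (.add (.get 8 (.get 5 (nvar 25))) (.lit 1)))
    (.setNat 9 (.get 5 (nvar 25)) (.add (.get 9 (.get 5 (nvar 25))) (.get 1 (nvar 25)))))

theorem histograms_wp {D : Inst} {leaf : ℕ → ℕ} {s : Memory} (hn : s.nat 0 0 = D.n)
    (hb : s.nat 1 = D.b) (hleaf : ∀ i < D.n, s.nat 5 i = leaf i) (h8 : ∀ l, s.nat 8 l = 0)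
    (h9 : ∀ l, s.nat 9 l = 0) :
    wp histograms (fun s' => (∀ l, s'.nat 8 l = hist D.n leaf (fun _ => 1) l ∧
      s'.nat 9 l = hist D.n leaf D.b l) ∧ AgreeOff {25, 8, 9} s s') s (D.n * 36 + 10) := by
  have hw : Prog.WritesIn {8, 9} (.seq
      (.setNat 8 (.get 5 (nvar 25)) (.add (.get 8 (.get 5 (nvar 25))) (.lit 1)))
      (.setNat 9 (.get 5 (nvar 25)) (.add (.get 9 (.get 5 (nvar 25))) (.get 1 (nvar 25))))) :=
    ⟨Or.inl rfl, Or.inr rfl⟩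
  refine (wp_forLoop (S := {8, 9}) D.n (fun k s' => ∀ l, s'.nat 8 l = hist k leaf (fun _ => 1) l ∧
      s'.nat 9 l = hist k leaf D.b l)
    (by simp) (B := 24) ?_ hw ?_ ?_).mono (fun _ h => h) (by simp [NatExpr.cost])
  · intro s' hs'
    simp only [NatExpr.eval, (hs' 0 (by simp)).1, hn]
  · simp [Memory.writeNat_nat, h8, h9, hist]
  · intro k hk s' hs' hk' hinv
    refine (wp_setNat_seq (wp_setNat ?_)).mono (fun _ h => h) (by simp [NatExpr.cost])
    intro l
    have e5 : s'.nat 5 k = leaf k := by rw [(hs' 5 (by simp)).1, hleaf k hk]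
    have e1 : s'.nat 1 k = D.b k := by rw [(hs' 1 (by simp)).1, hb]
    obtain ⟨g1, g2⟩ := hinv l
    by_cases hl : l = leaf k
    · subst hl
      simp [NatExpr.eval, hk', e5, e1, Memory.writeNat_nat, g1, g2, hist_succ]
    · simp [NatExpr.eval, hk', e5, e1, Memory.writeNat_nat, g1, g2, hist_succ, hl,
        Ne.symm hl]

/-- The memory holds the instance. -/
structure Loaded (D : Inst) (C c : ℝ) (s : Memory) : Prop where
  n_eq : s.nat 0 0 = D.n
  b_eq : s.nat 1 = D.b
  X_eq : s.real 0 = D.X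
  Y_eq : s.real 1 = D.Y
  T_eq : s.real 2 = D.T
  C_eq : s.real 3 1 = C
  c_eq : s.real 3 2 = c

theorem Loaded.of_agreeOff {D : Inst} {C c : ℝ} {s s' : Memory} {S : Set ℕ}
    (h : Loaded D C c s) (hs : AgreeOff S s s') (h0 : 0 ∉ S) (h1 : 1 ∉ S) (h2 : 2 ∉ S ∨
      s'.real = s.real) (h3 : 3 ∉ S ∨ s'.real = s.real) :
    Loaded D C c s' := by
  have e2 : s'.real 2 = s.real 2 := h2.elim (fun h => (hs 2 h).2) fun h => by rw [h]
  have e3 : s'.real 3 = s.real 3 := h3.elim (fun h => (hs 3 h).2) fun h => by rw [h]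
  obtain ⟨a1, a2, a3, a4, a5, a6, a7⟩ := h
  exact ⟨(hs 0 h0).1 ▸ a1, (hs 1 h1).1.trans a2, (hs 0 h0).2.trans a3, (hs 1 h1).2.trans a4,
    e2.trans a5, e3 ▸ a6, e3 ▸ a7⟩

/-- Sort the points and set up the tree. -/
def arrange : Prog :=
  .seq (sortInto 0 6) (.seq (sortInto 1 7) (.seq findSize (.seq halves (.seq leaves histograms))))

/-- Natural-number and real arrays share names, and the odds are kept in real arrays `5` and `6`;
they survive the writes to the natural-number arrays `5` and `6`. -/
theorem arrange_natOnly : arrange.NatOnly := by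
  simp [arrange, sortInto, findSize, halves, leaves, histograms, forLoop, countIf, Prog.NatOnly]

theorem arrange_writesIn : arrange.WritesIn {3, 4, 5, 6, 7, 8, 9, 23, 24, 25} := by
  simp [arrange, sortInto, findSize, halves, leaves, histograms, forLoop, countIf, Prog.WritesIn]

theorem arrange_wp {D : Inst} {C c : ℝ} {s : Memory} (hs : Loaded D C c s) (hn0 : 0 < D.n)
    (hA : s.nat 2 0 = D.A) (h8 : ∀ l, s.nat 8 l = 0) (h9 : ∀ l, s.nat 9 l = 0) :
    wp arrange (fun s' => ((∃ h ox oy, Static D C c (2 ^ h) ox oy s' ∧ IsOrder D.n D.X ox ∧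
      IsOrder D.n D.Y oy ∧ D.n ≤ 2 ^ h ∧ 2 ^ h ≤ 2 * D.n) ∧ s'.real = s.real) ∧
      AgreeOff {3, 4, 5, 6, 7, 8, 9, 23, 24, 25} s s') s (500 * D.n ^ 2) := by
  refine wp.frame (wp.frame_real ?_ arrange_natOnly) arrange_writesIn
  refine wp.mono (wp_seq (sortInto_wp hs.n_eq (by norm_num) (by norm_num) (by norm_num)
    (by norm_num)) (B₂ := D.n * (D.n * 44 + 30) + 10 + (D.n * 13 + 9 + ((2 * D.n) * 30 + 10 +
      (D.n * (D.n * 26 + 34) + 10 + (D.n * 36 + 10))))) ?_) (fun _ h => h) (by nlinarith)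
  rintro s₁ ⟨o₁, a₁⟩
  have l₁ : Loaded D C c s₁ := hs.of_agreeOff a₁ (by simp) (by simp) (.inl (by simp)) (.inl (by simp))
  refine wp_seq (sortInto_wp l₁.n_eq (by norm_num) (by norm_num) (by norm_num) (by norm_num)) ?_
  rintro s₂ ⟨o₂, a₂⟩
  have l₂ : Loaded D C c s₂ := l₁.of_agreeOff a₂ (by simp) (by simp) (.inl (by simp)) (.inl (by simp))
  refine wp_seq ((findSize_wp l₂.n_eq hn0).frame_real ⟨trivial, trivial⟩) ?_
  rintro s₃ ⟨⟨⟨h, hm, hm1, hm2⟩, a₃⟩, r₃⟩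
  have l₃ : Loaded D C c s₃ := l₂.of_agreeOff a₃ (by simp) (by simp) (.inl (by simp)) (.inr r₃)
  refine wp_seq ((halves_wp hm).mono (fun _ h => h) (by omega)) ?_
  rintro s₄ ⟨hh, a₄⟩
  have l₄ : Loaded D C c s₄ := l₃.of_agreeOff a₄ (by simp) (by simp) (.inl (by simp)) (.inl (by simp))
  have m₄ : s₄.nat 3 0 = 2 ^ h := by rw [(a₄ 3 (by simp)).1, hm]
  refine wp_seq (leaves_wp l₄.n_eq l₄.Y_eq m₄) ?_
  rintro s₅ ⟨hl, a₅⟩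
  have l₅ : Loaded D C c s₅ := l₄.of_agreeOff a₅ (by simp) (by simp) (.inl (by simp)) (.inl (by simp))
  have z₅ : ∀ l, s₅.nat 8 l = 0 ∧ s₅.nat 9 l = 0 := fun l => by
    rw [(a₅ 8 (by simp)).1, (a₄ 8 (by simp)).1, (a₃ 8 (by simp)).1, (a₂ 8 (by simp)).1,
      (a₁ 8 (by simp)).1, (a₅ 9 (by simp)).1, (a₄ 9 (by simp)).1, (a₃ 9 (by simp)).1,
      (a₂ 9 (by simp)).1, (a₁ 9 (by simp)).1]
    exact ⟨h8 l, h9 l⟩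
  refine (histograms_wp l₅.n_eq l₅.b_eq hl (fun l => (z₅ l).1) fun l => (z₅ l).2).mono ?_ le_rfl
  rintro s₆ ⟨hh₆, a₆⟩
  have l₆ : Loaded D C c s₆ := l₅.of_agreeOff a₆ (by simp) (by simp) (.inl (by simp)) (.inl (by simp))
  have ex : IsOrder D.n D.X (s₆.nat 6) := by
    rw [(a₆ 6 (by simp)).1, (a₅ 6 (by simp)).1, (a₄ 6 (by simp)).1, (a₃ 6 (by simp)).1,
      (a₂ 6 (by simp)).1, ← hs.X_eq]
    exact o₁
  have ey : IsOrder D.n D.Y (s₆.nat 7) := by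
    rw [(a₆ 7 (by simp)).1, (a₅ 7 (by simp)).1, (a₄ 7 (by simp)).1, (a₃ 7 (by simp)).1, ← l₁.Y_eq]
    exact o₂
  refine ⟨h, s₆.nat 6, s₆.nat 7, ⟨l₆.n_eq, l₆.b_eq, l₆.X_eq, l₆.Y_eq, l₆.T_eq, l₆.C_eq, l₆.c_eq,
    ?_, ?_, fun ν hν => ?_, fun i hi => ?_, rfl, rfl, fun l _ => (hh₆ l).1, fun l _ => (hh₆ l).2⟩,
    ex, ey, hm1, hm2⟩
  · rw [(a₆ 2 (by simp)).1, (a₅ 2 (by simp)).1, (a₄ 2 (by simp)).1, (a₃ 2 (by simp)).1,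
      (a₂ 2 (by simp)).1, (a₁ 2 (by simp)).1, hA]
  · rw [(a₆ 3 (by simp)).1, (a₅ 3 (by simp)).1, m₄]
  · rw [(a₆ 4 (by simp)).1, (a₅ 4 (by simp)).1, hh ν hν]
  · rw [(a₆ 5 (by simp)).1, hl i hi]

end RectScan

namespace RectScan
open RealRAM

/-! ### Setting up the odds -/

/-- Count the ones. -/
def countOnes : Prog :=
  .seq (countIf (.natLt (.lit 0) (.get 1 (nvar 23)))) (.setNat 2 (.lit 0) (nvar 24))

theorem countOnes_wp {D : Inst} {s : Memory} (hn : s.nat 0 0 = D.n) (hb : s.nat 1 = D.b)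
    (hb1 : ∀ i, D.b i ≤ 1) :
    wp countOnes (fun s' => s'.nat 2 0 = D.A ∧ AgreeOff {2, 23, 24} s s') s (D.n * 24 + 17) := by
  have hw : countOnes.WritesIn {2, 23, 24} :=
    ⟨(countIf_writesIn _).mono (by intro x; simp; tauto), Or.inl rfl⟩
  have hcount := countIf_wp (b := .natLt (.lit 0) (.get 1 (nvar 23)))
    (P := fun q => 0 < D.b q) hn ?_
  · refine (wp_seq hcount (B₂ := 4) ?_).frame hw
    rintro s₁ ⟨h1, -⟩
    refine (wp_setNat ?_).mono (fun _ h => h) (by simp [NatExpr.cost])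
    simp only [NatExpr.eval, Memory.writeNat_nat, and_self, if_true, h1]
    rw [Finset.card_filter, Inst.A]
    refine Finset.sum_congr rfl fun q _ => ?_
    have := hb1 q
    split_ifs <;> omega
  · intro q _ s' hs' hq
    simp only [Cond.Holds, NatExpr.eval, hq, (hs' 1 (by simp)).1, hb]

/-- The fineness of the grids. -/
abbrev fineE : RealExpr := .ofNat (nvar 10)

/-- Find the fineness of the grids. -/
def findFineness : Prog :=
  .seq (.setNat 10 (.lit 0) (.lit 1))
    (.loop (.realLt (.mul (.mul fineE fineE) (.get 3 (.lit 0)))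
      (.mul (.ofNat (.lit 17)) (.get 3 (.lit 2)))) (incr 10))

/-- Reals cannot be rounded, so `M` is found by counting up until `17 c / M² ≤ ε`. Both `M²` and the
number of rounds are `O(max(1, 1/ε))`. -/
theorem findFineness_wp {ε c : ℝ} {s : Memory} (hε : 0 < ε) (hc : 0 < c) (h0 : s.real 3 0 = ε)
    (h2 : s.real 3 2 = c) :
    wp findFineness (fun s' => (∃ M : ℕ, 1 ≤ M ∧ s'.nat 10 0 = M ∧ 17 * c ≤ M * M * ε ∧
        (M : ℝ) ^ 2 ≤ 2 + 34 * c / ε) ∧ AgreeOff {10} s s') s (⌈17 * c / ε⌉₊ * 24 + 20) := by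
  refine wp.frame ?_ (⟨rfl, rfl⟩ : findFineness.WritesIn {10})
  set Z := ⌈17 * c / ε⌉₊
  let J : Memory → Prop := fun s' => s'.real 3 = s.real 3 ∧ ∃ M : ℕ, 1 ≤ M ∧ s'.nat 10 0 = M ∧
    (M : ℝ) ^ 2 ≤ 2 + 34 * c / ε
  have key : 34 * c / ε = 2 * (17 * c / ε) := by ring
  have hloop := wp_loop (b := .realLt (.mul (.mul fineE fineE) (.get 3 (.lit 0)))
      (.mul (.ofNat (.lit 17)) (.get 3 (.lit 2)))) (p := incr 10) (B := 6) J
    (fun s' => Z - s'.nat 10 0) (by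
      rintro s' ⟨h3, M, hM1, hM, hM2⟩ hlt
      simp only [Cond.Holds, RealExpr.eval, NatExpr.eval, h3, h0, h2, hM] at hlt
      have hM1' : (1 : ℝ) ≤ M := by exact_mod_cast hM1
      have hq : (M : ℝ) * M < 17 * c / ε := by rw [lt_div_iff₀ hε]; exact_mod_cast hlt
      have hZ : M < Z := by
        have : (M : ℝ) < Z := lt_of_lt_of_le (by nlinarith) (Nat.le_ceil _)
        exact_mod_cast this
      refine (wp_setNat ⟨⟨h3, M + 1, by omega, ?_, ?_⟩, ?_⟩).mono (fun _ h => h)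
        (by simp [NatExpr.cost])
      · simp [Memory.writeNat_nat, NatExpr.eval, hM]
      · push_cast
        rw [key]
        -- `(M + 1)² ≤ 2 M² + 2`, and `M² < 17 c / ε` by the loop test.
        nlinarith [sq_nonneg ((M : ℝ) - 1)]
      · simp only [Memory.writeNat_nat, NatExpr.eval, and_self, if_true, hM]; omega)
  refine (wp_setNat_seq (hloop _ ⟨rfl, 1, le_rfl, ?_, ?_⟩)).mono ?_ ?_
  · simp [Memory.writeNat_nat, NatExpr.eval]
  · have : 0 < c / ε := by positivity
    rw [mul_div_assoc]; push_cast; linarith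
  · rintro s' ⟨⟨h3, M, hM1, hM, hM2⟩, h4⟩
    simp only [Cond.Holds, RealExpr.eval, NatExpr.eval, h3, h0, h2, hM, not_lt] at h4
    exact ⟨M, hM1, hM, by exact_mod_cast h4, hM2⟩
  · simp only [NatExpr.cost, Cond.cost, RealExpr.cost, Memory.writeNat_nat, NatExpr.eval, and_self,
      if_true, Nat.reduceAdd]
    omega

/-- The hypothesis says `(1 + 1/M) ^ N ≤ n²`, and `log (1 + 1/M) ≥ 1 / (M + 1) ≥ 1 / (2 M)`. -/
theorem le_of_geo_le {n M : ℝ} {N : ℕ} (hn : 0 < n) (hM : 1 ≤ M) (h : geo n M N ≤ n) :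
    (N : ℝ) ≤ 4 * M * Real.log n := by
  have hM0 : 0 < M := by linarith
  have h1 : (1 + 1 / M) ^ N ≤ n ^ 2 := by
    rw [geo, div_le_iff₀ hn] at h
    linarith
  have hp : 0 < 1 + 1 / M := by positivity
  have h2 := Real.log_le_log (by positivity) h1
  rw [Real.log_pow, Real.log_pow] at h2
  have h3 := Real.one_sub_inv_le_log_of_pos hp
  have h4 : 1 / (2 * M) ≤ 1 - (1 + 1 / M)⁻¹ := by
    have : 1 - (1 + 1 / M)⁻¹ = 1 / (M + 1) := by field_simp; ring
    rw [this]
    exact one_div_le_one_div_of_le (by linarith) (by linarith)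
  have h5 : (N : ℝ) * (1 / (2 * M)) ≤ 2 * Real.log n := by
    refine (mul_le_mul_of_nonneg_left (h4.trans h3) (Nat.cast_nonneg N)).trans ?_
    exact_mod_cast h2
  rw [mul_one_div, div_le_iff₀ (by linarith)] at h5
  linarith

/-- Tabulate the geometric grid. -/
def fineGrid : Prog :=
  .seq (.setNat 27 (.lit 0) (.lit 0)) (.seq (.setReal 27 (.lit 0) (.div oneE nE))
    (.seq (.loop (.not (.realLt nE (.get 27 (.lit 0))))
      (.seq (.setReal 5 (nvar 27) (.get 27 (.lit 0)))
        (.seq (.setReal 27 (.lit 0) (.mul (.get 27 (.lit 0)) (.add oneE (.div oneE fineE))))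
          (incr 27))))
      (.seq (.setReal 5 (nvar 27) (.mul fineE fineE))
        (.setNat 11 (.lit 0) (.add (nvar 27) (.lit 1))))))

theorem fineGrid_wp {n M : ℕ} {s : Memory} (hn : s.nat 0 0 = n) (hn0 : 0 < n) (hM1 : 1 ≤ M)
    (hM : s.nat 10 0 = M) :
    wp fineGrid (fun s' => (∃ N : ℕ, s'.nat 11 0 = N + 1 ∧ (n : ℝ) < geo n M N ∧
        N ≤ ⌊4 * M * Real.log n⌋₊ + 1 ∧ ∀ i < N + 1, s'.real 5 i = fine n M N i) ∧
      AgreeOff {5, 11, 27} s s') s ((⌊4 * M * Real.log n⌋₊ + 1) * 40 + 40) := by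
  have hw : fineGrid.WritesIn {5, 11, 27} := by simp [fineGrid, Prog.WritesIn]
  refine wp.frame ?_ hw
  have hn' : (0 : ℝ) < n := by exact_mod_cast hn0
  have hM1' : (1 : ℝ) ≤ M := by exact_mod_cast hM1
  set Z := ⌊4 * M * Real.log n⌋₊ + 1
  let J : Memory → Prop := fun s' => s'.nat 0 0 = n ∧ s'.nat 10 0 = M ∧ s'.nat 27 0 ≤ Z ∧
    s'.real 27 0 = geo n M (s'.nat 27 0) ∧ ∀ i < s'.nat 27 0, s'.real 5 i = geo n M i
  have hloop := wp_loop (b := .not (.realLt nE (.get 27 (.lit 0))))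
    (p := .seq (.setReal 5 (nvar 27) (.get 27 (.lit 0)))
        (.seq (.setReal 27 (.lit 0) (.mul (.get 27 (.lit 0)) (.add oneE (.div oneE fineE))))
          (incr 27))) (B := 25) J (fun s' => Z - s'.nat 27 0) (by
      rintro s' ⟨h1, h2, h3, h4, h5⟩ hlt
      simp only [Cond.Holds, RealExpr.eval, NatExpr.eval, h1, h4, not_lt] at hlt
      have hZ : s'.nat 27 0 < Z := Nat.lt_succ_of_le (Nat.le_floor (le_of_geo_le hn' hM1' hlt))
      refine (wp_setReal_seq (wp_setReal_seq (wp_setNat ⟨⟨?_, ?_, ?_, ?_, ?_⟩, ?_⟩))).mono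
        (fun _ h => h) (by simp [NatExpr.cost, RealExpr.cost])
      · simp [Memory.writeNat_nat, h1]
      · simp [Memory.writeNat_nat, h2]
      · simpa [Memory.writeNat_nat, NatExpr.eval] using hZ
      · simp [Memory.writeNat_nat, Memory.writeReal_real, NatExpr.eval, RealExpr.eval, h2, h4, geo,
          pow_succ]
        ring
      · intro i hi
        simp only [Memory.writeNat_nat, NatExpr.eval, and_self, if_true, Memory.writeReal_nat] at hi
        rcases Nat.lt_succ_iff_lt_or_eq.1 hi with hlt | rfl
        · simp [Memory.writeReal_real, NatExpr.eval, RealExpr.eval, hlt.ne, h5 i hlt]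
        · simp [Memory.writeReal_real, NatExpr.eval, RealExpr.eval, h4]
      · simp only [Memory.writeNat_nat, NatExpr.eval, and_self, if_true, Memory.writeReal_nat]
        omega)
  refine wp.mono (wp_setNat_seq (wp_setReal_seq (wp_seq (hloop _ ⟨?_, ?_, ?_, ?_, ?_⟩)
    (B₂ := 16) ?_))) (fun _ h => h) ?_
  · simp [Memory.writeNat_nat, hn]
  · simp [Memory.writeNat_nat, hM]
  · simp [Memory.writeNat_nat, NatExpr.eval]
  · simp [Memory.writeNat_nat, Memory.writeReal_real, NatExpr.eval, RealExpr.eval, geo, hn]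
  · simp [Memory.writeNat_nat, NatExpr.eval]
  · rintro s' ⟨⟨h1, h2, h3, h4, h5⟩, h6⟩
    simp only [Cond.Holds, RealExpr.eval, NatExpr.eval, h1, h4, not_not] at h6
    refine (wp_setReal_seq (wp_setNat ⟨s'.nat 27 0, ?_, h6, h3, ?_⟩)).mono (fun _ h => h)
      (by simp [NatExpr.cost, RealExpr.cost])
    · simp [Memory.writeNat_nat, NatExpr.eval]
    · intro i hi
      rcases Nat.lt_succ_iff_lt_or_eq.1 hi with hlt | rfl
      · simp [Memory.writeReal_real, NatExpr.eval, hlt.ne, h5 i hlt, fine, hlt]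
      · simp [Memory.writeReal_real, NatExpr.eval, RealExpr.eval, fine, h2]
        ring
  · simp only [NatExpr.cost, Cond.cost, RealExpr.cost, Memory.writeNat_nat, NatExpr.eval, and_self,
      if_true, Memory.writeReal_nat, Nat.reduceAdd]
    omega

/-- Tabulate the quadratic grid. -/
def quadGrid : Prog :=
  .seq (forLoop 25 (nvar 10)
    (.seq (.setReal 6 (nvar 25) (.mul (.mul (.ofNat (.lit 4)) rateE)
        (.mul (.div (.ofNat (.add (nvar 25) (.lit 1))) fineE)
          (.div (.ofNat (.add (nvar 25) (.lit 1))) fineE))))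
      (.setReal 6 (.add (nvar 10) (nvar 25))
        (.mul (.div fineE (.ofNat (.add (nvar 25) (.lit 1))))
          (.div fineE (.ofNat (.add (nvar 25) (.lit 1))))))))
    (.setNat 12 (.lit 0) (.add (nvar 10) (nvar 10)))

theorem quadGrid_wp {n A M : ℕ} {s : Memory} (hn : s.nat 0 0 = n) (hA : s.nat 2 0 = A)
    (hM : s.nat 10 0 = M) :
    wp quadGrid (fun s' => (s'.nat 12 0 = 2 * M ∧
        ∀ j < 2 * M, s'.real 6 j = quad ((A : ℝ) / n) M j) ∧
      AgreeOff {6, 12, 25} s s') s (M * 80 + 20) := by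
  have hw : quadGrid.WritesIn {6, 12, 25} := by simp [quadGrid, forLoop, Prog.WritesIn]
  have hw' : Prog.WritesIn {6} (.seq (.setReal 6 (nvar 25) (.mul (.mul (.ofNat (.lit 4)) rateE)
        (.mul (.div (.ofNat (.add (nvar 25) (.lit 1))) fineE)
          (.div (.ofNat (.add (nvar 25) (.lit 1))) fineE))))
      (.setReal 6 (.add (nvar 10) (nvar 25))
        (.mul (.div fineE (.ofNat (.add (nvar 25) (.lit 1))))
          (.div fineE (.ofNat (.add (nvar 25) (.lit 1))))))) := ⟨rfl, rfl⟩
  refine wp.frame ?_ hw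
  refine wp.mono (wp_seq (wp_forLoop (S := {6}) M (fun k s' => ∀ j < k,
    s'.real 6 j = quad ((A : ℝ) / n) M j ∧ s'.real 6 (M + j) = quad ((A : ℝ) / n) M (M + j))
    (by simp) (B := 66) ?_ hw' (by simp) ?_) (B₂ := 8) ?_) (fun _ h => h) ?_
  · intro s' hs'
    simp only [NatExpr.eval, (hs' 10 (by simp)).1, hM]
  · intro k hk s' hs' hk' hinv
    have e0 : s'.nat 0 0 = n := by rw [(hs' 0 (by simp)).1, hn]
    have e2 : s'.nat 2 0 = A := by rw [(hs' 2 (by simp)).1, hA]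
    have e10 : s'.nat 10 0 = M := by rw [(hs' 10 (by simp)).1, hM]
    refine (wp_setReal_seq (wp_setReal ?_)).mono (fun _ h => h)
      (by simp [NatExpr.cost, RealExpr.cost])
    intro j hj
    simp only [Memory.writeNat_real, Memory.writeReal_real, NatExpr.eval, RealExpr.eval,
      Memory.writeReal_nat, true_and, hk', e0, e2, e10]
    rcases Nat.lt_succ_iff_lt_or_eq.1 hj with hlt | rfl
    · obtain ⟨g1, g2⟩ := hinv j hlt
      rw [if_neg (by omega), if_neg (by omega), if_neg (by omega), if_neg (by omega)]
      exact ⟨g1, g2⟩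
    · rw [if_neg (by omega), if_pos rfl, if_pos rfl, quad, quad, if_pos hk, if_neg (by omega),
        Nat.add_sub_cancel_left]
      exact ⟨by push_cast; ring, by push_cast; ring⟩
  · rintro s' ⟨h1, h2⟩
    have e10 : s'.nat 10 0 = M := by rw [(h2 10 (by simp)).1, hM]
    refine (wp_setNat ⟨?_, fun j hj => ?_⟩).mono (fun _ h => h) (by simp [NatExpr.cost])
    · simp [Memory.writeNat_nat, NatExpr.eval, e10]; ring
    · rw [Memory.writeNat_real]
      by_cases hj' : j < M
      · exact (h1 j hj').1
      · have := (h1 (j - M) (by omega)).2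
        rwa [show M + (j - M) = j by omega] at this
  · simp only [NatExpr.cost, Nat.add_assoc, Nat.reduceAdd]
    omega

end RectScan

namespace RectScan
open RealRAM

/-! ### The whole program -/

/-- The scan with support constant at most `k` and `W` time windows. -/
noncomputable def scan (k : ℕ) (W : NatExpr) : Prog :=
  .seq countOnes (.seq findFineness (.seq fineGrid (.seq quadGrid (.seq arrange
    (.seq (directions k W) output)))))

/-- The constant in the bound for `directionsCost`. -/
noncomputable def scanConst (k cW : ℕ) : ℕ :=
  2 * (6 * nodeCost k + (query k).bound + 247 + 2 * cW) + 100

/-! ### Counting steps -/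

theorem sweepCost_le {k h n W cW L : ℕ} (hm : 2 ^ h ≤ 2 * n) (hL : h + 1 ≤ L) (hn : 1 ≤ n)
    (hW : 1 ≤ W) :
    sweepCost k h n W cW ≤
      W * n ^ 2 * L * (6 * nodeCost k + (query k).bound + 247 + 2 * cW) := by
  have hL1 : 1 ≤ L := by omega
  have hnL : 1 ≤ n * L := Nat.mul_pos hn hL1
  have h1 : slabsCost k h n ≤ n * L * (6 * nodeCost k + (query k).bound + 207) := by
    have e1 : (2 * 2 ^ h + 1) * nodeCost k ≤ (5 * (n * L)) * nodeCost k :=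
      Nat.mul_le_mul_right _ (by nlinarith)
    have e2 : n * ((h + 1) * nodeCost k) ≤ n * (L * nodeCost k) :=
      Nat.mul_le_mul_left _ (Nat.mul_le_mul_right _ hL)
    have e3 : n ≤ n * L := Nat.le_mul_of_pos_right _ hL1
    have e4 : n * (query k).bound ≤ n * L * (query k).bound := Nat.mul_le_mul_right _ e3
    unfold slabsCost advanceCost
    calc _ ≤ 92 * (n * L) + 13 * (n * L) + (5 * (n * L) * nodeCost k +
          (n * (L * nodeCost k) + n * L * (query k).bound + 92 * (n * L) + 10 * (n * L))) := by
          linarith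
      _ = _ := by ring
  have h2 : 1 ≤ n ^ 2 * L := by rw [sq, mul_assoc]; exact Nat.mul_pos hn hnL
  have h3 : 1 ≤ W * (n ^ 2 * L) := Nat.mul_pos hW h2
  have h4 : n * slabsCost k h n ≤ n ^ 2 * L * (6 * nodeCost k + (query k).bound + 207) :=
    (Nat.mul_le_mul_left n h1).trans_eq (by ring)
  have h5 : n ≤ n ^ 2 * L := by rw [sq, mul_assoc]; exact Nat.le_mul_of_pos_right _ hnL
  have h6 : n * (slabsCost k h n + 12) + 10 + cW + 10 ≤
      n ^ 2 * L * (6 * nodeCost k + (query k).bound + 239 + cW) := by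
    have : cW ≤ n ^ 2 * L * cW := Nat.le_mul_of_pos_left _ h2
    linarith
  have h7 := Nat.mul_le_mul_left W h6
  have h8 : cW + 8 ≤ W * (n ^ 2 * L) * (cW + 8) := Nat.le_mul_of_pos_left _ h3
  unfold sweepCost
  calc _ ≤ W * (n ^ 2 * L * (6 * nodeCost k + (query k).bound + 239 + cW)) +
        W * (n ^ 2 * L) * (cW + 8) := by linarith
    _ = _ := by ring

theorem directionsCost_le {k h n W cW I J L : ℕ} (hm : 2 ^ h ≤ 2 * n) (hL : h + 1 ≤ L)
    (hn : 1 ≤ n) (hW : 1 ≤ W) (hI : 1 ≤ I) (hJ : 1 ≤ J) :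
    directionsCost k h n W cW I J ≤ I * J * (W * n ^ 2 * L) * scanConst k cW := by
  have h1 := sweepCost_le (k := k) (cW := cW) hm hL hn hW
  have hX : 1 ≤ W * n ^ 2 * L :=
    Nat.mul_pos (Nat.mul_pos hW (pow_pos hn 2)) (by omega)
  set X := W * n ^ 2 * L
  set κ := 6 * nodeCost k + (query k).bound + 247 + 2 * cW with hκ
  have hIJ : 1 ≤ I * J := Nat.mul_pos hI hJ
  have h2 : I * J * (2 * sweepCost k h n W cW) ≤ I * J * (2 * (X * κ)) :=
    Nat.mul_le_mul_left _ (by omega)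
  have h3 : I ≤ I * J := Nat.le_mul_of_pos_right _ hJ
  have h4 : I * J ≤ I * J * X := Nat.le_mul_of_pos_right _ hX
  rw [scanConst, ← hκ, directionsCost]
  linarith

theorem log_two_mul_le {n : ℕ} (hn : 2 ≤ n) :
    ((Nat.log 2 (2 * n) + 1 : ℕ) : ℝ) ≤ 5 * Real.log n := by
  have h2 := Real.log_two_gt_d9
  have hn' : (2 : ℝ) ≤ n := by exact_mod_cast hn
  have hl : Real.log 2 ≤ Real.log n := Real.log_le_log (by norm_num) hn'
  have h1 : ((2 : ℝ)) ^ Nat.log 2 (2 * n) ≤ 2 * n := by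
    exact_mod_cast Nat.pow_log_le_self 2 (show 2 * n ≠ 0 by omega)
  have h3 := Real.log_le_log (by positivity) h1
  rw [Real.log_pow, Real.log_mul (by norm_num) (by positivity)] at h3
  push_cast
  set x : ℝ := (Nat.log 2 (2 * n) : ℝ)
  have hx : 0 ≤ x := Nat.cast_nonneg _
  nlinarith

/-- The constant in the bound for the number of steps. -/
noncomputable def timeConst (c κ : ℝ) : ℝ :=
  70 * (2 + 34 * c) * κ + 3 * (586 + 24 * (17 * c + 1)) + 60 + 645 * (2 + 34 * c)

/-- Every term is compared with `x = μ W n² ℓ²`, where `μ = max 1 (1/ε)` and `ℓ = log n ≥ 2/3`, so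
lower powers of `ℓ` are absorbed. The main term has `(N + 1) (2 M) ≤ 14 M² ℓ` pairs of odds, with
`M² ≤ H μ`, and depth `L ≤ 5 ℓ`; hence the factor `70`. -/
theorem scan_time {n M N L W κ : ℕ} {c ε : ℝ} (hn : 2 ≤ n) (hM1 : 1 ≤ M) (hW : 1 ≤ W)
    (hε : 0 < ε) (hc : 0 < c) (hMH : (M : ℝ) ^ 2 ≤ 2 + 34 * c / ε)
    (hNb : N ≤ ⌊4 * M * Real.log n⌋₊ + 1) (hL : (L : ℝ) ≤ 5 * Real.log n) :
    ((n * 24 + 17 + (⌈17 * c / ε⌉₊ * 24 + 20 + ((⌊4 * M * Real.log n⌋₊ + 1) * 40 + 40 +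
      (M * 80 + 20 + (500 * n ^ 2 + ((N + 1) * (2 * M) * (W * n ^ 2 * L) * κ + 25))))) : ℕ) : ℝ) ≤
      timeConst c κ * max 1 (1 / ε) * W * (n : ℝ) ^ 2 * Real.log n ^ 2 := by
  have hn' : (2 : ℝ) ≤ n := by exact_mod_cast hn
  have hM1' : (1 : ℝ) ≤ M := by exact_mod_cast hM1
  have hW1 : (1 : ℝ) ≤ W := by exact_mod_cast hW
  have hNb' : (N : ℝ) ≤ (⌊4 * M * Real.log n⌋₊ : ℕ) + 1 := by exact_mod_cast hNb
  have hℓ : (1 : ℝ) ≤ 3 / 2 * Real.log n := by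
    have := Real.log_two_gt_d9
    have := Real.log_le_log (by norm_num) hn'
    linarith
  generalize Real.log n = ℓ at *
  have hℓ0 : 0 < ℓ := by linarith
  have hfl : ((⌊4 * M * ℓ⌋₊ : ℕ) : ℝ) ≤ 4 * M * ℓ := Nat.floor_le (by positivity)
  have hcl : ((⌈17 * c / ε⌉₊ : ℕ) : ℝ) ≤ 17 * c / ε + 1 :=
    (Nat.ceil_lt_add_one (by positivity)).le
  have hμ1 : 1 ≤ max 1 (1 / ε) := le_max_left _ _
  have hμε : 1 / ε ≤ max 1 (1 / ε) := le_max_right _ _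
  push_cast
  generalize ((⌊4 * M * ℓ⌋₊ : ℕ) : ℝ) = f at *
  generalize ((⌈17 * c / ε⌉₊ : ℕ) : ℝ) = g at *
  generalize max 1 (1 / ε) = μ at *
  generalize (n : ℝ) = n at *
  generalize (M : ℝ) = M at *
  generalize (N : ℝ) = N at *
  generalize (W : ℝ) = W at *
  have hκ : (0 : ℝ) ≤ κ := Nat.cast_nonneg _
  generalize (κ : ℝ) = κ at *
  have hL0 : (0 : ℝ) ≤ L := Nat.cast_nonneg _
  generalize (L : ℝ) = L at *
  have hce : c / ε ≤ c * μ := by rw [div_eq_mul_one_div]; gcongr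
  have hcμ : c ≤ c * μ := le_mul_of_one_le_right hc.le hμ1
  unfold timeConst
  set H : ℝ := 2 + 34 * c with hH
  have hH0 : 0 < H := by positivity
  have hMH' : M ^ 2 ≤ H * μ := by
    rw [mul_div_assoc] at hMH
    rw [hH]
    linarith
  have hMM : M ≤ M ^ 2 := by rw [sq]; exact le_mul_of_one_le_left (by linarith) hM1'
  have hMℓ : 1 ≤ 3 / 2 * (M * ℓ) := hℓ.trans (by
    gcongr; exact le_mul_of_one_le_left hℓ0.le hM1')
  have hMMℓ : M ≤ 3 / 2 * (M * ℓ) := by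
    have := mul_le_mul_of_nonneg_left hℓ (by linarith : 0 ≤ M)
    linarith
  have hNr : N + 1 ≤ 7 * (M * ℓ) := by linarith
  have hℓ1 : ℓ ≤ 3 / 2 * ℓ ^ 2 := by
    have := mul_le_mul_of_nonneg_left hℓ hℓ0.le
    linarith
  have hℓ2 : 1 ≤ 3 * ℓ ^ 2 := by linarith
  have hn2 : 1 ≤ n ^ 2 := one_le_pow₀ (by linarith)
  have hWn : 1 ≤ W * n ^ 2 := one_le_mul_of_one_le_of_one_le hW1 hn2
  have hμW : 1 ≤ μ * W := one_le_mul_of_one_le_of_one_le hμ1 hW1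
  obtain ⟨x, hx⟩ : ∃ x, x = μ * W * n ^ 2 * ℓ ^ 2 := ⟨_, rfl⟩
  have hμℓ : μ * ℓ ^ 2 ≤ x := by
    have h := le_mul_of_one_le_right (by positivity : 0 ≤ μ * ℓ ^ 2) hWn
    rw [hx]; linarith
  have hμx : μ ≤ 3 * x := by
    have := le_mul_of_one_le_right (by linarith : 0 ≤ μ) hℓ2
    linarith
  have hn2x : n ^ 2 ≤ 3 * x := by
    have h := le_mul_of_one_le_right (by positivity : 0 ≤ n ^ 2)
      (one_le_mul_of_one_le_of_one_le hμW hℓ2)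
    rw [hx]; linarith
  have hx0 : 0 ≤ x := by linarith
  have hMℓx : M * ℓ ≤ 3 / 2 * (H * x) := by
    have h1 : M * ℓ ≤ H * μ * (3 / 2 * ℓ ^ 2) :=
      mul_le_mul (hMM.trans hMH') hℓ1 hℓ0.le (by positivity)
    have := mul_le_mul_of_nonneg_left hμℓ hH0.le
    linarith
  have e₂ : (24 * (17 * c + 1)) * μ ≤ (24 * (17 * c + 1)) * (3 * x) := by gcongr
  have hg : g ≤ (17 * c + 1) * μ := by
    rw [mul_div_assoc] at hcl
    linarith
  have hnn : n ≤ n ^ 2 := by rw [sq]; exact le_mul_of_one_le_left (by linarith) (by linarith)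
  have e₆ : (N + 1) * (2 * M) * (W * n ^ 2 * L) * κ ≤ 70 * H * κ * x := by
    have h2 : (N + 1) * (2 * M) ≤ 14 * (H * μ * ℓ) := by
      calc (N + 1) * (2 * M) ≤ 7 * (M * ℓ) * (2 * M) := by gcongr
        _ = 14 * (M ^ 2 * ℓ) := by ring
        _ ≤ 14 * (H * μ * ℓ) := by gcongr
    calc (N + 1) * (2 * M) * (W * n ^ 2 * L) * κ
        ≤ 14 * (H * μ * ℓ) * (W * n ^ 2 * (5 * ℓ)) * κ := by gcongr
      _ = _ := by rw [hx]; ring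
  have : (70 * H * κ + 3 * (586 + 24 * (17 * c + 1)) + 60 + 645 * H) * μ * W * n ^ 2 * ℓ ^ 2 =
      70 * H * κ * x + 3 * (586 * x) + 24 * (17 * c + 1) * (3 * x) + 60 * x + 645 * (H * x) := by
    rw [hx]; ring
  rw [this]
  linarith

theorem scan_runs {C c : ℝ} (hC : 0 < C) (hc : 0 < c) {k : ℕ} (hk : C ≤ k) (W : NatExpr) :
    ∃ K : ℝ, ∀ (D : Inst) (ε : ℝ) (s : Memory) (W' : ℕ), 2 ≤ D.n → 0 < ε → (∀ i, D.b i ≤ 1) →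
      Loaded D C c s → s.real 3 0 = ε → (∀ l, s.nat 8 l = 0) → (∀ l, s.nat 9 l = 0) →
      s.nat 30 0 = 0 → 1 ≤ W' → (∀ s : Memory, s.nat 0 0 = D.n → W.eval s = W') →
      TimesSuffice D W' →
      ∃ s' T, Runs (scan k W) s s' T ∧
        (T : ℝ) ≤ K * max 1 (1 / ε) * W' * (D.n : ℝ) ^ 2 * Real.log D.n ^ 2 ∧
        ∀ x₀ x₁ x₂ x₃ τ,
          Supp C D.n D.A (D.region x₀ x₁ x₂ x₃ τ).card (D.ones (D.region x₀ x₁ x₂ x₃ τ)) →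
          Valid D C c (s'.real 4 0) (s'.real 4 1) (s'.real 4 2) (s'.real 4 3) (s'.real 4 4)
            (s'.real 4 5) ∧
          disc c D.n D.A (D.region x₀ x₁ x₂ x₃ τ).card (D.ones (D.region x₀ x₁ x₂ x₃ τ)) ≤
            s'.real 4 4 + ε := by
  refine ⟨timeConst c (scanConst k W.cost), ?_⟩
  intro D ε s W' hn hε hb hs hs0 h8 h9 h30 hW' hW hT
  have hn0 : 0 < D.n := by omega
  obtain ⟨s₁, T₁, r₁, t₁, hA, a₁⟩ := countOnes_wp hs.n_eq hs.b_eq hb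
  have l₁ := hs.of_agreeOff a₁ (by simp) (by simp) (.inr ?_) (.inl (by simp))
  swap
  · exact r₁.real_eq (by simp [countOnes, countIf, forLoop, Prog.NatOnly])
  obtain ⟨s₂, T₂, r₂, t₂, ⟨M, hM1, hM, hMε, hMH⟩, a₂⟩ := findFineness_wp (s := s₁) hε hc
    (by rw [(a₁ 3 (by simp)).2, hs0]) l₁.c_eq
  have l₂ := l₁.of_agreeOff a₂ (by simp) (by simp) (.inl (by simp)) (.inl (by simp))
  obtain ⟨s₃, T₃, r₃, t₃, ⟨N, hI, hN, hNb, hf⟩, a₃⟩ := fineGrid_wp l₂.n_eq hn0 hM1 hM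
  have l₃ := l₂.of_agreeOff a₃ (by simp) (by simp) (.inl (by simp)) (.inl (by simp))
  have hA₃ : s₃.nat 2 0 = D.A := by rw [(a₃ 2 (by simp)).1, (a₂ 2 (by simp)).1, hA]
  obtain ⟨s₄, T₄, r₄, t₄, ⟨hJ, hq⟩, a₄⟩ := quadGrid_wp (M := M) l₃.n_eq hA₃
    (by rw [(a₃ 10 (by simp)).1, hM])
  have l₄ := l₃.of_agreeOff a₄ (by simp) (by simp) (.inl (by simp)) (.inl (by simp))
  have z : ∀ a, a ∉ ({2, 5, 6, 10, 11, 12, 23, 24, 25, 27} : Set ℕ) → s₄.nat a = s.nat a :=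
    fun a ha => by
      simp only [Set.mem_insert_iff, Set.mem_singleton_iff, not_or] at ha
      rw [(a₄ a (by simp; omega)).1, (a₃ a (by simp; omega)).1, (a₂ a (by simp; omega)).1,
        (a₁ a (by simp; omega)).1]
  obtain ⟨s₅, T₅, r₅, t₅, ⟨⟨h, ox, oy, hst, hox, hoy, hm, hm2⟩, hre⟩, a₅⟩ :=
    arrange_wp l₄ hn0 (by rw [(a₄ 2 (by simp)).1, hA₃]) (by rw [z 8 (by simp)]; exact h8)
      (by rw [z 9 (by simp)]; exact h9)
  have hp : Params D C k h ox oy W W' := ⟨hC, hn0, hk, hb, hm, hox, hoy, hT, hW⟩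
  -- The flag of the record is still `0`, so nothing has been claimed yet.
  have hbest : BestOK (Valid D C c) s₅ := fun h => absurd (by
    rw [(a₅ 30 (by simp)).1, z 30 (by simp), h30]) h
  obtain ⟨s₆, T₆, r₆, t₆, hbest', hcov⟩ := directions_wp hp hst hbest (I := N + 1) (J := 2 * M)
    (by rw [(a₅ 11 (by simp)).1, (a₄ 11 (by simp)).1, hI])
    (by rw [(a₅ 12 (by simp)).1, hJ]) rfl rfl
  obtain ⟨s₇, T₇, r₇, t₇, hout⟩ := output_wp s₆
  have hn' : (2 : ℝ) ≤ D.n := by exact_mod_cast hn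
  have hM1' : (1 : ℝ) ≤ M := by exact_mod_cast hM1
  refine ⟨s₇, _, .seq r₁ (.seq r₂ (.seq r₃ (.seq r₄ (.seq r₅ (.seq r₆ r₇))))), ?_, ?_⟩
  · have hL : h + 1 ≤ Nat.log 2 (2 * D.n) + 1 :=
      Nat.succ_le_succ (Nat.le_log_of_pow_le (by norm_num) hm2)
    have hd := t₆.trans (directionsCost_le hm2 hL hn0 hW' (Nat.le_add_left 1 N)
      (by omega : 1 ≤ 2 * M))
    have ht := scan_time (κ := scanConst k W.cost) hn hM1 hW' hε hc hMH hNb (log_two_mul_le hn)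
    refine le_trans ?_ ht
    exact_mod_cast Nat.add_le_add t₁ (Nat.add_le_add t₂ (Nat.add_le_add t₃ (Nat.add_le_add t₄
      (Nat.add_le_add t₅ (Nat.add_le_add hd t₇)))))
  · intro x₀ x₁ x₂ x₃ τ hS
    have hsp := directions_spec hp hc hM1 hN (s := s₆) (fun i hi j hj => by
      have e5 : s₅.real 5 i = fine D.n M N i := by
        rw [hre, (a₄ 5 (by simp)).2, hf i hi]
      have e6 : s₅.real 6 j = quad ((D.A : ℝ) / D.n) M j := by
        rw [hre, hq j hj]
      rw [← e5, ← e6]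
      exact hcov i hi j hj) hS
    have o := fun i hi => hout i hi
    refine ⟨?_, ?_⟩
    · rw [o 0 (by norm_num), o 1 (by norm_num), o 2 (by norm_num), o 3 (by norm_num),
        o 4 (by norm_num), o 5 (by norm_num)]
      exact hbest' hsp.1
    · rw [o 4 (by norm_num)]
      refine hsp.2.trans ?_
      have : c * 17 / (M : ℝ) ^ 2 ≤ ε := by
        rw [div_le_iff₀ (by positivity)]
        nlinarith
      linarith

end RectScan

namespace RectScan
open RealRAM BernoulliScan

/-! ### The input -/

/-- The instance held by a memory. -/
def instOf (n : ℕ) (s : Memory) : Inst := ⟨n, s.nat 1, s.real 0, s.real 1, s.real 2⟩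

section

variable {n : ℕ} (ε C c : ℝ) (pos : Fin n → ℝ × ℝ) (t : Fin n → ℝ) (y : Fin n → Bool)

theorem load_b (i : ℕ) :
    (instOf n (load ε C c pos t y)).b i = toArray 0 (fun j => if y j = true then 1 else 0) i := rfl

theorem load_b_le (i : ℕ) : (instOf n (load ε C c pos t y)).b i ≤ 1 := by
  rw [load_b, toArray]
  split_ifs <;> simp

theorem load_T (i : Fin n) : (instOf n (load ε C c pos t y)).T i = t i := by
  simp [instOf, load, toArray]

/-- Entries beyond `n` hold the default `0`, which is harmless since regions contain only indices
below `n`. -/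
theorem load_region (p q : ℝ × ℝ) (τ : ℝ) :
    (instOf n (load ε C c pos t y)).region p.1 p.2 q.1 q.2 τ =
      (inWindow pos t p q τ).map Fin.valEmbedding := by
  ext i
  simp only [Inst.region, inWindow, Finset.mem_filter, Finset.mem_range, Finset.mem_map,
    Finset.mem_univ, true_and, Fin.valEmbedding_apply, Set.mem_Icc, Prod.le_def]
  constructor
  · rintro ⟨hi, ⟨⟨h1, h2⟩, h3, h4⟩, h5⟩
    replace hi : i < n := hi
    simp only [instOf, load, toArray, hi, dif_pos] at h1 h2 h3 h4 h5
    exact ⟨⟨i, hi⟩, ⟨⟨⟨h1, h3⟩, h2, h4⟩, h5⟩, rfl⟩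
  · rintro ⟨⟨j, hj⟩, ⟨⟨⟨h1, h3⟩, h2, h4⟩, h5⟩, rfl⟩
    simp only [instOf, load, toArray, hj, dif_pos]
    exact ⟨trivial, ⟨⟨h1, h2⟩, h3, h4⟩, h5⟩

theorem load_ones (S : Finset (Fin n)) :
    (instOf n (load ε C c pos t y)).ones (S.map Fin.valEmbedding) = ones y S := by
  rw [Inst.ones, Finset.sum_map, ones, Finset.card_filter]
  refine Finset.sum_congr rfl fun i _ => ?_
  rw [load_b, toArray, Fin.valEmbedding_apply, dif_pos i.2]

theorem load_A : (instOf n (load ε C c pos t y)).A = ones y Finset.univ := by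
  rw [← load_ones ε C c pos t y, Inst.ones, Fin.map_valEmbedding_univ, Inst.A]
  refine Finset.sum_congr ?_ fun _ _ => rfl
  ext i
  simp [instOf]

theorem load_supp (p q : ℝ × ℝ) (τ : ℝ) :
    Supp C (instOf n (load ε C c pos t y)).n (instOf n (load ε C c pos t y)).A
      ((instOf n (load ε C c pos t y)).region p.1 p.2 q.1 q.2 τ).card
      ((instOf n (load ε C c pos t y)).ones
        ((instOf n (load ε C c pos t y)).region p.1 p.2 q.1 q.2 τ)) ↔
      Supported C y (inWindow pos t p q τ) := by
  rw [load_region, load_ones, load_A, Finset.card_map]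
  rfl

theorem load_disc (p q : ℝ × ℝ) (τ : ℝ) :
    disc c (instOf n (load ε C c pos t y)).n (instOf n (load ε C c pos t y)).A
      ((instOf n (load ε C c pos t y)).region p.1 p.2 q.1 q.2 τ).card
      ((instOf n (load ε C c pos t y)).ones
        ((instOf n (load ε C c pos t y)).region p.1 p.2 q.1 q.2 τ)) =
      dB c y (inWindow pos t p q τ) := by
  rw [load_region, load_ones, load_A, Finset.card_map]
  rfl

theorem load_loaded : Loaded (instOf n (load ε C c pos t y)) C c (load ε C c pos t y) := by
  constructor <;> simp [instOf, load]

end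

/-- The scan program solves the prospective problem, provided that it tries enough time windows. -/
theorem scan_load {C c : ℝ} (hC : 0 < C) (hc : 0 < c) (W : NatExpr) :
    ∃ (P : Prog) (K : ℝ), ∀ (n : ℕ) (ε : ℝ) (pos : Fin n → ℝ × ℝ) (t : Fin n → ℝ)
      (y : Fin n → Bool) (W' : ℕ), 2 ≤ n → 0 < ε → 1 ≤ W' →
      (∀ s : Memory, s.nat 0 0 = n → W.eval s = W') →
      (∀ τ, (∃ i, τ ≤ t i) → ∃ w : Fin n, w < W' ∧ ∀ i, τ ≤ t i ↔ t w ≤ t i) →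
      ∃ s T, Runs P (load ε C c pos t y) s T ∧
        (T : ℝ) ≤ K * max 1 (1 / ε) * W' * (n : ℝ) ^ 2 * Real.log n ^ 2 ∧
        IsProspectiveApprox ε C c pos t y s := by
  -- Capping at `⌈C⌉` makes the program text and its constants independent of the input.
  obtain ⟨K, hK⟩ := scan_runs hC hc (Nat.le_ceil C) W
  refine ⟨scan ⌈C⌉₊ W, K, fun n ε pos t y W' hn hε hW' hW hT => ?_⟩
  obtain ⟨s, T, h1, h2, h3⟩ := hK (instOf n (load ε C c pos t y)) ε (load ε C c pos t y) W' hn hε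
    (load_b_le ε C c pos t y) (load_loaded ε C c pos t y) (by simp [load]) (by simp [load])
    (by simp [load]) (by simp [load]) hW' hW (by
      rintro τ ⟨i, hi, hτ⟩
      replace hi : i < n := hi
      have hτ' : τ ≤ t ⟨i, hi⟩ := by rwa [← load_T ε C c pos t y]
      obtain ⟨w, hw, hw'⟩ := hT τ ⟨_, hτ'⟩
      refine ⟨w, hw, fun j hj => ?_⟩
      have := hw' ⟨j, hj⟩
      rwa [← load_T ε C c pos t y, ← load_T ε C c pos t y] at this)
  refine ⟨s, T, h1, h2, ?_⟩
  rintro ⟨p, q, τ, hS⟩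
  obtain ⟨h4, -⟩ := h3 p.1 p.2 q.1 q.2 τ ((load_supp ε C c pos t y p q τ).2 hS)
  refine ⟨(load_supp ε C c pos t y (outLow s) (outHigh s) (outTime s)).1 h4.1,
    h4.2.trans (load_disc ε C c pos t y (outLow s) (outHigh s) (outTime s)), fun p q τ hS => ?_⟩
  obtain ⟨-, h5⟩ := h3 p.1 p.2 q.1 q.2 τ ((load_supp ε C c pos t y p q τ).2 hS)
  rwa [load_disc ε C c pos t y] at h5

theorem inWindow_eq_inRect {n : ℕ} (pos : Fin n → ℝ × ℝ) (p q : ℝ × ℝ) {τ : ℝ} (hτ : τ ≤ 0) :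
    inWindow pos (fun _ => 0) p q τ = inRect pos p q := by
  simp [inWindow, inRect, hτ]

theorem nonempty_of_supported {n : ℕ} {C : ℝ} (hC : 0 < C) (hn : 0 < n) {y : Fin n → Bool}
    {S : Finset (Fin n)} (h : Supported C y S) : S.Nonempty := by
  rw [Finset.nonempty_iff_ne_empty]
  rintro rfl
  have h1 := h.2.1
  have hn' : (0 : ℝ) < n := by exact_mod_cast hn
  rw [bFrac, Finset.card_empty, Nat.cast_zero, zero_div] at h1
  have : 0 < C / n := by positivity
  linarith

end RectScan

/-! ### Both problems as instances of the prospective scan -/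

theorem mainTheorem6 (C c : ℝ) (hC : 0 < C) (hc : 0 < c) :
    (∃ (P : RealRAM.Prog) (K : ℝ), ∀ (n : ℕ) (ε : ℝ) (pos : Fin n → ℝ × ℝ) (y : Fin n → Bool),
      2 ≤ n → 0 < ε →
      ∃ (s : RealRAM.Memory) (T : ℕ),
        RealRAM.Runs P (BernoulliScan.load ε C c pos (fun _ => 0) y) s T ∧
        (T : ℝ) ≤ K * max 1 (1 / ε) * (n : ℝ) ^ 2 * Real.log n ^ 2 ∧
        BernoulliScan.IsApprox ε C c pos y s) ∧
    (∃ (P : RealRAM.Prog) (K : ℝ), ∀ (n : ℕ) (ε : ℝ) (pos : Fin n → ℝ × ℝ) (t : Fin n → ℝ)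
        (y : Fin n → Bool),
      2 ≤ n → 0 < ε →
      ∃ (s : RealRAM.Memory) (T : ℕ),
        RealRAM.Runs P (BernoulliScan.load ε C c pos t y) s T ∧
        (T : ℝ) ≤ K * max 1 (1 / ε) * (n : ℝ) ^ 3 * Real.log n ^ 2 ∧
        BernoulliScan.IsProspectiveApprox ε C c pos t y s) := by
  constructor
  -- With all time stamps `0`, rectangles are the windows with `τ ≤ 0`, and a single window start
  -- suffices.
  · obtain ⟨P, K, h⟩ := RectScan.scan_load hC hc (.lit 1)
    refine ⟨P, K, fun n ε pos y hn hε => ?_⟩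
    obtain ⟨s, T, h1, h2, h3⟩ := h n ε pos (fun _ => 0) y 1 hn hε le_rfl (fun _ _ => rfl)
      fun τ ⟨_, hτ⟩ => ⟨⟨0, by omega⟩, by simp, fun _ => ⟨fun _ => le_rfl, fun _ => hτ⟩⟩
    refine ⟨s, T, h1, by simpa using h2, ?_⟩
    rintro ⟨p, q, hS⟩
    rw [← RectScan.inWindow_eq_inRect pos p q le_rfl] at hS
    obtain ⟨h4, h5, h6⟩ := h3 ⟨p, q, 0, hS⟩
    -- The reported region contains a point, whose time stamp `0` is at least the reported start; so
    -- the start does not cut anything off.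
    obtain ⟨i, hi⟩ := RectScan.nonempty_of_supported hC (by omega) h4
    have hτ : BernoulliScan.outTime s ≤ 0 := by
      simp only [BernoulliScan.inWindow, Finset.mem_filter] at hi
      exact hi.2.2
    rw [RectScan.inWindow_eq_inRect pos _ _ hτ] at h4 h5
    refine ⟨h4, h5, fun p q hS => ?_⟩
    rw [← RectScan.inWindow_eq_inRect pos p q le_rfl] at hS ⊢
    exact h6 p q 0 hS
  · obtain ⟨P, K, h⟩ := RectScan.scan_load hC hc (.get 0 (.lit 0))
    refine ⟨P, K, fun n ε pos t y hn hε => ?_⟩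
    obtain ⟨s, T, h1, h2, h3⟩ := h n ε pos t y n hn hε (by omega) (fun _ hs => hs) (by
      rintro τ ⟨i, hi⟩
      -- Any start `τ` can be raised to the smallest time stamp not before it without changing the
      -- window's points.
      obtain ⟨w, hw, hmin⟩ := Finset.exists_min_image (Finset.univ.filter fun i => τ ≤ t i) t
        ⟨i, by simpa using hi⟩
      simp only [Finset.mem_filter, Finset.mem_univ, true_and] at hw hmin
      exact ⟨w, w.2, fun j => ⟨fun hj => hmin j hj, fun hj => hw.trans hj⟩⟩)
    refine ⟨s, T, h1, h2.trans_eq ?_, h3⟩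
    ring
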